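/- Let $\xi_0,\xi_1,\ldots$ be i.i.d. complex random variables on a probability space which are not a.s. constant and satisfy $\mathbb E\log(1+|\xi_0|)<\infty$. Let $(f_{k,n})_{k\ge 0,\,n\ge 1}$ be complex numbers, $f:[0,\infty)\to[0,\infty)$ a function and $T_0\in(0,\infty]$ such that: (A1) $f(t)>0$ for $t<T_0$ and $f(t)=0$ for $t>T_0$; (A2) $f$ is continuous on $[0,T_0)$ and, if $T_0<\infty$, left continuous at $T_0$; (A3) $\lim_{n\to\infty}\sup_{k\in[0,An]}\bigl||f_{k,n}|^{1/n}-f(k/n)\bigr|=0$ for every $A>0$; (A4) $R_0:=\liminf_{t\to\infty}f(t)^{-1/t}\in(0,\infty]$ and $\liminf_{n,\,k/n\to\infty}|f_{k,n}|^{-1/k}\ge R_0$. Put $u(t)=-\log f(t)$ (with $\log 0=-\infty$), assume that $u$ is convex on $(0,T_0)$, and let $I(s)=\sup_{t\ge 0}(st-u(t))$ for $s\in[-\infty,\infty)$ (so that $I(-\infty)=-u(0)$). Let $\kappa\in(0,T_0)$ and consider the random polynomials $$\mathbf G_n^{(\kappa)}(z)=\sum_{k=0}^{[\kappa n]}\xi_k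 f_{k,n}z^k .$$ Let $\mu_{\mathbf G_n^{(\kappa)}}$ be the measure assigning to each complex zero of $\mathbf G_n^{(\kappa)}$ its multiplicity (the zero measure if $\mathbf G_n^{(\kappa)}\equiv 0$). Then there is a unique locally finite Borel measure $\mu^{(\kappa)}$ on $\mathbb C$ such that $\frac1n\int\varphi\,d\mu_{\mathbf G_n^{(\kappa)}}\to\int\varphi\,d\mu^{(\kappa)}$ in probability as $n\to\infty$ for every continuous compactly supported $\varphi:\mathbb C\to\mathbb R$. This limiting zero measure $\mu^{(\kappa)}$ has total mass $\kappa$ and is the unique minimizer of $$J(\nu)=\frac12\int_{\mathbb C}\int_{\mathbb C}\log\frac1{|z-w|}\,\nu(dz)\,\nu(dw)+\int_{\mathbb C}I(\log|z|)\,\nu(dz)\in[-\infty,\infty]$$ among all Borel measures $\nu$ on $\mathbb C$ of total mass $\kappa$, where $J(\nu)=+\infty$ by convention when the expression has the indeterminate form $\infty-\infty$. That is, $\mu^{(\kappa)}$ is the equilibrium measure of mass $\kappa$ in the external field $I(\log|z|)$. -/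

import Mathlib

open MeasureTheory ProbabilityTheory Filter Topology
open scoped ENNReal

namespace ZeroEquilibrium

noncomputable section

/-! ### The random polynomials -/

/-- `ξ 0, ξ 1, …` are i.i.d. complex random variables which are not almost surely constant and
satisfy `E log (1 + |ξ 0|) < ∞`. -/
structure IsCoefficientNoise {Ω : Type*} [MeasurableSpace Ω] (P : Measure Ω) (ξ : ℕ → Ω → ℂ) :
    Prop where
  measurable : ∀ k, Measurable (ξ k)
  indep : iIndepFun ξ P
  ident : ∀ k, IdentDistrib (ξ k) (ξ 0) P P
  nondegenerate : ¬ ∃ c : ℂ, ∀ᵐ ω ∂P, ξ 0 ω = c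
  log_moment : Integrable (fun ω => Real.log (1 + ‖ξ 0 ω‖)) P

/-- The number `R₀ = liminf_{t → ∞} f(t)^{-1/t} ∈ [0, ∞]` (with `0^{-1/t} = ∞`). -/
def radius (f : ℝ → ℝ) : ℝ≥0∞ :=
  liminf (fun t : ℝ => ENNReal.ofReal (f t) ^ (-(1 / t))) atTop

/-- The filter on pairs `(k, n)` along which both `n → ∞` and `k / n → ∞`. -/
def farIndices : Filter (ℕ × ℕ) :=
  comap (fun p : ℕ × ℕ => p.2) atTop ⊓ comap (fun p : ℕ × ℕ => (p.1 : ℝ) / (p.2 : ℝ)) atTop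

/-- The standing assumptions on the deterministic coefficients `a k n` (`k` the degree, `n` the
scale), with profile `f : [0, ∞) → [0, ∞)` and `T₀ ∈ (0, ∞]`. Only the values of `f` on `[0, ∞)`
are used. -/
structure IsCoefficientProfile (a : ℕ → ℕ → ℂ) (f : ℝ → ℝ) (T₀ : EReal) : Prop where
  T₀_pos : 0 < T₀
  nonneg : ∀ t : ℝ, 0 ≤ t → 0 ≤ f t
  pos : ∀ t : ℝ, 0 ≤ t → (t : EReal) < T₀ → 0 < f t
  zero : ∀ t : ℝ, 0 ≤ t → T₀ < (t : EReal) → f t = 0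
  continuousOn : ContinuousOn f {t : ℝ | 0 ≤ t ∧ (t : EReal) < T₀}
  left_continuous : ∀ T : ℝ, (T : EReal) = T₀ → ContinuousWithinAt f (Set.Iic T) T
  /-- `sup_{0 ≤ k ≤ A n} | |a k n|^{1/n} - f (k/n) | → 0` as `n → ∞`, for every `A > 0`. -/
  unif : ∀ A : ℝ, 0 < A → ∀ ε : ℝ, 0 < ε → ∀ᶠ n : ℕ in atTop, ∀ k : ℕ, (k : ℝ) ≤ A * n →
    |‖a k n‖ ^ (1 / (n : ℝ)) - f ((k : ℝ) / (n : ℝ))| ≤ ε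
  radius_pos : 0 < radius f
  radius_le : radius f ≤ liminf (fun p : ℕ × ℕ => ‖a p.1 p.2‖ₑ ^ (-(1 / (p.1 : ℝ)))) farIndices

/-- The truncated random polynomial `∑_{k=0}^{[κ n]} ξ_k a_{k,n} z^k`. -/
def truncatedPoly {Ω : Type*} (ξ : ℕ → Ω → ℂ) (a : ℕ → ℕ → ℂ) (κ : ℝ) (n : ℕ) (ω : Ω) :
    Polynomial ℂ :=
  ∑ k ∈ Finset.range (⌊κ * n⌋₊ + 1), Polynomial.C (ξ k ω * a k n) * Polynomial.X ^ k

/-- The measure giving each zero of `p` a weight equal to its multiplicity (the zero measure if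
`p = 0`). -/
def zeroMeasure (p : Polynomial ℂ) : Measure ℂ :=
  (p.roots.map (fun z => Measure.dirac z)).sum

/-- The random measures `M n` converge in probability, in the vague topology, to the deterministic
locally finite measure `μ`. -/
def TendstoVaguelyInProbability {Ω : Type*} [MeasurableSpace Ω] (P : Measure Ω)
    (M : ℕ → Ω → Measure ℂ) (μ : Measure ℂ) : Prop :=
  IsLocallyFiniteMeasure μ ∧
    ∀ φ : ℂ → ℝ, Continuous φ → HasCompactSupport φ →
      TendstoInMeasure P (fun n ω => ∫ z, φ z ∂(M n ω)) atTop (fun _ => ∫ z, φ z ∂μ)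

/-- `μ` is the limiting zero measure `μ^{(κ)}`: the limit in probability of
`(1/n) ∑_{zeros z of G_n^{(κ)}} δ_z`. -/
def IsLimitingZeroMeasure {Ω : Type*} [MeasurableSpace Ω] (P : Measure Ω)
    (ξ : ℕ → Ω → ℂ) (a : ℕ → ℕ → ℂ) (κ : ℝ) (μ : Measure ℂ) : Prop :=
  TendstoVaguelyInProbability P
    (fun n ω => (n : ℝ≥0∞)⁻¹ • zeroMeasure (truncatedPoly ξ a κ n ω)) μ

/-! ### The external field -/

/-- `u(t) = - log f(t)`, with `log 0 = -∞`. -/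
def negLog (f : ℝ → ℝ) (t : ℝ) : EReal :=
  -ENNReal.log (ENNReal.ofReal (f t))

/-- The Legendre–Fenchel transform `I(s) = sup_{t ≥ 0} (s t - u(t))`, the same formula being used
for real `s` and for `s = -∞` (where it gives `I(-∞) = -u(0)`). -/
def legendre (f : ℝ → ℝ) (s : EReal) : EReal :=
  ⨆ t : Set.Ici (0 : ℝ), s * ((t : ℝ) : EReal) - negLog f t

/-- The external field `z ↦ I(log |z|)`, with `log |0| = -∞`. -/
def externalField (f : ℝ → ℝ) (z : ℂ) : EReal :=
  legendre f (ENNReal.log ‖z‖ₑ)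

/-! ### Weighted logarithmic energy -/

/-- The logarithmic kernel `log (1 / |z - w|)`, equal to `+∞` on the diagonal. -/
def logKernel (z w : ℂ) : EReal :=
  -ENNReal.log ‖z - w‖ₑ

/-- The contribution of the positive parts of the integrands to `weightedEnergy`. -/
def energyPos (Q : ℂ → EReal) (ν : Measure ℂ) : ℝ≥0∞ :=
  2⁻¹ * (∫⁻ z, ∫⁻ w, (logKernel z w).toENNReal ∂ν ∂ν) + ∫⁻ z, (Q z).toENNReal ∂ν

/-- The contribution of the negative parts of the integrands to `weightedEnergy`. -/
def energyNeg (Q : ℂ → EReal) (ν : Measure ℂ) : ℝ≥0∞ :=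
  2⁻¹ * (∫⁻ z, ∫⁻ w, (-logKernel z w).toENNReal ∂ν ∂ν) + ∫⁻ z, (-Q z).toENNReal ∂ν

open scoped Classical in
/-- The weighted logarithmic energy
`J(ν) = ½ ∬ log (1 / |z - w|) dν(z) dν(w) + ∫ Q(z) dν(z) ∈ [-∞, ∞]`,
where an infinite integral of positive parts gives `J(ν) = +∞`; in particular the indeterminate
form `∞ - ∞` is read as `+∞`. No integral is ever replaced by a default value. -/
def weightedEnergy (Q : ℂ → EReal) (ν : Measure ℂ) : EReal :=
  if energyPos Q ν = ∞ then ⊤ else (energyPos Q ν : EReal) - (energyNeg Q ν : EReal)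

/-- `μ` is the equilibrium measure of mass `κ` in the external field `Q`: it is the unique minimizer
of the weighted logarithmic energy among all Borel measures on `ℂ` of total mass `κ`. -/
def IsEquilibriumMeasure (Q : ℂ → EReal) (κ : ℝ) (μ : Measure ℂ) : Prop :=
  μ Set.univ = ENNReal.ofReal κ ∧
    ∀ ν : Measure ℂ, ν Set.univ = ENNReal.ofReal κ → ν ≠ μ →
      weightedEnergy Q μ < weightedEnergy Q ν

end

end ZeroEquilibrium

open MeasureTheory ProbabilityTheory Filter Topology
open scoped ENNReal

namespace ZeroEquilibrium

open scoped RealInnerProductSpace ComplexConjugate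

/-! Write v = -log f and V(z) = sup over 0 ≤ t ≤ κ of t log|z| - v(t). The k-th term of the
polynomial has modulus about exp(n (t log|z| - v(t))) with t = k/n, so (1/n) log|G_n| should be
close to V. The upper bound holds simultaneously for all z with high probability, because the
logarithmic moment makes every noise variable at most exp(δn) (`tendsto_measure_upper`). The lower
bound is needed only at finitely many nonzero points. There a positive proportion of the terms is
nearly maximal, and `exists_anticoncentration` says that a sum with many large independent terms is
rarely small (`tendsto_measure_lower`).

These one-sided bounds suffice. Since log|p| has the sub-mean value property, a lower bound at the
points of a fine grid and an upper bound on a disc force L¹ closeness to V. L¹ closeness of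
potentials up to a constant forces vague closeness of the measures (`exists_vague_stability`).

Convexity identifies the limit. The right derivative v' is nondecreasing, and the supremum defining
V equals ∫ log max(exp v'(t), |z|) dt over (0, κ] minus v(κ) (`le_radialPotential`,
`exists_radialPotential_eq`). By Jensen's formula this is, up to the constant v(κ), the logarithmic
potential of the rotationally invariant measure μ of mass κ with radii exp v'(t)
(`radialPotential_eq`).

For the variational statement, the field Q(z) = I(log|z|) is a supremum over more t than V, so Q ≥
V. Equality holds for |z| ≤ exp v'(κ), hence μ-almost everywhere. Replacing Q by V therefore only
lowers the energy of a competitor ν and does not lower that of μ. With V as field, the energy of ν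
minus that of μ is half the logarithmic energy of ν - μ. This is strictly positive for equal masses
by `logEnergy_sub_pos`: Frullani's integral writes -log as a superposition of Gaussians, and each
Gaussian energy is a weighted L² norm of a difference of characteristic functions. -/

/-! ### The Gaussian weight and anticoncentration -/

/-- The unnormalised standard Gaussian measure `exp (-‖s‖² / 2) ds` on `ℂ`. -/
noncomputable def gaussianWeight : Measure ℂ :=
  volume.withDensity (fun s : ℂ => ENNReal.ofReal (Real.exp (-(‖s‖ ^ 2 / 2))))

lemma gaussianWeight_ac : gaussianWeight ≪ volume := withDensity_absolutelyContinuous _ _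

lemma ac_gaussianWeight : (volume : Measure ℂ) ≪ gaussianWeight := by
  refine withDensity_absolutelyContinuous' (by fun_prop) (ae_of_all _ fun s => ?_)
  simp [Real.exp_pos]

lemma integrable_gaussian : Integrable (fun s : ℂ => Real.exp (-(‖s‖ ^ 2 / 2))) := by
  have := GaussianFourier.integrable_cexp_neg_mul_sq_norm_add (V := ℂ) (b := 1 / 2) (by norm_num)
    0 0
  have h2 := this.norm
  refine h2.congr (ae_of_all _ fun s => ?_)
  simp only [zero_mul, add_zero, Complex.norm_exp]
  congr 1
  have : (-(1 / 2) * (‖s‖ : ℂ) ^ 2) = ((-(‖s‖ ^ 2 / 2) : ℝ) : ℂ) := by push_cast; ring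
  rw [this, Complex.ofReal_re]

instance : IsFiniteMeasure gaussianWeight :=
  isFiniteMeasure_withDensity_ofReal integrable_gaussian.2

lemma integral_gaussianWeight {E : Type*} [NormedAddCommGroup E] [NormedSpace ℝ E] (g : ℂ → E) :
    ∫ s, g s ∂gaussianWeight = ∫ s, Real.exp (-(‖s‖ ^ 2 / 2)) • g s := by
  rw [gaussianWeight, integral_withDensity_eq_integral_toReal_smul (by fun_prop) (by simp)]
  refine integral_congr_ae (ae_of_all _ fun s => ?_)
  simp only
  rw [ENNReal.toReal_ofReal (Real.exp_pos _).le]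

lemma integral_char_gaussianWeight (x : ℂ) :
    ∫ s, Complex.exp (⟪x, s⟫ * Complex.I) ∂gaussianWeight
      = ((2 * Real.pi * Real.exp (-(‖x‖ ^ 2 / 2)) : ℝ) : ℂ) := by
  rw [integral_gaussianWeight]
  have := GaussianFourier.integral_cexp_neg_mul_sq_norm_add (V := ℂ) (b := 1 / 2) (by norm_num)
    Complex.I x
  simp only [Complex.finrank_real_complex] at this
  calc _ = ∫ v : ℂ, Complex.exp (-(1 / 2) * (‖v‖ : ℂ) ^ 2 + Complex.I * (⟪x, v⟫ : ℝ)) := by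
        refine integral_congr_ae (ae_of_all _ fun s => ?_)
        simp only [Complex.real_smul, Complex.ofReal_exp]
        rw [← Complex.exp_add]
        congr 1
        push_cast
        ring
    _ = _ := by
        rw [this]
        push_cast
        norm_num
        rw [neg_div]
        ring

/-- Fubini and the Gaussian's Fourier transform. This trades characteristic functions for a positive
kernel. It serves the small-ball bound, the monotonicity in ‖c‖, and the positivity of the energy.
The conjugate is the adjoint of multiplication by c for the real inner product. -/
lemma integral_charFun_gaussianWeight (ν : Measure ℂ) [IsFiniteMeasure ν] (c : ℂ) :
    ∫ s, charFun ν (conj c * s) ∂gaussianWeight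
      = ((2 * Real.pi * ∫ x, Real.exp (-(‖c * x‖ ^ 2 / 2)) ∂ν : ℝ) : ℂ) := by
  have hinner : ∀ x s : ℂ, ⟪x, conj c * s⟫ = ⟪c * x, s⟫ := by
    intro x s
    simp only [Complex.inner, map_mul]
    congr 1; ring
  simp only [charFun_apply, hinner]
  rw [integral_integral_swap]
  · have h := fun x => integral_char_gaussianWeight (c * x)
    rw [integral_congr_ae (ae_of_all _ h), integral_complex_ofReal, integral_const_mul]
  · refine (integrable_const (1 : ℝ)).mono' ?_ (ae_of_all _ fun p => ?_)
    · have : Continuous fun p : ℂ × ℂ => Complex.exp ((⟪c * p.2, p.1⟫ : ℝ) * Complex.I) := by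
        fun_prop
      exact this.aestronglyMeasurable
    · exact (Complex.norm_exp_ofReal_mul_I _).le

/-- Equality case of the triangle inequality for an average of unimodular numbers. -/
lemma norm_charFun_eq_one_iff (ρ : Measure ℂ) [IsProbabilityMeasure ρ] (s : ℂ) :
    ‖charFun ρ s‖ = 1 ↔ ∃ c : ℂ, ∀ᵐ x ∂ρ, Complex.exp (⟪x, s⟫ * Complex.I) = c := by
  have hn : ∀ x : ℂ, ‖Complex.exp ((⟪x, s⟫ : ℝ) * Complex.I)‖ = 1 := fun x =>
    Complex.norm_exp_ofReal_mul_I _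
  constructor
  · intro h
    rcases ae_eq_const_or_norm_integral_lt_of_norm_le_const (μ := ρ) (C := 1)
      (f := fun x => Complex.exp ((⟪x, s⟫ : ℝ) * Complex.I))
      (ae_of_all _ fun x => (hn x).le) with h1 | h1
    · exact ⟨_, h1⟩
    · rw [charFun_apply] at h
      rw [h] at h1
      simp only [probReal_univ, mul_one, lt_self_iff_false] at h1
  · rintro ⟨c, hc⟩
    obtain ⟨x, hx⟩ := hc.exists
    have : charFun ρ s = c := by
      rw [charFun_apply, integral_congr_ae hc]; simp
    rw [this, ← hx, hn]

/-- The quotient of two almost surely constant characters is almost surely constant. Hence the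
frequencies where the modulus is one form a subgroup. -/
lemma norm_charFun_sub_eq_one (ρ : Measure ℂ) [IsProbabilityMeasure ρ] {s t : ℂ}
    (hs : ‖charFun ρ s‖ = 1) (ht : ‖charFun ρ t‖ = 1) : ‖charFun ρ (s - t)‖ = 1 := by
  rw [norm_charFun_eq_one_iff] at *
  obtain ⟨c, hc⟩ := hs
  obtain ⟨d, hd⟩ := ht
  refine ⟨c * d⁻¹, ?_⟩
  filter_upwards [hc, hd] with x h1 h2
  rw [← h1, ← h2, ← Complex.exp_neg, ← Complex.exp_add, inner_sub_right]
  congr 1; push_cast; ring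

/-- If the characteristic function has modulus one everywhere, the law is a point mass. -/
lemma ae_eq_const_of_norm_charFun_eq_one (ρ : Measure ℂ) [IsProbabilityMeasure ρ]
    (h : ∀ s, ‖charFun ρ s‖ = 1) : ∃ c : ℂ, ∀ᵐ x ∂ρ, x = c := by
  have key : ∀ s : ℂ, ∀ᵐ x ∂ρ, ∀ n : ℕ,
      Complex.exp (⟪x, ((n + 1 : ℝ)⁻¹ : ℂ) * s⟫ * Complex.I)
        = Classical.choose ((norm_charFun_eq_one_iff ρ (((n + 1 : ℝ)⁻¹ : ℂ) * s)).1 (h _)) := by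
    intro s
    rw [ae_all_iff]
    intro n
    exact Classical.choose_spec ((norm_charFun_eq_one_iff ρ (((n + 1 : ℝ)⁻¹ : ℂ) * s)).1 (h _))
  -- One character determines the inner product only modulo 2π. Dividing the frequency by n + 1
  -- enlarges the ambiguity to multiples of 2π(n + 1), so a large n leaves only zero.
  have key2 : ∀ (s x y : ℂ), (∀ n : ℕ, Complex.exp (⟪x, ((n + 1 : ℝ)⁻¹ : ℂ) * s⟫ * Complex.I) =
      Complex.exp (⟪y, ((n + 1 : ℝ)⁻¹ : ℂ) * s⟫ * Complex.I)) → ⟪x, s⟫ = ⟪y, s⟫ := by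
    intro s x y hxy
    obtain ⟨n, hn⟩ := exists_nat_gt (|⟪x, s⟫ - ⟪y, s⟫|)
    have h1 := hxy n
    have hsm : ∀ z : ℂ, ⟪z, ((n + 1 : ℝ)⁻¹ : ℂ) * s⟫ = (n + 1 : ℝ)⁻¹ * ⟪z, s⟫ := by
      intro z
      have : ((n + 1 : ℝ)⁻¹ : ℂ) * s = ((n + 1 : ℝ)⁻¹ : ℝ) • s := by
        rw [Complex.real_smul]; push_cast; rfl
      rw [this, real_inner_smul_right]
    rw [hsm, hsm, Complex.exp_eq_exp_iff_exists_int] at h1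
    obtain ⟨k, hk⟩ := h1
    have hk2 : (n + 1 : ℝ)⁻¹ * ⟪x, s⟫ = (n + 1 : ℝ)⁻¹ * ⟪y, s⟫ + k * (2 * Real.pi) := by
      have := congrArg Complex.im hk
      simpa only [Complex.add_im, Complex.mul_im, Complex.ofReal_re, Complex.ofReal_im,
        Complex.I_re, Complex.I_im, mul_one, mul_zero, zero_mul, add_zero, zero_add,
        Complex.intCast_re, Complex.intCast_im, Complex.re_ofNat, Complex.im_ofNat,
        Complex.mul_re, sub_zero] using this
    have hn0 : (0 : ℝ) < n + 1 := by positivity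
    have hk3 : ⟪x, s⟫ - ⟪y, s⟫ = (n + 1) * (k * (2 * Real.pi)) := by
      field_simp at hk2
      linarith
    by_cases hk0 : k = 0
    · rw [hk0, Int.cast_zero, zero_mul, mul_zero] at hk3; linarith
    · exfalso
      rw [hk3, abs_mul, abs_mul, abs_of_pos hn0, abs_of_pos Real.two_pi_pos] at hn
      have : (1 : ℝ) ≤ |(k : ℝ)| := by exact_mod_cast Int.one_le_abs hk0
      have hp := Real.pi_gt_three
      nlinarith [mul_le_mul this (by linarith : (1 : ℝ) ≤ 2 * Real.pi) zero_le_one (abs_nonneg _)]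
  obtain ⟨y, hy1, hyI⟩ := ((key 1).and (key Complex.I)).exists
  refine ⟨y, ?_⟩
  filter_upwards [key 1, key Complex.I] with x hx1 hxI
  have e1 := key2 1 x y fun n => by rw [hx1, hy1]
  have e2 := key2 Complex.I x y fun n => by rw [hxI, hyI]
  apply Complex.ext
  · simpa [Complex.inner] using e1
  · simpa [Complex.inner] using e2

lemma continuous_charFun' (ρ : Measure ℂ) [IsFiniteMeasure ρ] : Continuous (charFun ρ) := by
  simp only [funext (charFun_apply (μ := ρ))]
  refine continuous_of_dominated (bound := fun _ => 1) ?_ ?_ (integrable_const _) ?_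
  · intro s; exact Continuous.aestronglyMeasurable (by fun_prop)
  · intro s; exact ae_of_all _ fun x => (Complex.norm_exp_ofReal_mul_I _).le
  · exact ae_of_all _ fun x => by fun_prop

/-- A nondegenerate law has `‖charFun‖ < 1` almost everywhere. -/
lemma ae_norm_charFun_lt_one (ρ : Measure ℂ) [IsProbabilityMeasure ρ]
    (h : ¬ ∃ c : ℂ, ∀ᵐ x ∂ρ, x = c) : ∀ᵐ s ∂(volume : Measure ℂ), ‖charFun ρ s‖ < 1 := by
  set G : Set ℂ := {s | ‖charFun ρ s‖ = 1} with hG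
  have hGm : MeasurableSet G :=
    (isClosed_singleton (x := (1 : ℝ))).preimage (continuous_charFun' ρ).norm |>.measurableSet
  have h0 : volume G = 0 := by
    by_contra hpos
    -- Steinhaus: the difference set of a set of positive measure is a neighbourhood of 0. A
    -- subgroup of ℂ containing such a neighbourhood is all of ℂ.
    have hn := Measure.sub_mem_nhds_zero_of_addHaar_pos (volume : Measure ℂ) G hGm
      (pos_iff_ne_zero.2 hpos)
    have hnG : G ∈ 𝓝 (0 : ℂ) := by
      refine mem_of_superset hn ?_
      rintro _ ⟨s, hs, t, ht, rfl⟩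
      exact norm_charFun_sub_eq_one ρ hs ht
    have hzero : ‖charFun ρ 0‖ = 1 := by simp
    let S : AddSubgroup ℂ := AddSubgroup.ofSub G ⟨0, hzero⟩
      (fun s hs t ht => by
        have := norm_charFun_sub_eq_one ρ hs ht
        rwa [sub_eq_add_neg] at this)
    have hall : ∀ s, s ∈ S := by
      intro s
      obtain ⟨n, hn⟩ : ∃ n : ℕ, ((n + 1 : ℝ)⁻¹ : ℝ) • s ∈ G := by
        have : Tendsto (fun n : ℕ => ((n + 1 : ℝ)⁻¹ : ℝ) • s) atTop (𝓝 ((0 : ℝ) • s)) := by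
          refine Tendsto.smul_const ?_ s
          have := tendsto_one_div_add_atTop_nhds_zero_nat (𝕜 := ℝ)
          simpa using this
        rw [zero_smul] at this
        exact (this.eventually hnG).exists
      have h2 : (n + 1) • (((n + 1 : ℝ)⁻¹ : ℝ) • s) ∈ S := S.nsmul_mem hn _
      convert h2 using 1
      rw [← Nat.cast_smul_eq_nsmul ℝ, smul_smul]
      have : (n + 1 : ℝ) ≠ 0 := by positivity
      push_cast
      rw [mul_inv_cancel₀ this, one_smul]
    exact h (ae_eq_const_of_norm_charFun_eq_one ρ hall)
  have : ∀ᵐ s ∂(volume : Measure ℂ), s ∉ G := measure_eq_zero_iff_ae_notMem.1 h0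
  filter_upwards [this] with s hs
  exact lt_of_le_of_ne (norm_charFun_le_one s) hs

/-- Symmetrisation: the difference of two independent copies has characteristic function ‖charFun
ρ‖², and convolution takes powers. -/
lemma exists_charFun_eq_norm_pow (ρ : Measure ℂ) [IsProbabilityMeasure ρ] (m : ℕ) :
    ∃ ν : Measure ℂ, IsProbabilityMeasure ν ∧ ∀ s, charFun ν s = ((‖charFun ρ s‖ ^ (2 * m) : ℝ) : ℂ) := by
  induction m with
  | zero => exact ⟨Measure.dirac 0, inferInstance, fun s => by simp [charFun_dirac]⟩
  | succ m ih =>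
    obtain ⟨ν, hν, hc⟩ := ih
    have : IsProbabilityMeasure (ρ.map (fun x => (-1 : ℝ) • x)) :=
      Measure.isProbabilityMeasure_map (by fun_prop)
    refine ⟨Measure.conv ν (Measure.conv ρ (ρ.map (fun x => (-1 : ℝ) • x))), inferInstance, ?_⟩
    intro s
    rw [charFun_conv, charFun_conv, hc, charFun_map_smul, neg_one_smul, charFun_neg,
      Complex.mul_conj, Complex.normSq_eq_norm_sq]
    push_cast
    ring

/-- An even power is itself a characteristic function, so both sides become integrals of exp(-‖c
x‖²/2), which decreases in ‖c‖. Large coefficients of unknown size are thereby replaced by 1. -/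
lemma integral_norm_charFun_pow_le (ρ : Measure ℂ) [IsProbabilityMeasure ρ] (m : ℕ) (c : ℂ)
    (hc : 1 ≤ ‖c‖) :
    ∫ s, ‖charFun ρ (conj c * s)‖ ^ (2 * m) ∂gaussianWeight
      ≤ ∫ s, ‖charFun ρ s‖ ^ (2 * m) ∂gaussianWeight := by
  obtain ⟨ν, hν, hν2⟩ := exists_charFun_eq_norm_pow ρ m
  have e1 := integral_charFun_gaussianWeight ν c
  have e2 := integral_charFun_gaussianWeight ν 1
  simp only [hν2, map_one, one_mul, integral_complex_ofReal, Complex.ofReal_inj] at e1 e2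
  rw [e1, e2]
  refine mul_le_mul_of_nonneg_left ?_ Real.two_pi_pos.le
  have hint : ∀ d : ℂ, Integrable (fun x => Real.exp (-(‖d * x‖ ^ 2 / 2))) ν := by
    intro d
    refine (integrable_const (1 : ℝ)).mono' (Continuous.aestronglyMeasurable (by fun_prop))
      (ae_of_all _ fun x => ?_)
    rw [Real.norm_eq_abs, abs_of_pos (Real.exp_pos _), Real.exp_le_one_iff]
    have := sq_nonneg ‖d * x‖
    linarith
  refine integral_mono (hint c) (by simpa using hint 1) fun x => ?_
  simp only [Real.exp_le_exp, norm_mul]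
  have : ‖x‖ ≤ ‖c‖ * ‖x‖ := le_mul_of_one_le_left (norm_nonneg _) hc
  have := pow_le_pow_left₀ (norm_nonneg x) this 2
  linarith

lemma tendsto_integral_norm_charFun_pow (ρ : Measure ℂ) [IsProbabilityMeasure ρ]
    (h : ¬ ∃ c : ℂ, ∀ᵐ x ∂ρ, x = c) :
    Tendsto (fun m : ℕ => ∫ s, ‖charFun ρ s‖ ^ (2 * m) ∂gaussianWeight) atTop (𝓝 0) := by
  have h0 : (0 : ℝ) = ∫ s : ℂ, (0 : ℝ) ∂gaussianWeight := by simp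
  rw [h0]
  refine tendsto_integral_of_dominated_convergence (fun _ => 1) ?_ (integrable_const _) ?_ ?_
  · intro m
    exact ((continuous_charFun' ρ).norm.pow _).aestronglyMeasurable
  · intro m
    refine ae_of_all _ fun s => ?_
    rw [Real.norm_eq_abs, abs_of_nonneg (by positivity)]
    exact pow_le_one₀ (norm_nonneg _) (norm_charFun_le_one s)
  · filter_upwards [gaussianWeight_ac.ae_le (ae_norm_charFun_lt_one ρ h)] with s hs
    simp only [pow_mul]
    refine tendsto_pow_atTop_nhds_zero_of_lt_one (by positivity) ?_
    exact pow_lt_one₀ (norm_nonneg _) hs two_ne_zero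

/-- An Esseen-type bound: the Gaussian kernel is at least 1/2 on the unit disc, and its integral is
controlled on the Fourier side. -/
lemma measure_norm_le_one_le (ν : Measure ℂ) [IsProbabilityMeasure ν] :
    ν.real {x | ‖x‖ ≤ 1} ≤ 2 * ∫ s, ‖charFun ν s‖ ∂gaussianWeight := by
  have e := integral_charFun_gaussianWeight ν 1
  simp only [map_one, one_mul] at e
  have h1 : 2 * Real.pi * ∫ x, Real.exp (-(‖x‖ ^ 2 / 2)) ∂ν
      ≤ ∫ s, ‖charFun ν s‖ ∂gaussianWeight := by
    have := norm_integral_le_integral_norm (μ := gaussianWeight) (charFun ν)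
    rw [e, Complex.norm_real, Real.norm_eq_abs] at this
    exact (le_abs_self _).trans this
  have hint : Integrable (fun x : ℂ => Real.exp (-(‖x‖ ^ 2 / 2))) ν := by
    refine (integrable_const (1 : ℝ)).mono' (Continuous.aestronglyMeasurable (by fun_prop))
      (ae_of_all _ fun x => ?_)
    rw [Real.norm_eq_abs, abs_of_pos (Real.exp_pos _), Real.exp_le_one_iff]
    have := sq_nonneg ‖x‖
    linarith
  have hm : MeasurableSet {x : ℂ | ‖x‖ ≤ 1} := measurableSet_le (by fun_prop) (by fun_prop)
  have h2 : (1 / 2 : ℝ) * ν.real {x | ‖x‖ ≤ 1} ≤ ∫ x, Real.exp (-(‖x‖ ^ 2 / 2)) ∂ν := by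
    rw [← smul_eq_mul, mul_comm] at *
    have : ∫ x, {x : ℂ | ‖x‖ ≤ 1}.indicator (fun _ => (1 / 2 : ℝ)) x ∂ν
        ≤ ∫ x, Real.exp (-(‖x‖ ^ 2 / 2)) ∂ν := by
      refine integral_mono ((integrable_const _).indicator hm) hint fun x => ?_
      by_cases hx : ‖x‖ ≤ 1
      · rw [Set.indicator_of_mem (by exact hx)]
        have h3 := Real.add_one_le_exp (-(‖x‖ ^ 2 / 2))
        have h4 : ‖x‖ ^ 2 ≤ 1 := pow_le_one₀ (norm_nonneg _) hx
        linarith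
      · rw [Set.indicator_of_notMem (by exact hx)]
        exact (Real.exp_pos _).le
    rwa [integral_indicator_const _ hm, smul_eq_mul, mul_comm] at this
  have hpi := Real.pi_gt_three
  have h0 : 0 ≤ ν.real {x : ℂ | ‖x‖ ≤ 1} := measureReal_nonneg
  nlinarith

lemma charFun_map_const_mul {Ω : Type*} [MeasurableSpace Ω] (P : Measure Ω) (X : Ω → ℂ)
    (hX : Measurable X) (c s : ℂ) :
    charFun (P.map (fun ω => c * X ω)) s = charFun (P.map X) (conj c * s) := by
  have hinner : ∀ x s : ℂ, ⟪x, conj c * s⟫ = ⟪c * x, s⟫ := by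
    intro x s
    simp only [Complex.inner, map_mul]
    congr 1; ring
  rw [charFun_apply, charFun_apply, integral_map (by fun_prop)
    (Continuous.aestronglyMeasurable (by fun_prop)), integral_map (by fun_prop)
    (Continuous.aestronglyMeasurable (by fun_prop))]
  simp only [hinner]

lemma prod_le_prod_of_subset_of_le_one {ι : Type*} {T S : Finset ι} (hTS : T ⊆ S) {g : ι → ℝ}
    (h0 : ∀ k ∈ S, 0 ≤ g k) (h1 : ∀ k ∈ S, g k ≤ 1) : ∏ k ∈ S, g k ≤ ∏ k ∈ T, g k := by
  classical
  rw [← Finset.prod_sdiff hTS]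
  exact mul_le_of_le_one_left (Finset.prod_nonneg fun k hk => h0 k (hTS hk))
    (Finset.prod_le_one (fun k hk => h0 k (Finset.mem_sdiff.1 hk).1)
      (fun k hk => h1 k (Finset.mem_sdiff.1 hk).1))

/-- **Anticoncentration.** A sum of i.i.d. nondegenerate terms with many coefficients of modulus at
least one is unlikely to be of modulus at most one. -/
theorem exists_anticoncentration {Ω : Type*} [MeasurableSpace Ω] (P : Measure Ω)
    [IsProbabilityMeasure P] (ξ : ℕ → Ω → ℂ) (hξ : IsCoefficientNoise P ξ) {η : ℝ} (hη : 0 < η) :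
    ∃ m : ℕ, ∀ (S T : Finset ℕ) (c : ℕ → ℂ), T ⊆ S → m ≤ T.card → (∀ k ∈ T, 1 ≤ ‖c k‖) →
      P {ω | ‖∑ k ∈ S, c k * ξ k ω‖ ≤ 1} ≤ ENNReal.ofReal η := by
  set ρ : Measure ℂ := P.map (ξ 0) with hρ
  have hρp : IsProbabilityMeasure ρ := Measure.isProbabilityMeasure_map (hξ.measurable 0).aemeasurable
  have hlaw : ∀ k, P.map (ξ k) = ρ := fun k => (hξ.ident k).map_eq
  have hnd : ¬ ∃ c : ℂ, ∀ᵐ x ∂ρ, x = c := by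
    rintro ⟨c, hc⟩
    exact hξ.nondegenerate ⟨c, ae_of_ae_map (hξ.measurable 0).aemeasurable hc⟩
  have ht := tendsto_integral_norm_charFun_pow ρ hnd
  obtain ⟨m, hm⟩ := (((tendsto_order.1 ht).2 (η / 2) (by positivity)).and
    (eventually_ge_atTop 1)).exists
  obtain ⟨hm, hm1⟩ := hm
  -- The number of retained factors equals the exponent 2m, so the weighted AM-GM inequality with
  -- weights 1/(2m) bounds the product of the moduli by the average of their 2m-th powers. Each of
  -- these has Gaussian integral below η/2. The remaining factor 2 comes from
  -- `measure_norm_le_one_le`.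
  refine ⟨2 * m, fun S T c hTS hT hc => ?_⟩
  obtain ⟨T', hT', hcard⟩ := Finset.exists_subset_card_eq hT
  have hX : Measurable (fun ω => ∑ k ∈ S, c k * ξ k ω) :=
    Finset.measurable_fun_sum _ fun k _ => (hξ.measurable k).const_mul _
  have hp : IsProbabilityMeasure (P.map (fun ω => ∑ k ∈ S, c k * ξ k ω)) :=
    Measure.isProbabilityMeasure_map hX.aemeasurable
  have hcf : ∀ s, charFun (P.map (fun ω => ∑ k ∈ S, c k * ξ k ω)) s
      = ∏ k ∈ S, charFun ρ (conj (c k) * s) := by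
    intro s
    have hind : iIndepFun (fun k ω => c k * ξ k ω) P :=
      hξ.indep.comp (fun k x => c k * x) (fun k => by fun_prop)
    have := iIndepFun.charFun_map_fun_finsetSum_eq_prod (P := P) (s := S)
      (X := fun k ω => c k * ξ k ω)
      (fun k _ => ((hξ.measurable k).const_mul _).aemeasurable) (hind.restrict _)
    rw [this, Finset.prod_apply]
    refine Finset.prod_congr rfl fun k _ => ?_
    rw [charFun_map_const_mul P _ (hξ.measurable k), hlaw]
  have hnorm : ∀ s, ‖charFun (P.map (fun ω => ∑ k ∈ S, c k * ξ k ω)) s‖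
      ≤ ∑ k ∈ T', (1 / (2 * m : ℝ)) * ‖charFun ρ (conj (c k) * s)‖ ^ (2 * m) := by
    intro s
    rw [hcf, norm_prod]
    calc _ ≤ ∏ k ∈ T', ‖charFun ρ (conj (c k) * s)‖ :=
          prod_le_prod_of_subset_of_le_one (hT'.trans hTS)
            (fun k _ => norm_nonneg _) (fun k _ => norm_charFun_le_one _)
      _ = ∏ k ∈ T', (‖charFun ρ (conj (c k) * s)‖ ^ (2 * m)) ^ (1 / (2 * m : ℝ)) := by
          refine Finset.prod_congr rfl fun k _ => ?_
          have h2m : (2 * m : ℝ) ≠ 0 := by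
            have : (m : ℝ) ≠ 0 := by exact_mod_cast (by omega : m ≠ 0)
            positivity
          rw [← Real.rpow_natCast, ← Real.rpow_mul (norm_nonneg _)]
          push_cast
          rw [mul_one_div_cancel h2m, Real.rpow_one]
      _ ≤ _ := by
          refine Real.geom_mean_le_arith_mean_weighted _ _ _ (fun k _ => by positivity) ?_
            (fun k _ => by positivity)
          have : (m : ℝ) ≠ 0 := by exact_mod_cast (by omega : m ≠ 0)
          rw [Finset.sum_const, hcard, nsmul_eq_mul]
          push_cast
          field_simp
  have hint : ∀ d : ℂ, Integrable (fun s => ‖charFun ρ (conj d * s)‖ ^ (2 * m)) gaussianWeight := by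
    intro d
    refine (integrable_const (1 : ℝ)).mono' ?_ (ae_of_all _ fun s => ?_)
    · exact (((continuous_charFun' ρ).comp (by fun_prop)).norm.pow _).aestronglyMeasurable
    · rw [Real.norm_eq_abs, abs_of_nonneg (by positivity)]
      exact pow_le_one₀ (norm_nonneg _) (norm_charFun_le_one _)
  have hbound : ∫ s, ‖charFun (P.map (fun ω => ∑ k ∈ S, c k * ξ k ω)) s‖ ∂gaussianWeight
      ≤ η / 2 := by
    calc _ ≤ ∫ s, ∑ k ∈ T', (1 / (2 * m : ℝ)) * ‖charFun ρ (conj (c k) * s)‖ ^ (2 * m)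
          ∂gaussianWeight := by
          refine integral_mono_of_nonneg (ae_of_all _ fun s => norm_nonneg _) ?_
            (ae_of_all _ hnorm)
          exact integrable_finsetSum _ fun k _ => (hint _).const_mul _
      _ = ∑ k ∈ T', (1 / (2 * m : ℝ)) * ∫ s, ‖charFun ρ (conj (c k) * s)‖ ^ (2 * m)
          ∂gaussianWeight := by
          rw [integral_finsetSum _ fun k _ => (hint _).const_mul _]
          simp only [integral_const_mul]
      _ ≤ ∑ k ∈ T', (1 / (2 * m : ℝ)) * (η / 2) := by
          refine Finset.sum_le_sum fun k hk => mul_le_mul_of_nonneg_left ?_ (by positivity)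
          exact (integral_norm_charFun_pow_le ρ m (c k) (hc k (hT' hk))).trans hm.le
      _ = η / 2 := by
          have : (m : ℝ) ≠ 0 := by exact_mod_cast (by omega : m ≠ 0)
          rw [Finset.sum_const, hcard, nsmul_eq_mul]
          push_cast
          field_simp
  have hfin := measure_norm_le_one_le (P.map (fun ω => ∑ k ∈ S, c k * ξ k ω))
  have hm' : MeasurableSet {x : ℂ | ‖x‖ ≤ 1} := measurableSet_le (by fun_prop) (by fun_prop)
  have : P {ω | ‖∑ k ∈ S, c k * ξ k ω‖ ≤ 1}
      = (P.map (fun ω => ∑ k ∈ S, c k * ξ k ω)) {x : ℂ | ‖x‖ ≤ 1} := by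
    rw [Measure.map_apply hX hm']; rfl
  rw [this, ← ENNReal.ofReal_toReal (measure_ne_top _ _)]
  exact ENNReal.ofReal_le_ofReal (hfin.trans (by linarith))

/-! ### Positivity of the logarithmic energy of differences -/

/-- The integrand `(exp (-a t) - exp (-t)) / t` of Frullani's representation of `-log a`. -/
noncomputable def frullaniKernel (a t : ℝ) : ℝ := t⁻¹ * (Real.exp (-(a * t)) - Real.exp (-t))

lemma frullaniKernel_nonneg {a t : ℝ} (ha : a ≤ 1) (ht : 0 < t) : 0 ≤ frullaniKernel a t := by
  refine mul_nonneg (inv_nonneg.2 ht.le) (sub_nonneg.2 (Real.exp_le_exp.2 ?_))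
  nlinarith

lemma frullaniKernel_nonpos {a t : ℝ} (ha : 1 ≤ a) (ht : 0 < t) : frullaniKernel a t ≤ 0 := by
  refine mul_nonpos_of_nonneg_of_nonpos (inv_nonneg.2 ht.le)
    (sub_nonpos.2 (Real.exp_le_exp.2 ?_))
  nlinarith

/-- From exp(-x) ≥ 1 - x. Used with (a, 1) and (1, a), it removes the singularity at t = 0 and
dominates the Frullani kernel by integrable exponentials. -/
lemma inv_mul_exp_sub_le {a b t : ℝ} (ht : 0 < t) :
    t⁻¹ * (Real.exp (-(a * t)) - Real.exp (-(b * t))) ≤ (b - a) * Real.exp (-(a * t)) := by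
  have h1 : Real.exp (-(b * t)) = Real.exp (-(a * t)) * Real.exp (-((b - a) * t)) := by
    rw [← Real.exp_add]; congr 1; ring
  have h2 := Real.add_one_le_exp (-((b - a) * t))
  rw [inv_mul_le_iff₀ ht, h1]
  have h3 := Real.exp_pos (-(a * t))
  nlinarith

lemma integrableOn_frullaniKernel {a : ℝ} (ha : 0 < a) :
    IntegrableOn (frullaniKernel a) (Set.Ioi 0) := by
  have hexp : ∀ b : ℝ, 0 < b → IntegrableOn (fun t => Real.exp (-(b * t))) (Set.Ioi 0) := by
    intro b hb
    simpa [neg_mul] using integrableOn_exp_mul_Ioi (neg_lt_zero.2 hb) 0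
  have hmeas : AEStronglyMeasurable (frullaniKernel a) (volume.restrict (Set.Ioi 0)) := by
    refine Measurable.aestronglyMeasurable ?_
    unfold frullaniKernel
    fun_prop
  refine Integrable.mono' (((hexp a ha).const_mul |1 - a|).add ((hexp 1 one_pos).const_mul |1 - a|))
    hmeas ?_
  filter_upwards [ae_restrict_mem measurableSet_Ioi] with t ht
  have ht : 0 < t := ht
  have e1 := (Real.exp_pos (-(a * t))).le
  have e2 := (Real.exp_pos (-(1 * t))).le
  have h1 := inv_mul_exp_sub_le (a := a) (b := 1) ht
  have h2 := inv_mul_exp_sub_le (a := 1) (b := a) ht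
  rw [one_mul] at *
  simp only [Pi.add_apply, Real.norm_eq_abs, one_mul]
  unfold frullaniKernel
  rw [abs_le]
  have h3 := le_abs_self (1 - a)
  have h4 := neg_le_abs (1 - a)
  constructor <;> nlinarith [mul_nonneg (abs_nonneg (1 - a)) e1, mul_nonneg (abs_nonneg (1 - a)) e2]

lemma integral_frullaniKernel {a : ℝ} (ha : 0 < a) :
    ∫ t in Set.Ioi 0, frullaniKernel a t = -Real.log a := by
  have hloc : LocallyIntegrableOn (fun t : ℝ => Real.exp (-t)) (Set.Ioi 0) :=
    (show Continuous fun t : ℝ => Real.exp (-t) by fun_prop).locallyIntegrable.locallyIntegrableOn _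
  have h := Frullani.integral_Ioi_eq (f := fun t : ℝ => Real.exp (-t)) (a := a) (b := 1) (L := 1)
    (R := 0) hloc ha one_pos ?_ ?_ ?_
  · simpa [frullaniKernel] using h
  · have : Tendsto (fun t : ℝ => Real.exp (-t)) (𝓝 0) (𝓝 (Real.exp (-0))) :=
      Continuous.tendsto (by fun_prop) 0
    simpa using this.mono_left nhdsWithin_le_nhds
  · exact Real.tendsto_exp_neg_atTop_nhds_zero
  · refine (integrableOn_frullaniKernel ha).congr_fun (fun t _ => ?_) measurableSet_Ioi
    simp [frullaniKernel]

/-- For fixed a the kernel has a constant sign in t, so nothing cancels. Joint integrability, needed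
for Fubini, thus reduces to integrability of the logarithm. -/
lemma integral_norm_frullaniKernel {a : ℝ} (ha : 0 < a) :
    ∫ t in Set.Ioi 0, ‖frullaniKernel a t‖ = |Real.log a| := by
  rcases le_total a 1 with h | h
  · rw [setIntegral_congr_fun (g := frullaniKernel a) measurableSet_Ioi fun t ht => by
      simp only [Real.norm_eq_abs]; exact abs_of_nonneg (frullaniKernel_nonneg h ht),
      integral_frullaniKernel ha, abs_of_nonpos (Real.log_nonpos ha.le h)]
  · rw [setIntegral_congr_fun (g := fun t => -frullaniKernel a t) measurableSet_Ioi fun t ht => by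
      simp only [Real.norm_eq_abs]; exact abs_of_nonpos (frullaniKernel_nonpos h ht),
      integral_neg, integral_frullaniKernel ha, abs_of_nonneg (Real.log_nonneg h), neg_neg]

/-- Two finite measures have an absolutely convergent mutual logarithmic energy. -/
structure LogIntegrable (α β : Measure ℂ) : Prop where
  integrable : Integrable (fun p : ℂ × ℂ => Real.log ‖p.1 - p.2‖) (α.prod β)
  ae_ne : ∀ᵐ p ∂(α.prod β), p.1 ≠ p.2

/-- The Gaussian mutual energy of two measures at the scale `t`. -/
noncomputable def gaussianEnergy (α β : Measure ℂ) (t : ℝ) : ℝ :=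
  ∫ p : ℂ × ℂ, Real.exp (-(‖p.1 - p.2‖ ^ 2 * t)) ∂(α.prod β)

lemma integrable_gaussianEnergy (α β : Measure ℂ) [IsFiniteMeasure α] [IsFiniteMeasure β] {t : ℝ}
    (ht : 0 ≤ t) :
    Integrable (fun p : ℂ × ℂ => Real.exp (-(‖p.1 - p.2‖ ^ 2 * t))) (α.prod β) := by
  refine (integrable_const (1 : ℝ)).mono' (Continuous.aestronglyMeasurable (by fun_prop))
    (ae_of_all _ fun x => ?_)
  rw [Real.norm_eq_abs, abs_of_pos (Real.exp_pos _), Real.exp_le_one_iff]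
  have : 0 ≤ ‖x.1 - x.2‖ ^ 2 * t := by positivity
  linarith

lemma integrable_frullaniKernel_prod {α β : Measure ℂ} [IsFiniteMeasure α] [IsFiniteMeasure β]
    (h : LogIntegrable α β) :
    Integrable (fun q : (ℂ × ℂ) × ℝ => frullaniKernel (‖q.1.1 - q.1.2‖ ^ 2) q.2)
      ((α.prod β).prod (volume.restrict (Set.Ioi 0))) := by
  have hm : Measurable (fun q : (ℂ × ℂ) × ℝ => frullaniKernel (‖q.1.1 - q.1.2‖ ^ 2) q.2) := by
    unfold frullaniKernel; fun_prop
  rw [integrable_prod_iff hm.aestronglyMeasurable]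
  have hpos : ∀ᵐ p ∂(α.prod β), 0 < ‖p.1 - p.2‖ ^ 2 := by
    filter_upwards [h.ae_ne] with p hp
    have : 0 < ‖p.1 - p.2‖ := norm_pos_iff.2 (sub_ne_zero.2 hp)
    positivity
  constructor
  · filter_upwards [hpos] with p hp using integrableOn_frullaniKernel hp
  · refine (h.integrable.norm.const_mul 2).congr ?_
    filter_upwards [hpos] with p hp
    rw [integral_norm_frullaniKernel hp, Real.log_pow, abs_mul, Real.norm_eq_abs]
    simp

lemma integral_frullaniKernel_prod {α β : Measure ℂ} [IsFiniteMeasure α] [IsFiniteMeasure β]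
    {t : ℝ} (ht : 0 < t) :
    ∫ p : ℂ × ℂ, frullaniKernel (‖p.1 - p.2‖ ^ 2) t ∂(α.prod β)
      = t⁻¹ * (gaussianEnergy α β t - α.real Set.univ * β.real Set.univ * Real.exp (-t)) := by
  unfold frullaniKernel gaussianEnergy
  rw [integral_const_mul, integral_sub (integrable_gaussianEnergy α β ht.le) (integrable_const _),
    integral_const, smul_eq_mul]
  congr 3
  rw [← Set.univ_prod_univ, measureReal_prod_prod]

/-- Frullani's formula at a = ‖z - w‖², with the integrals exchanged. The square produces the factor
2 and makes the kernel Gaussian. -/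
lemma logEnergy_eq {α β : Measure ℂ} [IsFiniteMeasure α] [IsFiniteMeasure β]
    (h : LogIntegrable α β) :
    IntegrableOn (fun t => t⁻¹ * (gaussianEnergy α β t -
      α.real Set.univ * β.real Set.univ * Real.exp (-t))) (Set.Ioi 0) ∧
    ∫ t in Set.Ioi 0, t⁻¹ * (gaussianEnergy α β t -
      α.real Set.univ * β.real Set.univ * Real.exp (-t))
      = 2 * -∫ p : ℂ × ℂ, Real.log ‖p.1 - p.2‖ ∂(α.prod β) := by
  have hint := integrable_frullaniKernel_prod h
  constructor
  · refine IntegrableOn.congr_fun hint.integral_prod_right (fun t ht => ?_) measurableSet_Ioi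
    exact integral_frullaniKernel_prod ht
  · have hpos : ∀ᵐ p ∂(α.prod β), 0 < ‖p.1 - p.2‖ ^ 2 := by
      filter_upwards [h.ae_ne] with p hp
      have : 0 < ‖p.1 - p.2‖ := norm_pos_iff.2 (sub_ne_zero.2 hp)
      positivity
    rw [← setIntegral_congr_fun measurableSet_Ioi (fun t ht =>
      integral_frullaniKernel_prod (α := α) (β := β) ht), ← integral_integral_swap hint,
      ← integral_neg, ← integral_const_mul]
    refine integral_congr_ae ?_
    filter_upwards [hpos] with p hp
    rw [integral_frullaniKernel hp, Real.log_pow]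
    push_cast; ring

/-- The law of z - w under the product measure has characteristic function charFun α times the
conjugate of charFun β. -/
lemma gaussianEnergy_eq (α β : Measure ℂ) [IsFiniteMeasure α] [IsFiniteMeasure β] (c : ℝ) :
    ∫ s, charFun α ((c : ℂ) * s) * conj (charFun β ((c : ℂ) * s)) ∂gaussianWeight
      = ((2 * Real.pi * gaussianEnergy α β (c ^ 2 / 2) : ℝ) : ℂ) := by
  set τ : Measure ℂ := (α.prod β).map (fun p : ℂ × ℂ => p.1 - p.2) with hτ
  have hτf : IsFiniteMeasure τ := by rw [hτ]; infer_instance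
  have hcf : ∀ s, charFun τ s = charFun α s * conj (charFun β s) := by
    intro s
    rw [← charFun_neg, hτ, charFun_apply, integral_map (by fun_prop)
      (Continuous.aestronglyMeasurable (by fun_prop)), charFun_apply, charFun_apply,
      ← integral_prod_mul]
    refine integral_congr_ae (ae_of_all _ fun p => ?_)
    simp only
    rw [← Complex.exp_add, inner_sub_left, inner_neg_right]
    congr 1; push_cast; ring
  have e := integral_charFun_gaussianWeight τ (c : ℂ)
  simp only [hcf, Complex.conj_ofReal] at e
  rw [e, hτ, integral_map (by fun_prop) (Continuous.aestronglyMeasurable (by fun_prop))]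
  congr 2
  refine integral_congr_ae (ae_of_all _ fun p => ?_)
  simp only [norm_mul, Complex.norm_real, Real.norm_eq_abs, mul_pow, sq_abs]
  congr 1; ring

/-- Up to the factor 2π, the quadratic form is the Gaussian integral of the squared modulus of the
difference of the characteristic functions at frequency c s. If it vanished, continuity and full
support of the weight would make these functions agree everywhere. -/
lemma gaussianEnergy_sub_pos {α β : Measure ℂ} [IsFiniteMeasure α] [IsFiniteMeasure β]
    (hne : α ≠ β) {t : ℝ} (ht : 0 < t) :
    0 < gaussianEnergy α α t - (gaussianEnergy α β t + gaussianEnergy β α t)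
      + gaussianEnergy β β t := by
  set c : ℝ := Real.sqrt (2 * t) with hc
  have hc0 : 0 < c := Real.sqrt_pos.2 (by positivity)
  have hct : c ^ 2 / 2 = t := by rw [hc, Real.sq_sqrt (by positivity)]; ring
  have e1 := gaussianEnergy_eq α α c
  have e2 := gaussianEnergy_eq α β c
  have e3 := gaussianEnergy_eq β α c
  have e4 := gaussianEnergy_eq β β c
  rw [hct] at e1 e2 e3 e4
  have hcont : ∀ μ : Measure ℂ, IsFiniteMeasure μ → Continuous fun s => charFun μ ((c : ℂ) * s) :=
    fun μ hμ => (continuous_charFun' μ).comp (by fun_prop)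
  have hint : ∀ μ ν : Measure ℂ, IsFiniteMeasure μ → IsFiniteMeasure ν →
      Integrable (fun s => charFun μ ((c : ℂ) * s) * conj (charFun ν ((c : ℂ) * s)))
        gaussianWeight := by
    intro μ ν hμ hν
    refine (integrable_const (μ.real Set.univ * ν.real Set.univ)).mono' ?_ (ae_of_all _ fun s => ?_)
    · exact ((hcont μ hμ).mul (Complex.continuous_conj.comp (hcont ν hν))).aestronglyMeasurable
    · rw [norm_mul, RCLike.norm_conj]
      exact mul_le_mul (norm_charFun_le _) (norm_charFun_le _) (norm_nonneg _) measureReal_nonneg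
  set D : ℂ → ℂ := fun s => charFun α ((c : ℂ) * s) - charFun β ((c : ℂ) * s) with hD
  have hDc : Continuous D := (hcont α inferInstance).sub (hcont β inferInstance)
  have hsum : ((∫ s, ‖D s‖ ^ 2 ∂gaussianWeight : ℝ) : ℂ)
      = ((2 * Real.pi * (gaussianEnergy α α t - (gaussianEnergy α β t + gaussianEnergy β α t)
      + gaussianEnergy β β t) : ℝ) : ℂ) := by
    rw [← integral_complex_ofReal]
    calc _ = ∫ s, (charFun α ((c : ℂ) * s) * conj (charFun α ((c : ℂ) * s))
          - (charFun α ((c : ℂ) * s) * conj (charFun β ((c : ℂ) * s))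
            + charFun β ((c : ℂ) * s) * conj (charFun α ((c : ℂ) * s)))
          + charFun β ((c : ℂ) * s) * conj (charFun β ((c : ℂ) * s))) ∂gaussianWeight := by
          refine integral_congr_ae (ae_of_all _ fun s => ?_)
          simp only
          rw [← Complex.normSq_eq_norm_sq, ← Complex.mul_conj, hD]
          simp only [map_sub]
          ring
      _ = _ := by
          have i1 := hint α α inferInstance inferInstance
          have i2 := hint α β inferInstance inferInstance
          have i3 := hint β α inferInstance inferInstance
          have i4 := hint β β inferInstance inferInstance
          have h := integral_add' (i1.sub (i2.add i3)) i4
          rw [integral_sub' i1 (i2.add i3), integral_add' i2 i3, e1, e2, e3, e4] at h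
          refine h.trans ?_
          push_cast; ring
  rw [Complex.ofReal_inj] at hsum
  have hDint : Integrable (fun s => ‖D s‖ ^ 2) gaussianWeight := by
    refine (integrable_const ((α.real Set.univ + β.real Set.univ) ^ 2)).mono' ?_
      (ae_of_all _ fun s => ?_)
    · exact (hDc.norm.pow 2).aestronglyMeasurable
    · rw [Real.norm_eq_abs, abs_of_nonneg (by positivity)]
      refine pow_le_pow_left₀ (norm_nonneg _) ((norm_sub_le _ _).trans ?_) 2
      exact add_le_add (norm_charFun_le _) (norm_charFun_le _)
  have hpos : 0 < ∫ s, ‖D s‖ ^ 2 ∂gaussianWeight := by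
    refine lt_of_le_of_ne (integral_nonneg fun s => by positivity) fun h0 => hne ?_
    have h1 := (integral_eq_zero_iff_of_nonneg (fun s => by positivity) hDint).1 h0.symm
    have h2 : D =ᵐ[volume] 0 := by
      filter_upwards [ac_gaussianWeight.ae_le h1] with s hs
      simpa using hs
    have h3 := (Continuous.ae_eq_iff_eq volume hDc continuous_zero).1 h2
    refine Measure.ext_of_charFun (funext fun s => ?_)
    have h4 := congrFun h3 ((c : ℂ)⁻¹ * s)
    have hc1 : (c : ℂ) ≠ 0 := by exact_mod_cast hc0.ne'
    simp only [hD, mul_inv_cancel_left₀ hc1, Pi.zero_apply] at h4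
    exact sub_eq_zero.1 h4
  rw [hsum] at hpos
  exact pos_of_mul_pos_right hpos Real.two_pi_pos.le

/-- The logarithmic energy of the difference of two distinct measures of equal mass is positive. -/
theorem logEnergy_sub_pos {α β : Measure ℂ} [IsFiniteMeasure α] [IsFiniteMeasure β]
    (hne : α ≠ β) (hmass : α.real Set.univ = β.real Set.univ)
    (hαα : LogIntegrable α α) (hαβ : LogIntegrable α β) (hβα : LogIntegrable β α)
    (hββ : LogIntegrable β β) :
    0 < (-∫ p : ℂ × ℂ, Real.log ‖p.1 - p.2‖ ∂(α.prod α))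
      - ((-∫ p : ℂ × ℂ, Real.log ‖p.1 - p.2‖ ∂(α.prod β))
        + (-∫ p : ℂ × ℂ, Real.log ‖p.1 - p.2‖ ∂(β.prod α)))
      + (-∫ p : ℂ × ℂ, Real.log ‖p.1 - p.2‖ ∂(β.prod β)) := by
  obtain ⟨i1, e1⟩ := logEnergy_eq hαα
  obtain ⟨i2, e2⟩ := logEnergy_eq hαβ
  obtain ⟨i3, e3⟩ := logEnergy_eq hβα
  obtain ⟨i4, e4⟩ := logEnergy_eq hββ
  have hI := (i1.sub (i2.add i3)).add i4
  have hE := integral_add (i1.sub (i2.add i3)) i4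
  rw [integral_sub' i1 (i2.add i3), integral_add' i2 i3, e1, e2, e3, e4] at hE
  have hpos : 0 < ∫ t in Set.Ioi (0 : ℝ), t⁻¹ * (gaussianEnergy α α t -
      (gaussianEnergy α β t + gaussianEnergy β α t) + gaussianEnergy β β t) := by
    -- Equality of the masses makes the four exp(-t) corrections cancel.
    have hEq : ∀ t ∈ Set.Ioi (0 : ℝ), (((fun t => t⁻¹ * (gaussianEnergy α α t -
        α.real Set.univ * α.real Set.univ * Real.exp (-t))) - ((fun t => t⁻¹ * (gaussianEnergy α β t
        - α.real Set.univ * β.real Set.univ * Real.exp (-t))) + (fun t => t⁻¹ *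
        (gaussianEnergy β α t - β.real Set.univ * α.real Set.univ * Real.exp (-t))))) +
        (fun t => t⁻¹ * (gaussianEnergy β β t -
        β.real Set.univ * β.real Set.univ * Real.exp (-t)))) t = t⁻¹ * (gaussianEnergy α α t -
      (gaussianEnergy α β t + gaussianEnergy β α t) + gaussianEnergy β β t) := by
      intro t _
      simp only [Pi.add_apply, Pi.sub_apply, hmass]
      ring
    have hI2 := IntegrableOn.congr_fun hI hEq measurableSet_Ioi
    rw [setIntegral_pos_iff_support_of_nonneg_ae _ hI2]
    · have : Set.Ioi (0 : ℝ) ⊆ (Function.support fun t => t⁻¹ * (gaussianEnergy α α t -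
        (gaussianEnergy α β t + gaussianEnergy β α t) + gaussianEnergy β β t)) ∩ Set.Ioi 0 := by
        intro t ht
        exact ⟨(mul_pos (inv_pos.2 ht) (gaussianEnergy_sub_pos hne ht)).ne', ht⟩
      refine lt_of_lt_of_le ?_ (measure_mono this)
      simp
    · filter_upwards [ae_restrict_mem measurableSet_Ioi] with t ht
      exact (mul_pos (inv_pos.2 ht) (gaussianEnergy_sub_pos hne ht)).le
  have hfin : ∫ t in Set.Ioi (0 : ℝ), t⁻¹ * (gaussianEnergy α α t -
      (gaussianEnergy α β t + gaussianEnergy β α t) + gaussianEnergy β β t)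
      = 2 * ((-∫ p : ℂ × ℂ, Real.log ‖p.1 - p.2‖ ∂(α.prod α))
      - ((-∫ p : ℂ × ℂ, Real.log ‖p.1 - p.2‖ ∂(α.prod β))
        + (-∫ p : ℂ × ℂ, Real.log ‖p.1 - p.2‖ ∂(β.prod α)))
      + (-∫ p : ℂ × ℂ, Real.log ‖p.1 - p.2‖ ∂(β.prod β))) := by
    rw [show (2 * ((-∫ p : ℂ × ℂ, Real.log ‖p.1 - p.2‖ ∂(α.prod α))
      - ((-∫ p : ℂ × ℂ, Real.log ‖p.1 - p.2‖ ∂(α.prod β))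
        + (-∫ p : ℂ × ℂ, Real.log ‖p.1 - p.2‖ ∂(β.prod α)))
      + (-∫ p : ℂ × ℂ, Real.log ‖p.1 - p.2‖ ∂(β.prod β)))) = _ by
        rw [mul_add, mul_sub, mul_add], ← hE]
    refine setIntegral_congr_fun measurableSet_Ioi fun t _ => ?_
    simp only [Pi.add_apply, Pi.sub_apply, hmass]
    ring
  rw [hfin] at hpos
  linarith

/-! ### Logarithmic potentials -/

lemma measurable_log_norm_sub : Measurable fun p : ℂ × ℂ => Real.log ‖p.1 - p.2‖ := by fun_prop

/-- In polar coordinates the integrand is r log r, which is continuous at 0. -/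
lemma integrableOn_log_norm (R : ℝ) :
    IntegrableOn (fun w : ℂ => Real.log ‖w‖) (Metric.ball 0 R) := by
  rw [integrableOn_fun_norm_addHaar (μ := (volume : Measure ℂ)) (f := Real.log)]
  simp only [Complex.finrank_real_complex, Nat.add_one_sub_one, pow_one, smul_eq_mul]
  have : Continuous fun y : ℝ => y * Real.log y := Real.continuous_mul_log
  exact (this.continuousOn.integrableOn_Icc (a := 0) (b := R)).mono_set Set.Ioo_subset_Icc_self

lemma integrableOn_log_norm_sub (z₀ a : ℂ) (R : ℝ) :
    IntegrableOn (fun z : ℂ => Real.log ‖z - a‖) (Metric.ball z₀ R) := by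
  have h := integrableOn_log_norm (R + ‖z₀ - a‖)
  have hmp : MeasurePreserving (fun z : ℂ => z - a) volume volume :=
    measurePreserving_sub_right volume a
  have hemb : MeasurableEmbedding (fun z : ℂ => z - a) :=
    (Homeomorph.subRight a).measurableEmbedding
  have h2 := (hmp.integrableOn_comp_preimage hemb).2 h
  refine h2.mono_set fun z hz => ?_
  simp only [Set.mem_preimage, Metric.mem_ball, dist_zero_right]
  rw [Metric.mem_ball, dist_eq_norm] at hz
  calc ‖z - a‖ = ‖(z - z₀) + (z₀ - a)‖ := by ring_nf
    _ ≤ _ := norm_add_le _ _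
    _ < _ := by linarith

lemma integral_abs_log_norm_sub_le {a : ℂ} {R ϱ : ℝ} (ha : ‖a‖ ≤ ϱ) :
    ∫ z in Metric.ball (0 : ℂ) R, |Real.log ‖z - a‖|
      ≤ ∫ w in Metric.ball (0 : ℂ) (R + ϱ), |Real.log ‖w‖| := by
  have hmp : MeasurePreserving (fun z : ℂ => z - a) volume volume :=
    measurePreserving_sub_right volume a
  have hemb : MeasurableEmbedding (fun z : ℂ => z - a) :=
    (Homeomorph.subRight a).measurableEmbedding
  rw [← hmp.setIntegral_preimage_emb hemb (fun w => |Real.log ‖w‖|)]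
  have h := (integrableOn_log_norm (R + ϱ)).abs
  refine setIntegral_mono_set ((hmp.integrableOn_comp_preimage hemb).2 h)
    (ae_of_all _ fun z => abs_nonneg _) (LE.le.eventuallyLE fun z hz => ?_)
  simp only [Set.mem_preimage, Metric.mem_ball, dist_zero_right] at *
  have := norm_sub_le z a
  linarith

lemma circleAverage_log_norm_sub (a c : ℂ) {r : ℝ} (hr : 0 < r) :
    Real.circleAverage (fun z => Real.log ‖z - a‖) c r = Real.log (max r ‖c - a‖) := by
  have h := circleAverage_log_norm_sub_const_eq_log_radius_add_posLog (a := a) (c := c) hr.ne'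
  rw [h]
  rcases le_total ‖c - a‖ r with h1 | h1
  · rw [max_eq_left h1, Real.posLog_eq_zero_iff _ |>.2, add_zero]
    rw [abs_of_nonneg (by positivity), inv_mul_le_iff₀ hr, mul_one]
    exact h1
  · have hpos : 0 < ‖c - a‖ := hr.trans_le h1
    rw [max_eq_right h1, Real.posLog_eq_log, Real.log_mul (by positivity) hpos.ne', Real.log_inv]
    · ring
    · rw [abs_of_nonneg (by positivity), le_inv_mul_iff₀ hr, mul_one]
      exact h1

lemma abs_log_eq (x : ℝ) : |Real.log x| = 2 * Real.posLog x - Real.log x := by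
  rw [Real.posLog]
  rcases le_total 0 (Real.log x) with h | h
  · rw [max_eq_right h, abs_of_nonneg h]; ring
  · rw [max_eq_left h, abs_of_nonpos h]; ring

lemma integrableOn_log_circleMap (a c : ℂ) (r : ℝ) :
    IntegrableOn (fun θ => Real.log ‖circleMap c r θ - a‖) (Set.Ioc 0 (2 * Real.pi)) := by
  have h : CircleIntegrable (fun z => Real.log ‖z - a‖) c r := circleIntegrable_log_norm_sub_const r
  exact (intervalIntegrable_iff_integrableOn_Ioc_of_le Real.two_pi_pos.le).1 h

lemma integral_log_circleMap (a c : ℂ) {r : ℝ} (hr : 0 < r) :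
    ∫ θ in Set.Ioc 0 (2 * Real.pi), Real.log ‖circleMap c r θ - a‖
      = 2 * Real.pi * Real.log (max r ‖c - a‖) := by
  have h := circleAverage_log_norm_sub a c hr
  rw [Real.circleAverage_def, intervalIntegral.integral_of_le Real.two_pi_pos.le, smul_eq_mul] at h
  rw [← h, mul_inv_cancel_left₀ Real.two_pi_pos.ne']

/-- Since |log x| = 2 log⁺ x - log x, the exact circle mean of the logarithm and a crude bound on
its positive part control the L¹ norm, even when a lies on the circle. -/
lemma integral_abs_log_circleMap_le (a c : ℂ) {r : ℝ} (hr : 0 < r) :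
    ∫ θ in Set.Ioc 0 (2 * Real.pi), |Real.log ‖circleMap c r θ - a‖|
      ≤ 2 * Real.pi * (2 * Real.posLog (‖c - a‖ + r) - Real.log (max r ‖c - a‖)) := by
  have hI := integrableOn_log_circleMap a c r
  have hle : ∀ θ, |Real.log ‖circleMap c r θ - a‖|
      ≤ 2 * Real.posLog (‖c - a‖ + r) - Real.log ‖circleMap c r θ - a‖ := by
    intro θ
    rw [abs_log_eq]
    have : ‖circleMap c r θ - a‖ ≤ ‖c - a‖ + r := by
      have : circleMap c r θ - a = (c - a) + circleMap 0 r θ := by simp [circleMap]; ring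
      rw [this]
      refine (norm_add_le _ _).trans ?_
      rw [norm_circleMap_zero, abs_of_pos hr]
    have := Real.posLog_le_posLog (norm_nonneg _) this
    linarith
  have hc : IntegrableOn (fun _ : ℝ => 2 * Real.posLog (‖c - a‖ + r)) (Set.Ioc 0 (2 * Real.pi)) :=
    integrableOn_const measure_Ioc_lt_top.ne
  calc _ ≤ ∫ θ in Set.Ioc 0 (2 * Real.pi),
        (2 * Real.posLog (‖c - a‖ + r) - Real.log ‖circleMap c r θ - a‖) :=
        integral_mono hI.abs (hc.sub hI) hle
    _ = _ := by
      rw [integral_sub hc hI, integral_log_circleMap a c hr, setIntegral_const]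
      simp [Real.pi_pos.le]
      ring

/-- Sub-mean value property of `log ‖· - a‖` on discs. -/
lemma log_norm_sub_le_disc_integral {z₀ a : ℂ} (ha : z₀ ≠ a) {ρ : ℝ} :
    volume.real (Metric.ball z₀ ρ) * Real.log ‖z₀ - a‖
      ≤ ∫ z in Metric.ball z₀ ρ, Real.log ‖z - a‖ := by
  set J := ∫ z in Metric.ball z₀ ρ, Real.log ‖z - a‖ with hJ
  -- The disc is averaged over all its rotations: each rotation preserves the integral. After
  -- exchanging integrals, every inner integral is a circle mean about z₀, where Jensen's formula
  -- gives the bound.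
  set F : ℂ × ℝ → ℝ := fun p => Real.log ‖z₀ + Complex.exp (p.2 * Complex.I) * p.1 - a‖ with hF
  have hmp : ∀ θ : ℝ, MeasurePreserving (fun w : ℂ => z₀ + Complex.exp (θ * Complex.I) * w)
      volume volume := by
    intro θ
    have h1 : MeasurePreserving (fun w : ℂ => Complex.exp (θ * Complex.I) * w) volume volume :=
      (rotation (Circle.exp θ)).measurePreserving
    have h2 := (measurePreserving_add_left (volume : Measure ℂ) z₀).comp h1
    exact h2
  have hemb : ∀ θ : ℝ, MeasurableEmbedding
      (fun w : ℂ => z₀ + Complex.exp (θ * Complex.I) * w) := by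
    intro θ
    have h1 := (rotation (Circle.exp θ)).toHomeomorph.trans (Homeomorph.addLeft z₀)
    exact ((rotation (Circle.exp θ)).toHomeomorph.trans (Homeomorph.addLeft z₀)).measurableEmbedding
  have hpre : ∀ θ : ℝ, (fun w : ℂ => z₀ + Complex.exp (θ * Complex.I) * w) ⁻¹' (Metric.ball z₀ ρ)
      = Metric.ball 0 ρ := by
    intro θ
    ext w
    simp [Metric.mem_ball, dist_eq_norm, Complex.norm_exp_ofReal_mul_I]
  have hin : ∀ θ : ℝ, IntegrableOn (fun w => F (w, θ)) (Metric.ball 0 ρ) := by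
    intro θ
    have := ((hmp θ).integrableOn_comp_preimage (hemb θ)).2 (integrableOn_log_norm_sub z₀ a ρ)
    rw [hpre] at this
    exact this
  have hval : ∀ θ : ℝ, ∫ w in Metric.ball 0 ρ, F (w, θ) = J := by
    intro θ
    have := (hmp θ).setIntegral_preimage_emb (hemb θ) (fun z => Real.log ‖z - a‖)
      (Metric.ball z₀ ρ)
    rw [hpre] at this
    exact this
  have hval2 : ∀ θ : ℝ, ∫ w in Metric.ball 0 ρ, ‖F (w, θ)‖
      = ∫ z in Metric.ball z₀ ρ, ‖Real.log ‖z - a‖‖ := by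
    intro θ
    have := (hmp θ).setIntegral_preimage_emb (hemb θ) (fun z => ‖Real.log ‖z - a‖‖)
      (Metric.ball z₀ ρ)
    rw [hpre] at this
    exact this
  have hFm : Measurable F := by
    rw [hF]; fun_prop
  have hFint : Integrable F ((volume.restrict (Metric.ball 0 ρ)).prod
      (volume.restrict (Set.Ioc 0 (2 * Real.pi)))) := by
    rw [integrable_prod_iff' hFm.aestronglyMeasurable]
    refine ⟨ae_of_all _ hin, ?_⟩
    simp only [hval2]
    exact integrableOn_const measure_Ioc_lt_top.ne
  have hswap := integral_integral_swap (f := fun w θ => F (w, θ)) hFint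
  simp only [hval, setIntegral_const] at hswap
  have hlow : ∀ᵐ w ∂(volume.restrict (Metric.ball (0 : ℂ) ρ)),
      2 * Real.pi * Real.log ‖z₀ - a‖ ≤ ∫ θ in Set.Ioc 0 (2 * Real.pi), F (w, θ) := by
    have hne : ∀ᵐ w ∂(volume.restrict (Metric.ball (0 : ℂ) ρ)), w ≠ 0 :=
      ae_restrict_of_ae (by simp [ae_iff])
    filter_upwards [hne] with w hw
    have hr : 0 < ‖w‖ := norm_pos_iff.2 hw
    have h1 := circleAverage_log_norm_sub a z₀ hr
    rw [Real.circleAverage_eq_integral_add (Complex.arg w),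
      intervalIntegral.integral_of_le Real.two_pi_pos.le, smul_eq_mul] at h1
    have h2 : ∀ θ : ℝ, circleMap z₀ ‖w‖ (θ + Complex.arg w)
        = z₀ + Complex.exp (θ * Complex.I) * w := by
      intro θ
      rw [circleMap]
      congr 1
      conv_rhs => rw [← Complex.norm_mul_exp_arg_mul_I w]
      push_cast
      rw [add_mul, Complex.exp_add]
      ring
    simp only [h2] at h1
    have h3 : ∫ θ in Set.Ioc 0 (2 * Real.pi), F (w, θ)
        = 2 * Real.pi * Real.log (max ‖w‖ ‖z₀ - a‖) := by
      rw [← h1, mul_inv_cancel_left₀ Real.two_pi_pos.ne']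
    rw [h3]
    refine mul_le_mul_of_nonneg_left (Real.log_le_log ?_ (le_max_right _ _)) Real.two_pi_pos.le
    exact norm_pos_iff.2 (sub_ne_zero.2 ha)
  have : IsFiniteMeasure (volume.restrict (Metric.ball (0 : ℂ) ρ)) :=
    isFiniteMeasure_restrict.2 measure_ball_lt_top.ne
  have hmono := integral_mono_ae (integrable_const _) hFint.integral_prod_left hlow
  rw [setIntegral_const, hswap] at hmono
  have hvol : volume.real (Metric.ball (0 : ℂ) ρ) = volume.real (Metric.ball z₀ ρ) := by
    simp only [measureReal_def, Complex.volume_ball]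
  rw [hvol] at hmono
  have hpi := Real.two_pi_pos
  simp only [smul_eq_mul, Real.volume_real_Ioc_of_le Real.two_pi_pos.le, sub_zero] at hmono
  have : 2 * Real.pi * (volume.real (Metric.ball z₀ ρ) * Real.log ‖z₀ - a‖) ≤ 2 * Real.pi * J := by
    linarith
  exact le_of_mul_le_mul_left this hpi

/-- The logarithmic potential `∫ log ‖z - a‖ dm(a)`. -/
noncomputable def logPotential (m : Measure ℂ) (z : ℂ) : ℝ := ∫ a, Real.log ‖z - a‖ ∂m

lemma stronglyMeasurable_logPotential (m : Measure ℂ) [SFinite m] :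
    StronglyMeasurable (logPotential m) :=
  (measurable_log_norm_sub.stronglyMeasurable).integral_prod_right (ν := m)

lemma integrable_log_prod (m : Measure ℂ) [IsFiniteMeasure m] {ϱ : ℝ}
    (hm : ∀ᵐ a ∂m, ‖a‖ ≤ ϱ) (R : ℝ) :
    Integrable (fun p : ℂ × ℂ => Real.log ‖p.1 - p.2‖)
      ((volume.restrict (Metric.ball 0 R)).prod m) := by
  rw [integrable_prod_iff' measurable_log_norm_sub.aestronglyMeasurable]
  refine ⟨ae_of_all _ fun a => integrableOn_log_norm_sub 0 a R, ?_⟩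
  refine (integrable_const (∫ w in Metric.ball (0 : ℂ) (R + ϱ), |Real.log ‖w‖|)).mono' ?_ ?_
  · exact (measurable_log_norm_sub.norm.stronglyMeasurable.integral_prod_left
      (μ := volume.restrict (Metric.ball 0 R))).aestronglyMeasurable
  · filter_upwards [hm] with a ha
    rw [Real.norm_eq_abs, abs_of_nonneg (integral_nonneg fun _ => norm_nonneg _)]
    exact integral_abs_log_norm_sub_le ha

lemma integrableOn_logPotential (m : Measure ℂ) [IsFiniteMeasure m] {ϱ : ℝ}
    (hm : ∀ᵐ a ∂m, ‖a‖ ≤ ϱ) (R : ℝ) :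
    IntegrableOn (logPotential m) (Metric.ball 0 R) :=
  (integrable_log_prod m hm R).integral_prod_left

lemma integrable_log_circle_prod (m : Measure ℂ) [IsFiniteMeasure m] {ϱ : ℝ}
    (hm : ∀ᵐ a ∂m, ‖a‖ ≤ ϱ) (c : ℂ) {r : ℝ} (hr : 0 < r) :
    Integrable (fun p : ℝ × ℂ => Real.log ‖circleMap c r p.1 - p.2‖)
      ((volume.restrict (Set.Ioc 0 (2 * Real.pi))).prod m) := by
  have hmeas : Measurable (fun p : ℝ × ℂ => Real.log ‖circleMap c r p.1 - p.2‖) := by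
    unfold circleMap; fun_prop
  rw [integrable_prod_iff' hmeas.aestronglyMeasurable]
  refine ⟨ae_of_all _ fun a => integrableOn_log_circleMap a c r, ?_⟩
  refine (integrable_const (2 * Real.pi * (2 * Real.posLog (‖c‖ + ϱ + r) - Real.log r))).mono' ?_ ?_
  · exact (hmeas.norm.stronglyMeasurable.integral_prod_left
      (μ := volume.restrict (Set.Ioc 0 (2 * Real.pi)))).aestronglyMeasurable
  · filter_upwards [hm] with a ha
    rw [Real.norm_eq_abs, abs_of_nonneg (integral_nonneg fun _ => norm_nonneg _)]
    refine (integral_abs_log_circleMap_le a c hr).trans ?_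
    refine mul_le_mul_of_nonneg_left ?_ Real.two_pi_pos.le
    have h1 : Real.posLog (‖c - a‖ + r) ≤ Real.posLog (‖c‖ + ϱ + r) :=
      Real.posLog_le_posLog (by positivity) (by linarith [norm_sub_le c a])
    have h2 : Real.log r ≤ Real.log (max r ‖c - a‖) := Real.log_le_log hr (le_max_left _ _)
    linarith

lemma integrableOn_logPotential_circle (m : Measure ℂ) [IsFiniteMeasure m] {ϱ : ℝ}
    (hm : ∀ᵐ a ∂m, ‖a‖ ≤ ϱ) (c : ℂ) {r : ℝ} (hr : 0 < r) :
    IntegrableOn (fun θ => logPotential m (circleMap c r θ)) (Set.Ioc 0 (2 * Real.pi)) :=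
  (integrable_log_circle_prod m hm c hr).integral_prod_left

lemma integral_logPotential_circle (m : Measure ℂ) [IsFiniteMeasure m] {ϱ : ℝ}
    (hm : ∀ᵐ a ∂m, ‖a‖ ≤ ϱ) (c : ℂ) {r : ℝ} (hr : 0 < r) :
    ∫ θ in Set.Ioc 0 (2 * Real.pi), logPotential m (circleMap c r θ)
      = 2 * Real.pi * ∫ a, Real.log (max r ‖c - a‖) ∂m := by
  unfold logPotential
  rw [integral_integral_swap (f := fun θ a => Real.log ‖circleMap c r θ - a‖)
    (integrable_log_circle_prod m hm c hr)]
  simp only [integral_log_circleMap _ _ hr, integral_const_mul]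

/-! ### Smoothing kernels and comparison of measures through their potentials -/

/-- The truncated kernel `log (max r ‖x‖) - log ‖x‖`, the difference of the average of `log ‖·‖`
over the circle of radius `r` around `x` and of `log ‖x‖`. -/
noncomputable def capKernel (r : ℝ) (x : ℂ) : ℝ := Real.log (max r ‖x‖) - Real.log ‖x‖

lemma capKernel_nonneg {r : ℝ} {x : ℂ} (hx : x ≠ 0) : 0 ≤ capKernel r x :=
  sub_nonneg.2 (Real.log_le_log (norm_pos_iff.2 hx) (le_max_right _ _))

lemma capKernel_eq_zero {r : ℝ} {x : ℂ} (hx : r ≤ ‖x‖) : capKernel r x = 0 := by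
  rw [capKernel, max_eq_right hx, sub_self]

lemma integrable_capKernel (r : ℝ) : Integrable (capKernel r) := by
  have h1 : IntegrableOn (capKernel r) (Metric.ball 0 r) := by
    refine Integrable.sub ?_ (integrableOn_log_norm r)
    refine IntegrableOn.congr_fun (f := fun _ => Real.log r)
      (integrableOn_const measure_ball_lt_top.ne) (fun x hx => ?_) measurableSet_ball
    rw [Metric.mem_ball, dist_zero_right] at hx
    rw [max_eq_left hx.le]
  rwa [integrableOn_iff_integrable_of_support_subset] at h1
  intro x hx
  by_contra hx2
  rw [Metric.mem_ball, dist_zero_right, not_lt] at hx2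
  exact hx (capKernel_eq_zero hx2)

lemma ae_ne_const (a : ℂ) : ∀ᵐ z ∂(volume : Measure ℂ), z ≠ a := by simp [ae_iff]

lemma integral_capKernel_pos {r : ℝ} (hr : 0 < r) : 0 < ∫ x, capKernel r x := by
  rw [integral_pos_iff_support_of_nonneg_ae _ (integrable_capKernel r)]
  · have hsub : Metric.ball 0 r \ {0} ⊆ Function.support (capKernel r) := by
      rintro x ⟨hx, hx0⟩
      rw [Metric.mem_ball, dist_zero_right] at hx
      have hx0 : 0 < ‖x‖ := norm_pos_iff.2 hx0
      rw [Function.mem_support, capKernel, max_eq_left hx.le]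
      exact (sub_pos.2 (Real.log_lt_log hx0 hx)).ne'
    refine lt_of_lt_of_le ?_ (measure_mono hsub)
    rw [measure_sdiff_null (by simp)]
    exact Metric.measure_ball_pos _ _ hr
  · filter_upwards [ae_ne_const 0] with x hx using capKernel_nonneg hx

/-- Convolution of `φ` with the truncated kernel. -/
noncomputable def capConv (r : ℝ) (φ : ℂ → ℝ) (a : ℂ) : ℝ := ∫ z, φ z * capKernel r (z - a)

lemma integrable_capKernel_sub (r : ℝ) (a : ℂ) :
    Integrable (fun z => capKernel r (z - a)) := (integrable_capKernel r).comp_sub_right a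

lemma integrable_mul_capKernel {Φ : ℝ} (r : ℝ) {φ : ℂ → ℝ} (hφ : Continuous φ)
    (hb : ∀ z, |φ z| ≤ Φ) (a : ℂ) : Integrable (fun z => φ z * capKernel r (z - a)) :=
  (integrable_capKernel_sub r a).bdd_mul hφ.aestronglyMeasurable (ae_of_all _ hb)

/-- The kernel is nonnegative off the origin and vanishes outside the disc of radius r, where φ
varies by at most ω. Convolution is thus nearly multiplication by the kernel's mass. -/
lemma abs_capConv_sub_le {r Φ ω : ℝ} {φ : ℂ → ℝ} (hφ : Continuous φ)
    (hb : ∀ z, |φ z| ≤ Φ) (hω : ∀ z w, ‖z - w‖ < r → |φ z - φ w| ≤ ω) (a : ℂ) :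
    |capConv r φ a - (∫ x, capKernel r x) * φ a| ≤ ω * ∫ x, capKernel r x := by
  have e1 : (∫ x, capKernel r x) = ∫ z, capKernel r (z - a) :=
    (integral_sub_right_eq_self (capKernel r) a).symm
  have hi := integrable_capKernel_sub r a
  have e2 : capConv r φ a - (∫ x, capKernel r x) * φ a
      = ∫ z, (φ z - φ a) * capKernel r (z - a) := by
    rw [e1, mul_comm, ← integral_const_mul, capConv,
      ← integral_sub (integrable_mul_capKernel r hφ hb a) (hi.const_mul _)]
    simp only [sub_mul]
  rw [e2, e1, ← integral_const_mul, ← Real.norm_eq_abs]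
  refine norm_integral_le_of_norm_le (hi.const_mul ω) ?_
  filter_upwards [ae_ne_const a] with z hz
  have h0 := capKernel_nonneg (r := r) (sub_ne_zero.2 hz)
  rw [norm_mul, Real.norm_eq_abs, Real.norm_eq_abs, abs_of_nonneg h0]
  rcases lt_or_ge ‖z - a‖ r with h | h
  · exact mul_le_mul_of_nonneg_right (hω z a h) h0
  · rw [capKernel_eq_zero h]; simp

lemma capConv_eq_setIntegral {r R : ℝ} {φ : ℂ → ℝ} (hsupp : ∀ z, R ≤ ‖z‖ → φ z = 0) (a : ℂ) :
    capConv r φ a = ∫ z in Metric.ball 0 R, φ z * capKernel r (z - a) := by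
  rw [capConv, setIntegral_eq_integral_of_forall_compl_eq_zero]
  intro z hz
  rw [Metric.mem_ball, dist_zero_right, not_lt] at hz
  rw [hsupp z hz, zero_mul]

lemma abs_log_max_le {r ϱ : ℝ} (hr : 0 < r) {z a : ℂ} (ha : ‖a‖ ≤ ϱ) :
    |Real.log (max r ‖z - a‖)| ≤ |Real.log r| + Real.posLog (r + ‖z‖ + ϱ) := by
  have h1 : Real.log r ≤ Real.log (max r ‖z - a‖) := Real.log_le_log hr (le_max_left _ _)
  have hm : 0 < max r ‖z - a‖ := lt_max_of_lt_left hr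
  have h2 : Real.log (max r ‖z - a‖) ≤ Real.posLog (r + ‖z‖ + ϱ) := by
    refine (le_max_right 0 _).trans (Real.posLog_le_posLog hm.le (max_le ?_ ?_))
    · linarith [norm_nonneg z, (norm_nonneg a).trans ha]
    · linarith [norm_sub_le z a]
  have h3 : 0 ≤ Real.posLog (r + ‖z‖ + ϱ) := Real.posLog_nonneg
  rw [abs_le]
  constructor
  · linarith [neg_abs_le (Real.log r)]
  · linarith [abs_nonneg (Real.log r)]

lemma integrable_capKernel_prod (m : Measure ℂ) [IsFiniteMeasure m] {ϱ : ℝ}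
    (hm : ∀ᵐ a ∂m, ‖a‖ ≤ ϱ) {r : ℝ} (hr : 0 < r) (R : ℝ) :
    Integrable (fun p : ℂ × ℂ => capKernel r (p.1 - p.2))
      ((volume.restrict (Metric.ball 0 R)).prod m) := by
  have : IsFiniteMeasure (volume.restrict (Metric.ball (0 : ℂ) R)) :=
    isFiniteMeasure_restrict.2 measure_ball_lt_top.ne
  refine (Integrable.sub ?_ (integrable_log_prod m hm R))
  refine (integrable_const (|Real.log r| + Real.posLog (r + R + ϱ))).mono' ?_ ?_
  · exact Measurable.aestronglyMeasurable (by fun_prop)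
  · have h1 : ∀ᵐ p ∂((volume.restrict (Metric.ball (0 : ℂ) R)).prod m), ‖p.2‖ ≤ ϱ :=
      Measure.quasiMeasurePreserving_snd.ae hm
    have h2 : ∀ᵐ p ∂((volume.restrict (Metric.ball (0 : ℂ) R)).prod m), ‖p.1‖ < R := by
      refine Measure.quasiMeasurePreserving_fst.ae (p := fun z : ℂ => ‖z‖ < R) ?_
      filter_upwards [ae_restrict_mem measurableSet_ball] with z hz
      simpa using hz
    filter_upwards [h1, h2] with p hp1 hp2
    refine (abs_log_max_le hr hp1).trans ?_
    have : Real.posLog (r + ‖p.1‖ + ϱ) ≤ Real.posLog (r + R + ϱ) :=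
      Real.posLog_le_posLog (by linarith [norm_nonneg p.1, (norm_nonneg p.2).trans hp1])
        (by linarith)
    linarith

/-- Integrating the kernel against m turns it into the circle mean of the potential of m minus the
potential itself. So the smoothed integral sees m only through its potential. -/
lemma integral_capConv (m : Measure ℂ) [IsFiniteMeasure m] {ϱ : ℝ}
    (hm : ∀ᵐ a ∂m, ‖a‖ ≤ ϱ) {r R Φ : ℝ} (hr : 0 < r) {φ : ℂ → ℝ} (hφ : Continuous φ)
    (hb : ∀ z, |φ z| ≤ Φ) (hsupp : ∀ z, R ≤ ‖z‖ → φ z = 0) :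
    Integrable (capConv r φ) m ∧
    Integrable (fun z => φ z * ((2 * Real.pi)⁻¹ * (∫ θ in Set.Ioc 0 (2 * Real.pi),
      logPotential m (circleMap z r θ)) - logPotential m z)) (volume.restrict (Metric.ball 0 R)) ∧
    ∫ a, capConv r φ a ∂m = ∫ z in Metric.ball 0 R, φ z *
      ((2 * Real.pi)⁻¹ * (∫ θ in Set.Ioc 0 (2 * Real.pi), logPotential m (circleMap z r θ))
        - logPotential m z) := by
  have hK := integrable_capKernel_prod m hm hr R
  have hφK : Integrable (fun p : ℂ × ℂ => φ p.1 * capKernel r (p.1 - p.2))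
      ((volume.restrict (Metric.ball 0 R)).prod m) :=
    hK.bdd_mul (hφ.comp continuous_fst).aestronglyMeasurable (ae_of_all _ fun p => hb p.1)
  have hae : ∀ᵐ z ∂(volume.restrict (Metric.ball (0 : ℂ) R)),
      ∫ a, φ z * capKernel r (z - a) ∂m = φ z * ((2 * Real.pi)⁻¹ *
        (∫ θ in Set.Ioc 0 (2 * Real.pi), logPotential m (circleMap z r θ)) - logPotential m z) := by
    filter_upwards [(integrable_log_prod m hm R).prod_right_ae] with z hz
    rw [integral_const_mul, integral_logPotential_circle m hm z hr,
      inv_mul_cancel_left₀ Real.two_pi_pos.ne', logPotential, ← integral_sub _ hz]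
    · rfl
    · refine (integrable_const (|Real.log r| + Real.posLog (r + ‖z‖ + ϱ))).mono' ?_ ?_
      · exact Measurable.aestronglyMeasurable (by fun_prop)
      · filter_upwards [hm] with a ha using abs_log_max_le hr ha
  have hconv : capConv r φ = fun a => ∫ z in Metric.ball 0 R, φ z * capKernel r (z - a) :=
    funext fun a => capConv_eq_setIntegral hsupp a
  refine ⟨?_, ?_, ?_⟩
  · rw [hconv]
    exact hφK.integral_prod_right
  · exact hφK.integral_prod_left.congr hae
  · rw [hconv, ← integral_integral_swap (f := fun z a => φ z * capKernel r (z - a)) hφK]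
    exact integral_congr_ae hae

/-- The constant b drops out because it is common to the circle mean and the centre value. Each of
these contributes one L¹ norm, whence the factor 2. Translating along the circle costs the
enlargement of the disc by r. -/
lemma abs_integral_capConv_sub_le (m₁ m₂ : Measure ℂ) [IsFiniteMeasure m₁] [IsFiniteMeasure m₂]
    {ϱ₁ ϱ₂ : ℝ} (hm₁ : ∀ᵐ a ∂m₁, ‖a‖ ≤ ϱ₁) (hm₂ : ∀ᵐ a ∂m₂, ‖a‖ ≤ ϱ₂) {r R Φ b : ℝ} (hr : 0 < r)
    {φ : ℂ → ℝ} (hφ : Continuous φ) (hb : ∀ z, |φ z| ≤ Φ) (hsupp : ∀ z, R ≤ ‖z‖ → φ z = 0) :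
    |∫ a, capConv r φ a ∂m₁ - ∫ a, capConv r φ a ∂m₂|
      ≤ 2 * Φ * ∫ z in Metric.ball 0 (R + r), |logPotential m₁ z - logPotential m₂ z + b| := by
  obtain ⟨-, j1, e1⟩ := integral_capConv m₁ hm₁ hr hφ hb hsupp
  obtain ⟨-, j2, e2⟩ := integral_capConv m₂ hm₂ hr hφ hb hsupp
  set g : ℂ → ℝ := fun z => logPotential m₁ z - logPotential m₂ z + b with hg
  set ε := ∫ z in Metric.ball 0 (R + r), |g z| with hε
  have hΦ : 0 ≤ Φ := (abs_nonneg _).trans (hb 0)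
  have hgm : StronglyMeasurable g := ((stronglyMeasurable_logPotential m₁).sub
    (stronglyMeasurable_logPotential m₂)).add stronglyMeasurable_const
  have hgi : ∀ R, IntegrableOn g (Metric.ball 0 R) := fun R =>
    ((integrableOn_logPotential m₁ hm₁ R).sub (integrableOn_logPotential m₂ hm₂ R)).add
      (integrableOn_const measure_ball_lt_top.ne)
  have hmp : ∀ θ : ℝ, MeasurePreserving (fun z : ℂ => circleMap z r θ) volume volume := fun θ =>
    measurePreserving_add_right volume (r * Complex.exp (θ * Complex.I))
  have hemb : ∀ θ : ℝ, MeasurableEmbedding (fun z : ℂ => circleMap z r θ) := fun θ =>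
    (Homeomorph.addRight (r * Complex.exp (θ * Complex.I))).measurableEmbedding
  have hsub : ∀ θ, Metric.ball 0 R ⊆
      (fun z : ℂ => circleMap z r θ) ⁻¹' (Metric.ball 0 (R + r)) := by
    intro θ z hz
    simp only [Set.mem_preimage, Metric.mem_ball, dist_zero_right] at *
    have h1 : circleMap z r θ = z + circleMap 0 r θ := by simp [circleMap]
    have := norm_add_le z (circleMap 0 r θ)
    rw [norm_circleMap_zero, abs_of_pos hr] at this
    rw [h1]
    linarith
  have hti0 : ∀ θ, IntegrableOn (fun z => g (circleMap z r θ))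
      ((fun z : ℂ => circleMap z r θ) ⁻¹' (Metric.ball 0 (R + r))) := fun θ =>
    ((hmp θ).integrableOn_comp_preimage (hemb θ)).2 (hgi (R + r))
  have hti : ∀ θ, IntegrableOn (fun z => g (circleMap z r θ)) (Metric.ball 0 R) := fun θ =>
    (hti0 θ).mono_set (hsub θ)
  have htε : ∀ θ, ∫ z in Metric.ball 0 R, ‖g (circleMap z r θ)‖ ≤ ε := by
    intro θ
    rw [hε, ← (hmp θ).setIntegral_preimage_emb (hemb θ) (fun z => |g z|)]
    exact setIntegral_mono_set (hti0 θ).abs (ae_of_all _ fun _ => abs_nonneg _)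
      (LE.le.eventuallyLE (hsub θ))
  have hmeas : StronglyMeasurable fun p : ℂ × ℝ => g (circleMap p.1 r p.2) := by
    refine hgm.comp_measurable ?_
    unfold circleMap; fun_prop
  have hprod : Integrable (fun p : ℂ × ℝ => g (circleMap p.1 r p.2))
      ((volume.restrict (Metric.ball 0 R)).prod (volume.restrict (Set.Ioc 0 (2 * Real.pi)))) := by
    rw [integrable_prod_iff' hmeas.aestronglyMeasurable]
    refine ⟨ae_of_all _ hti, ?_⟩
    refine (integrable_const ε).mono' (hmeas.norm.integral_prod_left
      (μ := volume.restrict (Metric.ball 0 R))).aestronglyMeasurable (ae_of_all _ fun θ => ?_)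
    rw [Real.norm_eq_abs, abs_of_nonneg (integral_nonneg fun _ => norm_nonneg _)]
    exact htε θ
  have hnorm : ∫ z in Metric.ball 0 R, ∫ θ in Set.Ioc 0 (2 * Real.pi), ‖g (circleMap z r θ)‖
      ≤ 2 * Real.pi * ε := by
    rw [integral_integral_swap (f := fun z θ => ‖g (circleMap z r θ)‖) hprod.norm]
    calc _ ≤ ∫ θ in Set.Ioc 0 (2 * Real.pi), ε :=
          integral_mono hprod.norm.integral_prod_right (integrable_const _) htε
      _ = _ := by simp [Real.pi_pos.le]
  have hdiff : ∀ z, φ z * ((2 * Real.pi)⁻¹ * (∫ θ in Set.Ioc 0 (2 * Real.pi),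
      logPotential m₁ (circleMap z r θ)) - logPotential m₁ z) - φ z * ((2 * Real.pi)⁻¹ *
      (∫ θ in Set.Ioc 0 (2 * Real.pi), logPotential m₂ (circleMap z r θ)) - logPotential m₂ z)
      = φ z * ((2 * Real.pi)⁻¹ * (∫ θ in Set.Ioc 0 (2 * Real.pi), g (circleMap z r θ)) - g z) := by
    intro z
    have i1 := integrableOn_logPotential_circle m₁ hm₁ z hr
    have i2 := integrableOn_logPotential_circle m₂ hm₂ z hr
    have : ∫ θ in Set.Ioc 0 (2 * Real.pi), g (circleMap z r θ)
        = (∫ θ in Set.Ioc 0 (2 * Real.pi), logPotential m₁ (circleMap z r θ))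
          - (∫ θ in Set.Ioc 0 (2 * Real.pi), logPotential m₂ (circleMap z r θ))
          + 2 * Real.pi * b := by
      have h := integral_add' (i1.sub i2) (integrable_const (μ := volume.restrict
        (Set.Ioc 0 (2 * Real.pi))) b)
      rw [integral_sub' i1 i2, setIntegral_const] at h
      refine h.trans ?_
      simp [Real.pi_pos.le]
    rw [this]
    have hpi := Real.two_pi_pos.ne'
    simp only [hg]
    field_simp
    ring
  rw [e1, e2, ← integral_sub j1 j2, ← Real.norm_eq_abs]
  simp only [hdiff]
  have hbound : Integrable (fun z => Φ * ((2 * Real.pi)⁻¹ *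
      (∫ θ in Set.Ioc 0 (2 * Real.pi), ‖g (circleMap z r θ)‖) + |g z|))
      (volume.restrict (Metric.ball 0 R)) :=
    ((hprod.norm.integral_prod_left.const_mul _).add (hgi R).abs).const_mul Φ
  refine (norm_integral_le_of_norm_le hbound (ae_of_all _ fun z => ?_)).trans ?_
  · rw [norm_mul]
    refine mul_le_mul (hb z) ((norm_sub_le _ _).trans (add_le_add ?_ le_rfl)) (norm_nonneg _) hΦ
    rw [norm_mul, Real.norm_eq_abs (2 * Real.pi)⁻¹, abs_of_pos (inv_pos.2 Real.two_pi_pos)]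
    exact mul_le_mul_of_nonneg_left (norm_integral_le_integral_norm _)
      (inv_pos.2 Real.two_pi_pos).le
  · have h1 : ∫ z in Metric.ball 0 R, |g z| ≤ ε :=
      setIntegral_mono_set (hgi (R + r)).abs (ae_of_all _ fun _ => abs_nonneg _)
        (LE.le.eventuallyLE (Metric.ball_subset_ball (by linarith)))
    rw [integral_const_mul, integral_add (hprod.norm.integral_prod_left.const_mul _) (hgi R).abs,
      integral_const_mul]
    have h2 : (2 * Real.pi)⁻¹ * ∫ z in Metric.ball 0 R, ∫ θ in Set.Ioc 0 (2 * Real.pi),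
        ‖g (circleMap z r θ)‖ ≤ ε := by
      rw [inv_mul_le_iff₀ Real.two_pi_pos]; exact hnorm
    calc _ ≤ Φ * (ε + ε) := mul_le_mul_of_nonneg_left (add_le_add h2 h1) hΦ
      _ = _ := by ring

/-- Two compactly supported measures whose potentials are close in `L¹` up to a constant have close
integrals against a continuous compactly supported function. -/
theorem integral_sub_le_of_potential (m₁ m₂ : Measure ℂ) [IsFiniteMeasure m₁] [IsFiniteMeasure m₂]
    {ϱ₁ ϱ₂ : ℝ} (hm₁ : ∀ᵐ a ∂m₁, ‖a‖ ≤ ϱ₁) (hm₂ : ∀ᵐ a ∂m₂, ‖a‖ ≤ ϱ₂) {r R Φ ω b : ℝ} (hr : 0 < r)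
    {φ : ℂ → ℝ} (hφ : Continuous φ) (hb : ∀ z, |φ z| ≤ Φ) (hsupp : ∀ z, R ≤ ‖z‖ → φ z = 0)
    (hω : ∀ z w, ‖z - w‖ < r → |φ z - φ w| ≤ ω) :
    (∫ x, capKernel r x) * |∫ a, φ a ∂m₁ - ∫ a, φ a ∂m₂|
      ≤ ω * (∫ x, capKernel r x) * (m₁.real Set.univ + m₂.real Set.univ)
        + 2 * Φ * ∫ z in Metric.ball 0 (R + r), |logPotential m₁ z - logPotential m₂ z + b| := by
  have h := abs_integral_capConv_sub_le m₁ m₂ hm₁ hm₂ (b := b) hr hφ hb hsupp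
  set C := ∫ x, capKernel r x with hC
  have hCpos : 0 < C := integral_capKernel_pos hr
  have key : ∀ (m : Measure ℂ) (_ : IsFiniteMeasure m) (ϱ : ℝ) (_ : ∀ᵐ a ∂m, ‖a‖ ≤ ϱ),
      |∫ a, capConv r φ a ∂m - C * ∫ a, φ a ∂m| ≤ ω * C * m.real Set.univ := by
    intro m _ ϱ hm
    obtain ⟨i, -, -⟩ := integral_capConv m hm hr hφ hb hsupp
    have iφ : Integrable φ m := (integrable_const Φ).mono' hφ.aestronglyMeasurable (ae_of_all _ hb)
    rw [← integral_const_mul, ← integral_sub i (iφ.const_mul C)]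
    rw [← Real.norm_eq_abs]
    refine (norm_integral_le_of_norm_le (integrable_const (μ := m) (ω * C))
      (ae_of_all _ fun a => ?_)).trans (le_of_eq ?_)
    · exact abs_capConv_sub_le hφ hb hω a
    · simp [mul_comm]
  have k1 := key m₁ inferInstance ϱ₁ hm₁
  have k2 := key m₂ inferInstance ϱ₂ hm₂
  have : C * |∫ a, φ a ∂m₁ - ∫ a, φ a ∂m₂| = |C * ∫ a, φ a ∂m₁ - C * ∫ a, φ a ∂m₂| := by
    rw [← mul_sub, abs_mul, abs_of_pos hCpos]
  rw [this]
  rw [abs_le] at *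
  constructor <;> linarith [k1.1, k1.2, k2.1, k2.2, h.1, h.2]

/-! ### Zero measures of polynomials -/

lemma integrable_sum_dirac (s : Multiset ℂ) (g : ℂ → ℝ) :
    Integrable g (s.map (fun z => Measure.dirac z)).sum ∧
      ∫ z, g z ∂(s.map (fun z => Measure.dirac z)).sum = (s.map g).sum := by
  induction s using Multiset.induction_on with
  | empty => simp
  | cons a s ih =>
    obtain ⟨i, e⟩ := ih
    simp only [Multiset.map_cons, Multiset.sum_cons]
    have ha : Integrable g (Measure.dirac a) := integrable_dirac (by simp)
    exact ⟨ha.add_measure i, by rw [integral_add_measure ha i, e, integral_dirac]⟩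

lemma sum_dirac_univ (s : Multiset ℂ) :
    (s.map (fun z => Measure.dirac z)).sum Set.univ = Multiset.card s := by
  induction s using Multiset.induction_on with
  | empty => simp
  | cons a s ih =>
    simp only [Multiset.map_cons, Multiset.sum_cons, Measure.add_apply, ih, Multiset.card_cons]
    simp [add_comm]

lemma ae_sum_dirac_le (s : Multiset ℂ) :
    ∃ ϱ : ℝ, ∀ᵐ a ∂(s.map (fun z => Measure.dirac z)).sum, ‖a‖ ≤ ϱ := by
  induction s using Multiset.induction_on with
  | empty => exact ⟨0, by simp⟩
  | cons a s ih =>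
    obtain ⟨ϱ, h⟩ := ih
    refine ⟨max ϱ ‖a‖, ?_⟩
    simp only [Multiset.map_cons, Multiset.sum_cons]
    rw [ae_add_measure_iff]
    constructor
    · rw [ae_dirac_iff (measurableSet_le (by fun_prop) (by fun_prop))]
      exact le_max_right _ _
    · filter_upwards [h] with z hz using hz.trans (le_max_left _ _)

lemma integral_zeroMeasure (p : Polynomial ℂ) (g : ℂ → ℝ) (c : ℝ≥0∞) :
    ∫ z, g z ∂(c • zeroMeasure p) = c.toReal * (p.roots.map g).sum := by
  rw [integral_smul_measure, zeroMeasure, (integrable_sum_dirac _ _).2, smul_eq_mul]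

lemma logPotential_zeroMeasure (p : Polynomial ℂ) (c : ℝ≥0∞) (z : ℂ) :
    logPotential (c • zeroMeasure p) z
      = c.toReal * (p.roots.map fun a => Real.log ‖z - a‖).sum :=
  integral_zeroMeasure p _ c

lemma log_norm_eval_eq {p : Polynomial ℂ} {z : ℂ} (hz : p.eval z ≠ 0) :
    Real.log ‖p.eval z‖
      = Real.log ‖p.leadingCoeff‖ + (p.roots.map fun a => Real.log ‖z - a‖).sum := by
  have hp : p ≠ 0 := by rintro rfl; simp at hz
  have hev : p.eval z = p.leadingCoeff * (p.roots.map fun a => z - a).prod := by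
    conv_lhs => rw [(IsAlgClosed.splits p).eq_prod_roots]
    simp [Polynomial.eval_multiset_prod, Multiset.map_map]
  have hne : ∀ a ∈ p.roots, z - a ≠ 0 := by
    intro a ha h0
    rw [Polynomial.mem_roots hp, Polynomial.IsRoot.def, ← sub_eq_zero.1 h0] at ha
    exact hz ha
  have hprod : ∀ s : Multiset ℂ, (∀ a ∈ s, z - a ≠ 0) →
      ‖(s.map fun a => z - a).prod‖ ≠ 0 ∧
      Real.log ‖(s.map fun a => z - a).prod‖ = (s.map fun a => Real.log ‖z - a‖).sum := by
    intro s
    induction s using Multiset.induction_on with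
    | empty => simp
    | cons a s ih =>
      intro h
      have h1 := h a (Multiset.mem_cons_self a s)
      obtain ⟨i1, i2⟩ := ih fun b hb => h b (Multiset.mem_cons_of_mem hb)
      have h1' : ‖z - a‖ ≠ 0 := norm_ne_zero_iff.2 h1
      simp only [Multiset.map_cons, Multiset.prod_cons, Multiset.sum_cons, norm_mul]
      exact ⟨mul_ne_zero h1' i1, by rw [Real.log_mul h1' i1, i2]⟩
  obtain ⟨i1, i2⟩ := hprod _ hne
  rw [hev, norm_mul, Real.log_mul _ i1, i2]
  exact norm_ne_zero_iff.2 (Polynomial.leadingCoeff_ne_zero.2 hp)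

lemma ae_eval_ne_zero {p : Polynomial ℂ} (hp : p ≠ 0) :
    ∀ᵐ z ∂(volume : Measure ℂ), p.eval z ≠ 0 := by
  have : {z : ℂ | ¬ p.eval z ≠ 0} ⊆ (p.roots.toFinset : Set ℂ) := by
    intro z hz
    simp only [ne_eq, not_not, Set.mem_ofPred_eq] at hz
    simp [Polynomial.mem_roots hp, Polynomial.IsRoot.def, hz]
  exact measure_mono_null this (Finset.measure_zero _ _)

lemma sum_log_disc (s : Multiset ℂ) (z₀ : ℂ) (ρ : ℝ) :
    IntegrableOn (fun z => (s.map fun a => Real.log ‖z - a‖).sum) (Metric.ball z₀ ρ) ∧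
    (z₀ ∉ s → volume.real (Metric.ball z₀ ρ) * (s.map fun a => Real.log ‖z₀ - a‖).sum
      ≤ ∫ z in Metric.ball z₀ ρ, (s.map fun a => Real.log ‖z - a‖).sum) := by
  induction s using Multiset.induction_on with
  | empty => simp
  | cons a s ih =>
    obtain ⟨i, h⟩ := ih
    simp only [Multiset.map_cons, Multiset.sum_cons]
    have ha := integrableOn_log_norm_sub z₀ a ρ
    refine ⟨ha.add i, fun hz => ?_⟩
    rw [Multiset.mem_cons, not_or] at hz
    rw [integral_add ha i, mul_add]
    exact add_le_add (log_norm_sub_le_disc_integral hz.1) (h hz.2)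

/-- The sub-mean value inequality summed over the roots. Nonvanishing at z₀ matters: the real
logarithm is 0 at 0 rather than -∞, and the inequality could fail there. -/
lemma log_norm_eval_disc {p : Polynomial ℂ} {z₀ : ℂ} (hz : p.eval z₀ ≠ 0) (w : ℂ) (ρ : ℝ) :
    IntegrableOn (fun z => Real.log ‖p.eval z‖) (Metric.ball w ρ) ∧
    volume.real (Metric.ball z₀ ρ) * Real.log ‖p.eval z₀‖
      ≤ ∫ z in Metric.ball z₀ ρ, Real.log ‖p.eval z‖ := by
  have hp : p ≠ 0 := by rintro rfl; simp at hz
  have hroot : z₀ ∉ p.roots := by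
    rw [Polynomial.mem_roots hp]; exact hz
  have hae : ∀ w : ℂ, (fun z => Real.log ‖p.leadingCoeff‖ +
      (p.roots.map fun a => Real.log ‖z - a‖).sum) =ᵐ[volume.restrict (Metric.ball w ρ)]
      fun z => Real.log ‖p.eval z‖ := by
    intro w
    filter_upwards [ae_restrict_of_ae (ae_eval_ne_zero hp)] with z h using (log_norm_eval_eq h).symm
  have hc : ∀ w : ℂ, IntegrableOn (fun _ : ℂ => Real.log ‖p.leadingCoeff‖) (Metric.ball w ρ) :=
    fun w => integrableOn_const measure_ball_lt_top.ne
  constructor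
  · exact ((hc w).add (sum_log_disc p.roots w ρ).1).congr (hae w)
  · rw [← integral_congr_ae (hae z₀), integral_add (hc z₀) (sum_log_disc p.roots z₀ ρ).1,
      log_norm_eval_eq hz, mul_add, setIntegral_const, smul_eq_mul]
    have := (sum_log_disc p.roots z₀ ρ).2 hroot
    linarith

/-! ### Stability of the zeros under one-sided bounds -/

/-- Centres of the square grid of mesh `ρ`, none of which is the origin. -/
noncomputable def gridPoint (ρ : ℝ) (i : ℤ × ℤ) : ℂ := ⟨ρ * (i.1 + 1 / 2), ρ * (i.2 + 1 / 2)⟩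

/-- Indices of the grid points near the disc of radius `M ρ`. -/
noncomputable def gridIndex (M : ℕ) : Finset (ℤ × ℤ) := Finset.Ico (-M : ℤ) M ×ˢ Finset.Ico (-M : ℤ) M

lemma card_gridIndex (M : ℕ) : (gridIndex M).card = 4 * M ^ 2 := by
  simp only [gridIndex, Finset.card_product, Int.card_Ico]
  have : ((M : ℤ) - -M).toNat = 2 * M := by omega
  rw [this]; ring

/-- The half-integer shift keeps the grid off the origin, where the random polynomial is a single
term and anticoncentration gives nothing. -/
lemma gridPoint_ne_zero {ρ : ℝ} (hρ : 0 < ρ) (i : ℤ × ℤ) : gridPoint ρ i ≠ 0 := by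
  intro h
  have h1 := congrArg Complex.re h
  simp only [gridPoint, Complex.zero_re, mul_eq_zero, hρ.ne', false_or] at h1
  have h2 : (2 * i.1 + 1 : ℝ) = 0 := by linarith
  have h3 : (2 * i.1 + 1 : ℤ) = 0 := by exact_mod_cast h2
  omega

lemma exists_gridPoint {ρ : ℝ} (hρ : 0 < ρ) {M : ℕ} {z : ℂ} (hz : ‖z‖ < ρ * M) :
    ∃ i ∈ gridIndex M, ‖z - gridPoint ρ i‖ < ρ := by
  have hcoord : ∀ x : ℝ, |x| < ρ * M → ⌊x / ρ⌋ ∈ Finset.Ico (-M : ℤ) M ∧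
      |x - ρ * (⌊x / ρ⌋ + 1 / 2)| ≤ ρ / 2 := by
    intro x hx
    rw [abs_lt] at hx
    have h1 := Int.floor_le (x / ρ)
    have h2 := Int.lt_floor_add_one (x / ρ)
    rw [le_div_iff₀ hρ] at h1
    rw [div_lt_iff₀ hρ] at h2
    refine ⟨Finset.mem_Ico.2 ⟨?_, ?_⟩, ?_⟩
    · rw [Int.le_floor, le_div_iff₀ hρ]; push_cast; linarith
    · rw [Int.floor_lt, div_lt_iff₀ hρ]; push_cast; linarith
    · rw [abs_le]; constructor <;> linarith
  obtain ⟨a1, a2⟩ := hcoord z.re ((Complex.abs_re_le_norm z).trans_lt hz)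
  obtain ⟨b1, b2⟩ := hcoord z.im ((Complex.abs_im_le_norm z).trans_lt hz)
  refine ⟨(⌊z.re / ρ⌋, ⌊z.im / ρ⌋), Finset.mk_mem_product a1 b1, ?_⟩
  have h3 := sq_le_sq' (by linarith [(abs_le.1 a2).1]) (abs_le.1 a2).2
  have h4 := sq_le_sq' (by linarith [(abs_le.1 b2).1]) (abs_le.1 b2).2
  have h5 : ‖z - gridPoint ρ (⌊z.re / ρ⌋, ⌊z.im / ρ⌋)‖ ^ 2 < ρ ^ 2 := by
    rw [← Complex.normSq_eq_norm_sq, Complex.normSq_apply]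
    simp only [gridPoint, Complex.sub_re, Complex.sub_im]
    nlinarith [sq_pos_of_pos hρ]
  exact lt_of_pow_lt_pow_left₀ 2 hρ.le h5

lemma norm_gridPoint_add_le {ρ : ℝ} (hρ : 0 < ρ) {M : ℕ} {i : ℤ × ℤ} (hi : i ∈ gridIndex M) :
    ‖gridPoint ρ i‖ + ρ ≤ 3 * (ρ * M) := by
  have hcoord : ∀ j ∈ Finset.Ico (-M : ℤ) M, |ρ * ((j : ℝ) + 1 / 2)| ≤ ρ * (M - 1 / 2) := by
    intro j hj
    rw [Finset.mem_Ico] at hj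
    have h1 : (-M : ℝ) ≤ j := by exact_mod_cast hj.1
    have h2 : (j : ℝ) + 1 ≤ M := by exact_mod_cast hj.2
    rw [abs_mul, abs_of_pos hρ]
    refine mul_le_mul_of_nonneg_left ?_ hρ.le
    rw [abs_le]; constructor <;> linarith
  obtain ⟨h1, h2⟩ := Finset.mem_product.1 hi
  have := Complex.norm_le_abs_re_add_abs_im (gridPoint ρ i)
  have h3 := hcoord _ h1
  have h4 := hcoord _ h2
  have hM : (1 : ℝ) ≤ M := by
    have := Finset.mem_Ico.1 h1
    exact_mod_cast (by omega : 1 ≤ M)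
  simp only [gridPoint] at this ⊢
  nlinarith

lemma volume_real_ball (z : ℂ) {ρ : ℝ} (hρ : 0 ≤ ρ) :
    volume.real (Metric.ball z ρ) = Real.pi * ρ ^ 2 := by
  rw [measureReal_def, Complex.volume_ball, ENNReal.toReal_mul, ENNReal.toReal_pow,
    ENNReal.toReal_ofReal hρ, mul_comm]
  rfl

/-- A polynomial whose scaled logarithm is bounded above by `V + δ` on a disc and below by `V - δ`
at finitely many grid points has scaled logarithm close to `V` in `L¹`. -/
lemma integral_abs_log_sub_le {V : ℂ → ℝ} (hV : Continuous V) {ρ δ c : ℝ} (hρ : 0 < ρ)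
    (hδ : 0 < δ) (hc : 0 < c) {M : ℕ} (hM : 0 < M)
    (hω : ∀ z w, ‖w‖ < 3 * (ρ * M) → ‖z‖ < 3 * (ρ * M) → ‖z - w‖ < ρ → |V z - V w| ≤ δ)
    {p : Polynomial ℂ}
    (hup : ∀ z, ‖z‖ < 3 * (ρ * M) → ‖p.eval z‖ ≤ Real.exp ((V z + δ) / c))
    (hlow : ∀ i ∈ gridIndex M,
      Real.exp ((V (gridPoint ρ i) - δ) / c) ≤ ‖p.eval (gridPoint ρ i)‖) :
    p ≠ 0 ∧ ∫ z in Metric.ball (0 : ℂ) (ρ * M), |c * Real.log ‖p.eval z‖ - V z|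
      ≤ 13 * Real.pi * (ρ * M) ^ 2 * δ := by
  set R := ρ * M with hR
  have hM' : (0 : ℝ) < M := by exact_mod_cast hM
  have hR0 : 0 < R := mul_pos hρ hM'
  have hne : ∀ i ∈ gridIndex M, p.eval (gridPoint ρ i) ≠ 0 := fun i hi =>
    norm_pos_iff.1 ((Real.exp_pos _).trans_le (hlow i hi))
  have h00 : ((0, 0) : ℤ × ℤ) ∈ gridIndex M := by
    simp only [gridIndex, Finset.mem_product, Finset.mem_Ico]; omega
  have hp : p ≠ 0 := by
    rintro rfl; exact hne _ h00 (by simp)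
  refine ⟨hp, ?_⟩
  set L : ℂ → ℝ := fun z => Real.log ‖p.eval z‖ with hL
  have hLi : ∀ w ρ, IntegrableOn L (Metric.ball w ρ) := fun w ρ =>
    (log_norm_eval_disc (hne _ h00) w ρ).1
  have hVi : ∀ w ρ, IntegrableOn V (Metric.ball w ρ) := fun w ρ =>
    (hV.continuousOn.integrableOn_compact (isCompact_closedBall w ρ)).mono_set
      Metric.ball_subset_closedBall
  have hconst : ∀ (w : ℂ) (ρ δ : ℝ), IntegrableOn (fun _ => δ) (Metric.ball w ρ) := fun w ρ δ =>
    integrableOn_const measure_ball_lt_top.ne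
  -- The gap in the upper bound, nonnegative away from the zeros. Around each grid point the
  -- sub-mean value property and the lower bound at the centre limit its mean to 3δ: one δ from the
  -- upper bound, one from the oscillation of V, one from the lower bound.
  set D : ℂ → ℝ := fun z => V z + δ - c * L z with hD
  have hDi : ∀ w ρ, IntegrableOn D (Metric.ball w ρ) := fun w ρ =>
    ((hVi w ρ).add (hconst w ρ δ)).sub ((hLi w ρ).const_mul c)
  have hD0 : ∀ z, ‖z‖ < 3 * R → p.eval z ≠ 0 → 0 ≤ D z := by
    intro z hz hpz
    have := Real.log_le_log (norm_pos_iff.2 hpz) (hup z hz)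
    rw [Real.log_exp, le_div_iff₀ hc] at this
    simp only [hD, hL]; linarith
  have hball : ∀ i ∈ gridIndex M, ∀ z ∈ Metric.ball (gridPoint ρ i) ρ, ‖z‖ < 3 * R := by
    intro i hi z hz
    rw [Metric.mem_ball, dist_eq_norm] at hz
    have := norm_gridPoint_add_le hρ hi
    have h2 := norm_sub_norm_le z (gridPoint ρ i)
    linarith
  have hDball : ∀ i ∈ gridIndex M,
      ∫ z in Metric.ball (gridPoint ρ i) ρ, D z ≤ Real.pi * ρ ^ 2 * (3 * δ) := by
    intro i hi
    set z₀ := gridPoint ρ i with hz₀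
    have hself : ‖z₀‖ < 3 * R := hball i hi z₀ (Metric.mem_ball_self hρ)
    have e1 : ∫ z in Metric.ball z₀ ρ, D z = (∫ z in Metric.ball z₀ ρ, (V z + δ))
        - c * ∫ z in Metric.ball z₀ ρ, L z := by
      rw [← integral_const_mul]
      exact integral_sub ((hVi z₀ ρ).add (hconst z₀ ρ δ)) ((hLi z₀ ρ).const_mul c)
    have e2 : ∫ z in Metric.ball z₀ ρ, (V z + δ) ≤ Real.pi * ρ ^ 2 * (V z₀ + 2 * δ) := by
      calc _ ≤ ∫ z in Metric.ball z₀ ρ, (V z₀ + 2 * δ) := by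
            refine setIntegral_mono_on ((hVi z₀ ρ).add (hconst z₀ ρ δ)) (hconst z₀ ρ _)
              measurableSet_ball fun z hz => ?_
            have h1 := hball i hi z hz
            rw [Metric.mem_ball, dist_eq_norm] at hz
            have := (abs_le.1 (hω z z₀ hself h1 hz)).2
            linarith
        _ = _ := by rw [setIntegral_const, volume_real_ball _ hρ.le, smul_eq_mul]
    have e3 := (log_norm_eval_disc (hne i hi) z₀ ρ).2
    rw [volume_real_ball _ hρ.le] at e3
    have e4 : V z₀ - δ ≤ c * L z₀ := by
      have := Real.log_le_log (Real.exp_pos _) (hlow i hi)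
      rw [Real.log_exp, div_le_iff₀ hc] at this
      simp only [hL]; linarith
    have hvol : 0 < Real.pi * ρ ^ 2 := by positivity
    rw [e1]
    have e5 := mul_le_mul_of_nonneg_left e3 hc.le
    have e6 := mul_le_mul_of_nonneg_left e4 hvol.le
    nlinarith
  have hcover : ∫ z in Metric.ball (0 : ℂ) R, D z
      ≤ ∑ i ∈ gridIndex M, ∫ z in Metric.ball (gridPoint ρ i) ρ, D z := by
    simp only [← integral_indicator (measurableSet_ball (x := _) (ε := _))]
    rw [← integral_finsetSum _ fun i _ => (hDi _ _).integrable_indicator measurableSet_ball]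
    refine integral_mono_ae ((hDi _ _).integrable_indicator measurableSet_ball)
      (integrable_finsetSum _ fun i _ => (hDi _ _).integrable_indicator measurableSet_ball) ?_
    filter_upwards [ae_eval_ne_zero hp] with z hz
    have hnn : ∀ i ∈ gridIndex M, 0 ≤ (Metric.ball (gridPoint ρ i) ρ).indicator D z := by
      intro i hi
      refine Set.indicator_apply_nonneg fun h => hD0 z (hball i hi z h) hz
    by_cases hzR : z ∈ Metric.ball (0 : ℂ) R
    · rw [Set.indicator_of_mem hzR]
      rw [Metric.mem_ball, dist_zero_right] at hzR
      obtain ⟨i, hi, hzi⟩ := exists_gridPoint hρ hzR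
      have : D z = (Metric.ball (gridPoint ρ i) ρ).indicator D z := by
        rw [Set.indicator_of_mem]
        rwa [Metric.mem_ball, dist_eq_norm]
      rw [this]
      exact Finset.single_le_sum (f := fun i => (Metric.ball (gridPoint ρ i) ρ).indicator D z)
        hnn hi
    · rw [Set.indicator_of_notMem hzR]
      exact Finset.sum_nonneg hnn
  have hsum : ∑ i ∈ gridIndex M, ∫ z in Metric.ball (gridPoint ρ i) ρ, D z
      ≤ 12 * Real.pi * R ^ 2 * δ := by
    refine (Finset.sum_le_sum hDball).trans (le_of_eq ?_)
    rw [Finset.sum_const, card_gridIndex, nsmul_eq_mul, hR]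
    push_cast; ring
  -- The covering by 4M² discs of area πρ² yields 12πR²δ for the gap. Since |c L - V| = |δ - D| ≤ D
  -- + δ, a further πR²δ makes the constant 13.
  calc ∫ z in Metric.ball (0 : ℂ) R, |c * L z - V z|
      ≤ ∫ z in Metric.ball (0 : ℂ) R, (D z + δ) := by
        refine integral_mono_ae (((hLi 0 R).const_mul c).sub (hVi 0 R)).abs
          ((hDi 0 R).add (hconst 0 R δ)) ?_
        filter_upwards [ae_restrict_mem measurableSet_ball,
          ae_restrict_of_ae (ae_eval_ne_zero hp)] with z hzR hz
        rw [Metric.mem_ball, dist_zero_right] at hzR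
        have h0 := hD0 z (by linarith) hz
        simp only [hD] at h0 ⊢
        rw [abs_le]; constructor <;> linarith
    _ = (∫ z in Metric.ball (0 : ℂ) R, D z) + Real.pi * R ^ 2 * δ := by
        rw [integral_add (hDi 0 R) (hconst 0 R δ), setIntegral_const, volume_real_ball _ hR0.le,
          smul_eq_mul]
    _ ≤ _ := by linarith [hcover.trans hsum]

/-- If `V` is a continuous potential of a compactly supported measure `μ` up to a constant, then a
polynomial whose scaled logarithm is at most `V + δ` on a large disc and at least `V - δ` at
finitely many points has its scaled zero measure vaguely close to `μ`. -/
theorem exists_vague_stability (μ : Measure ℂ) [IsFiniteMeasure μ] {ϱ : ℝ}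
    (hμ : ∀ᵐ a ∂μ, ‖a‖ ≤ ϱ) {V : ℂ → ℝ} (hV : Continuous V) {b₀ : ℝ}
    (hVμ : ∀ z, V z = logPotential μ z - b₀) {K : ℝ} {φ : ℂ → ℝ} (hφ : Continuous φ)
    (hφc : HasCompactSupport φ) {ε : ℝ} (hε : 0 < ε) :
    ∃ (Z : Finset ℂ) (R δ : ℝ), 0 ∉ Z ∧ 0 < δ ∧ ∀ (n : ℕ) (p : Polynomial ℂ), 0 < n →
      (p.natDegree : ℝ) ≤ K * n →
      (∀ z, ‖z‖ < R → ‖p.eval z‖ ≤ Real.exp (n * (V z + δ))) →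
      (∀ z ∈ Z, Real.exp (n * (V z - δ)) ≤ ‖p.eval z‖) →
      |∫ z, φ z ∂((n : ℝ≥0∞)⁻¹ • zeroMeasure p) - ∫ z, φ z ∂μ| ≤ ε := by
  obtain ⟨R₀, hR₀⟩ : ∃ R₀ : ℝ, ∀ z, R₀ ≤ ‖z‖ → φ z = 0 := by
    obtain ⟨R₀, h⟩ := hφc.isCompact.isBounded.subset_ball (0 : ℂ)
    refine ⟨R₀, fun z hz => ?_⟩
    by_contra hne
    have := h (subset_tsupport _ hne)
    rw [Metric.mem_ball, dist_zero_right] at this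
    linarith
  obtain ⟨Φ, hΦ⟩ : ∃ Φ, ∀ z, |φ z| ≤ Φ := by
    obtain ⟨Φ, h⟩ := hφc.exists_bound_of_continuous hφ
    exact ⟨Φ, h⟩
  have hΦ0 : 0 ≤ Φ := (abs_nonneg _).trans (hΦ 0)
  have hmass : 0 ≤ |K| + μ.real Set.univ := add_nonneg (abs_nonneg _) measureReal_nonneg
  set ω := ε / (2 * (|K| + μ.real Set.univ + 1)) with hω
  have hω0 : 0 < ω := by positivity
  obtain ⟨r, hr, hφr⟩ : ∃ r > 0, ∀ z w, ‖z - w‖ < r → |φ z - φ w| ≤ ω := by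
    obtain ⟨r, hr, h⟩ := Metric.uniformContinuous_iff.1
      (hφc.uniformContinuous_of_continuous hφ) ω hω0
    refine ⟨r, hr, fun z w hzw => ?_⟩
    have := h (a := z) (b := w) (by rwa [dist_eq_norm])
    rw [Real.dist_eq] at this
    exact this.le
  set C := ∫ x, capKernel r x with hC
  have hC0 : 0 < C := integral_capKernel_pos hr
  set R := max R₀ 0 + r with hR
  have hRpos : 0 < R := by positivity
  -- Chosen so that 2Φ · 13πR²δ ≤ Cε/2. The other half of Cε pays for the oscillation ω against the
  -- total masses. Using Φ + 1 avoids division by zero.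
  set δ := C * ε / (2 * (26 * Real.pi * R ^ 2 * (Φ + 1))) with hδ
  have hδ0 : 0 < δ := by
    have := Real.pi_pos
    positivity
  obtain ⟨ρ₀, hρ₀, hVρ⟩ : ∃ ρ₀ > 0, ∀ z w, ‖w‖ < 3 * R → ‖z‖ < 3 * R → ‖z - w‖ < ρ₀ →
      |V z - V w| ≤ δ := by
    have hu := (isCompact_closedBall (0 : ℂ) (3 * R)).uniformContinuousOn_of_continuous
      hV.continuousOn
    obtain ⟨ρ₀, h0, h⟩ := Metric.uniformContinuousOn_iff.1 hu δ hδ0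
    refine ⟨ρ₀, h0, fun z w hw hz hzw => ?_⟩
    have := h z (by simpa using hz.le) w (by simpa using hw.le) (by rwa [dist_eq_norm])
    rw [Real.dist_eq] at this
    exact this.le
  obtain ⟨M, hM⟩ := exists_nat_gt (R / ρ₀)
  have hM0 : 0 < M := by
    have : (0 : ℝ) < M := lt_of_le_of_lt (by positivity) hM
    exact_mod_cast this
  have hM0' : (0 : ℝ) < M := by exact_mod_cast hM0
  set ρ := R / M with hρ
  have hρ0 : 0 < ρ := by positivity
  have hρM : ρ * M = R := by rw [hρ]; field_simp
  have hρle : ρ ≤ ρ₀ := by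
    rw [div_lt_iff₀ hρ₀] at hM
    rw [hρ, div_le_iff₀ hM0']; linarith
  refine ⟨(gridIndex M).image (gridPoint ρ), 3 * R, δ, ?_, hδ0, ?_⟩
  · rw [Finset.mem_image]
    rintro ⟨i, -, hi⟩
    exact gridPoint_ne_zero hρ0 i hi
  intro n p hn hdeg hup hlow
  have hn' : (0 : ℝ) < n := by exact_mod_cast hn
  have hcn : ∀ x : ℝ, x / (n : ℝ)⁻¹ = n * x := fun x => by rw [div_inv_eq_mul, mul_comm]
  obtain ⟨hp, hint⟩ := integral_abs_log_sub_le (c := (n : ℝ)⁻¹) hV hρ0 hδ0 (by positivity) hM0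
    (by rw [hρM]; exact fun z w h1 h2 h3 => hVρ z w h1 h2 (h3.trans_le hρle)) (p := p)
    (by rw [hρM]; intro z hz; rw [hcn]; exact hup z hz)
    (by intro i hi; rw [hcn]; exact hlow _ (Finset.mem_image_of_mem _ hi))
  rw [hρM] at hint
  set m := (n : ℝ≥0∞)⁻¹ • zeroMeasure p with hm
  have hninv : ((n : ℝ≥0∞)⁻¹).toReal = (n : ℝ)⁻¹ := by simp
  have hninv_top : (n : ℝ≥0∞)⁻¹ ≠ ∞ := by simp [hn.ne']
  have hzu : zeroMeasure p Set.univ = Multiset.card p.roots := sum_dirac_univ _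
  have hmfin : IsFiniteMeasure m := ⟨by
    rw [hm, Measure.smul_apply, hzu, smul_eq_mul]
    exact ENNReal.mul_lt_top hninv_top.lt_top (by simp)⟩
  have hmK : m.real Set.univ ≤ |K| := by
    rw [measureReal_def, hm, Measure.smul_apply, hzu, smul_eq_mul, ENNReal.toReal_mul, hninv]
    simp only [ENNReal.toReal_natCast]
    rw [inv_mul_le_iff₀ hn']
    have h1 : (Multiset.card p.roots : ℝ) ≤ p.natDegree := by
      exact_mod_cast Polynomial.card_roots' p
    nlinarith [le_abs_self K]
  obtain ⟨ϱ₁, hϱ₁⟩ := ae_sum_dirac_le p.roots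
  have hmae : ∀ᵐ a ∂m, ‖a‖ ≤ ϱ₁ := Measure.ae_smul_measure hϱ₁ _
  -- The free constant b absorbs the unknown leading coefficient of p and the normalisation b₀ of V.
  have hmain := integral_sub_le_of_potential m μ hmae hμ (R := max R₀ 0)
    (b := (n : ℝ)⁻¹ * Real.log ‖p.leadingCoeff‖ + b₀) hr hφ hΦ
    (fun z hz => hR₀ z ((le_max_left _ _).trans hz)) hφr
  have hpot : ∫ z in Metric.ball (0 : ℂ) (max R₀ 0 + r), |logPotential m z - logPotential μ z +
      ((n : ℝ)⁻¹ * Real.log ‖p.leadingCoeff‖ + b₀)| ≤ 13 * Real.pi * R ^ 2 * δ := by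
    refine le_trans (le_of_eq ?_) hint
    refine integral_congr_ae ?_
    filter_upwards [ae_restrict_of_ae (ae_eval_ne_zero hp)] with z hz
    rw [log_norm_eval_eq hz, hm, logPotential_zeroMeasure, hninv, hVμ]
    congr 1; ring
  have hδval : 2 * Φ * (13 * Real.pi * R ^ 2 * δ) ≤ C * (ε / 2) := by
    have hpos : 0 < 26 * Real.pi * R ^ 2 * (Φ + 1) := by
      have := Real.pi_pos
      positivity
    have e : 26 * Real.pi * R ^ 2 * (Φ + 1) * δ = C * (ε / 2) := by
      rw [hδ]; field_simp
    have : 0 ≤ Real.pi * R ^ 2 * δ := by have := Real.pi_pos; positivity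
    nlinarith
  have hωval : ω * (m.real Set.univ + μ.real Set.univ) ≤ ε / 2 := by
    have e : ω * (|K| + μ.real Set.univ + 1) = ε / 2 := by
      rw [hω]; field_simp
    nlinarith
  have hfin : C * |∫ z, φ z ∂m - ∫ z, φ z ∂μ| ≤ C * ε := by
    refine hmain.trans ?_
    have h1 := mul_le_mul_of_nonneg_left hpot (by positivity : 0 ≤ 2 * Φ)
    have h2 := mul_le_mul_of_nonneg_left hωval hC0.le
    nlinarith
  exact le_of_mul_le_mul_left hfin hC0

/-! ### Convex profiles and the radial limit measure -/

/-- The right derivative. -/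
noncomputable def rightSlope (v : ℝ → ℝ) (t : ℝ) : ℝ := derivWithin v (Set.Ioi t) t

lemma measurable_rightSlope (v : ℝ → ℝ) : Measurable (rightSlope v) :=
  measurable_derivWithin_Ioi v

/-- The right derivative is a subgradient inside the interval. The endpoint s = 0 follows by
continuity. -/
lemma tangent_le {v : ℝ → ℝ} {b : ℝ} (hv : ConvexOn ℝ (Set.Ioo 0 b) v)
    (hc : ContinuousOn v (Set.Ico 0 b)) {t s : ℝ} (ht : t ∈ Set.Ioo 0 b) (hs : s ∈ Set.Ico 0 b) :
    v t + rightSlope v t * (s - t) ≤ v s := by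
  have hint : ∀ t ∈ Set.Ioo 0 b, t ∈ interior (Set.Ioo 0 b) := fun t ht => by
    rwa [interior_Ioo]
  have key : ∀ s ∈ Set.Ioo 0 b, v t + rightSlope v t * (s - t) ≤ v s := by
    intro s hs
    rcases lt_trichotomy s t with h | h | h
    · have h1 := hv.slope_le_leftDeriv_of_mem_interior hs (hint t ht) h
      have h2 := hv.leftDeriv_le_rightDeriv_of_mem_interior (hint t ht)
      have h3 : slope v s t ≤ rightSlope v t := h1.trans h2
      rw [slope_def_field, div_le_iff₀ (by linarith)] at h3
      linarith
    · rw [h]; simp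
    · have h3 : rightSlope v t ≤ slope v t s := hv.rightDeriv_le_slope_of_mem_interior (hint t ht) hs h
      rw [slope_def_field, le_div_iff₀ (by linarith)] at h3
      linarith
  have hb : 0 < b := ht.1.trans ht.2
  have hcl : s ∈ closure (Set.Ioo 0 b) := by
    rw [closure_Ioo hb.ne]; exact ⟨hs.1, hs.2.le⟩
  have : (𝓝[Set.Ioo 0 b] s).NeBot := mem_closure_iff_nhdsWithin_neBot.1 hcl
  have h1 : Tendsto v (𝓝[Set.Ioo 0 b] s) (𝓝 (v s)) :=
    (hc s hs).mono_left (nhdsWithin_mono _ Set.Ioo_subset_Ico_self)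
  have h2 : Tendsto (fun s => v t + rightSlope v t * (s - t)) (𝓝[Set.Ioo 0 b] s)
      (𝓝 (v t + rightSlope v t * (s - t))) :=
    (Continuous.tendsto (by fun_prop) s).mono_left nhdsWithin_le_nhds
  exact le_of_tendsto_of_tendsto h2 h1 (eventually_mem_nhdsWithin.mono key)

/-- The data of a convex function on `(0, b)`, continuous on `[0, b)`, and of `κ ∈ (0, b)`. -/
structure ConvexProfile (v : ℝ → ℝ) (κ b : ℝ) : Prop where
  convex : ConvexOn ℝ (Set.Ioo 0 b) v
  cont : ContinuousOn v (Set.Ico 0 b)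
  pos : 0 < κ
  lt : κ < b

namespace ConvexProfile

variable {v : ℝ → ℝ} {κ b : ℝ}

lemma monotoneOn (h : ConvexProfile v κ b) : MonotoneOn (rightSlope v) (Set.Ioo 0 b) := by
  have := h.convex.monotoneOn_rightDeriv
  rwa [interior_Ioo] at this

lemma slope_le (h : ConvexProfile v κ b) {t : ℝ} (ht : t ∈ Set.Ioc 0 κ) :
    rightSlope v t ≤ rightSlope v κ :=
  h.monotoneOn ⟨ht.1, ht.2.trans_lt h.lt⟩ ⟨h.pos, h.lt⟩ ht.2

/-- The slope may tend to -∞ at 0. Subtracting v from a linear function of slope v'(κ) gives a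
continuous function with nonnegative right derivative, and such a derivative is integrable. -/
lemma integrableOn (h : ConvexProfile v κ b) : IntegrableOn (rightSlope v) (Set.Ioc 0 κ) := by
  have hd : ∀ t ∈ Set.Ioo 0 κ, HasDerivWithinAt (fun t => rightSlope v κ * t - v t)
      (rightSlope v κ - rightSlope v t) (Set.Ioi t) t := by
    intro t ht
    have h1 := h.convex.hasDerivWithinAt_rightDeriv_of_mem_interior (x := t) (by
      rw [interior_Ioo]; exact ⟨ht.1, ht.2.trans h.lt⟩)
    have h2 : HasDerivWithinAt (fun t => rightSlope v κ * t) (rightSlope v κ) (Set.Ioi t) t := by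
      simpa using ((hasDerivAt_id t).const_mul (rightSlope v κ)).hasDerivWithinAt
    exact h2.sub h1
  have hcont : ContinuousOn (fun t => rightSlope v κ * t - v t) (Set.Icc 0 κ) :=
    (by fun_prop : Continuous fun t => rightSlope v κ * t).continuousOn.sub
      (h.cont.mono fun t ht => ⟨ht.1, ht.2.trans_lt h.lt⟩)
  have := intervalIntegral.integrableOn_deriv_right_of_nonneg hcont hd
    (fun t ht => sub_nonneg.2 (h.slope_le ⟨ht.1, ht.2.le⟩))
  have hcst : IntegrableOn (fun _ : ℝ => rightSlope v κ) (Set.Ioc 0 κ) :=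
    integrableOn_const measure_Ioc_lt_top.ne
  refine (hcst.sub this).congr (ae_of_all _ fun t => ?_)
  simp

lemma integrable_sub (h : ConvexProfile v κ b) {s t : ℝ} (hs : 0 ≤ s) (ht : t ≤ κ) :
    IntegrableOn (rightSlope v) (Set.Ioc s t) :=
  h.integrableOn.mono_set (Set.Ioc_subset_Ioc hs ht)

lemma integral_eq (h : ConvexProfile v κ b) {s t : ℝ} (hs : 0 ≤ s) (hst : s ≤ t) (ht : t ≤ κ) :
    ∫ x in Set.Ioc s t, rightSlope v x = v t - v s := by
  rw [← intervalIntegral.integral_of_le hst]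
  refine intervalIntegral.integral_eq_sub_of_hasDeriv_right_of_le hst ?_ ?_ ?_
  · exact h.cont.mono fun x hx => ⟨hs.trans hx.1, (hx.2.trans ht).trans_lt h.lt⟩
  · intro x hx
    exact h.convex.hasDerivWithinAt_rightDeriv_of_mem_interior (x := x) (by
      rw [interior_Ioo]; exact ⟨hs.trans_lt hx.1, (hx.2.trans_le ht).trans h.lt⟩)
  · exact (intervalIntegrable_iff_integrableOn_Ioc_of_le hst).2 (h.integrable_sub hs ht)

end ConvexProfile

/-- The limiting potential, normalised so that it equals `sup_{0 ≤ t ≤ κ} (t log ‖z‖ - v t)`. -/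
noncomputable def radialPotential (v : ℝ → ℝ) (κ : ℝ) (z : ℂ) : ℝ :=
  (∫ t in Set.Ioc 0 κ, Real.log (max (Real.exp (rightSlope v t)) ‖z‖)) - v κ

namespace ConvexProfile

variable {v : ℝ → ℝ} {κ b : ℝ}

lemma log_max_bounds (g : ℝ) (z : ℂ) : g ≤ Real.log (max (Real.exp g) ‖z‖) ∧
    |Real.log (max (Real.exp g) ‖z‖)| ≤ |g| + Real.posLog ‖z‖ := by
  have h1 : g ≤ Real.log (max (Real.exp g) ‖z‖) := by
    conv_lhs => rw [← Real.log_exp g]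
    exact Real.log_le_log (Real.exp_pos _) (le_max_left _ _)
  refine ⟨h1, ?_⟩
  have h0 : 0 ≤ Real.posLog ‖z‖ := Real.posLog_nonneg
  rw [abs_le]
  constructor
  · linarith [neg_abs_le g]
  · rcases max_choice (Real.exp g) ‖z‖ with h | h <;> rw [h]
    · rw [Real.log_exp]; linarith [le_abs_self g]
    · have : Real.log ‖z‖ ≤ Real.posLog ‖z‖ := le_max_right _ _
      linarith [abs_nonneg g]

lemma integrableOn_log_max (h : ConvexProfile v κ b) (z : ℂ) :
    IntegrableOn (fun t => Real.log (max (Real.exp (rightSlope v t)) ‖z‖)) (Set.Ioc 0 κ) := by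
  refine (h.integrableOn.abs.add (integrableOn_const (C := Real.posLog ‖z‖)
    measure_Ioc_lt_top.ne)).mono' ?_ (ae_of_all _ fun t => (log_max_bounds _ z).2)
  have := measurable_rightSlope v
  exact Measurable.aestronglyMeasurable (by fun_prop)

lemma continuous_radialPotential (h : ConvexProfile v κ b) : Continuous (radialPotential v κ) := by
  refine Continuous.sub ?_ continuous_const
  refine continuous_iff_continuousAt.2 fun z₀ => ?_
  have := measurable_rightSlope v
  refine continuousAt_of_dominated
    (bound := fun t => |rightSlope v t| + Real.posLog (‖z₀‖ + 1)) ?_ ?_ ?_ ?_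
  · exact Eventually.of_forall fun z => Measurable.aestronglyMeasurable (by fun_prop)
  · filter_upwards [Metric.ball_mem_nhds z₀ one_pos] with z hz
    refine ae_of_all _ fun t => (log_max_bounds _ z).2.trans ?_
    rw [Metric.mem_ball, dist_eq_norm] at hz
    have h1 := norm_sub_norm_le z z₀
    have := Real.posLog_le_posLog (norm_nonneg z) (by linarith : ‖z‖ ≤ ‖z₀‖ + 1)
    linarith
  · exact h.integrableOn.abs.add (integrableOn_const measure_Ioc_lt_top.ne)
  · refine ae_of_all _ fun t => ContinuousAt.log (Continuous.continuousAt (by fun_prop)) ?_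
    exact (lt_max_of_lt_left (Real.exp_pos _)).ne'

lemma split_integral (h : ConvexProfile v κ b) (z : ℂ) {t : ℝ} (ht : t ∈ Set.Icc 0 κ) :
    ∫ s in Set.Ioc 0 κ, Real.log (max (Real.exp (rightSlope v s)) ‖z‖)
      = (∫ s in Set.Ioc 0 t, Real.log (max (Real.exp (rightSlope v s)) ‖z‖))
        + ∫ s in Set.Ioc t κ, Real.log (max (Real.exp (rightSlope v s)) ‖z‖) := by
  rw [← Set.Ioc_union_Ioc_eq_Ioc ht.1 ht.2]
  exact setIntegral_union (Set.Ioc_disjoint_Ioc_of_le le_rfl) measurableSet_Ioc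
    ((h.integrableOn_log_max z).mono_set (Set.Ioc_subset_Ioc_right ht.2))
    ((h.integrableOn_log_max z).mono_set (Set.Ioc_subset_Ioc_left ht.1))

lemma tail_le (h : ConvexProfile v κ b) (z : ℂ) {t : ℝ} (ht : t ∈ Set.Icc 0 κ) :
    v κ - v t ≤ ∫ s in Set.Ioc t κ, Real.log (max (Real.exp (rightSlope v s)) ‖z‖) := by
  rw [← h.integral_eq ht.1 ht.2 le_rfl]
  exact integral_mono (h.integrable_sub ht.1 le_rfl)
    ((h.integrableOn_log_max z).mono_set (Set.Ioc_subset_Ioc_left ht.1))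
    fun s => (log_max_bounds _ z).1

lemma neg_le_radialPotential (h : ConvexProfile v κ b) (z : ℂ) : -v 0 ≤ radialPotential v κ z := by
  have := h.tail_le z (t := 0) ⟨le_rfl, h.pos.le⟩
  rw [radialPotential]; linarith

/-- Split the integral at t. Bound the logarithm of the maximum below by log‖z‖ on the left and by
the slope on the right, where the slope integrates to v(κ) - v(t). -/
lemma le_radialPotential (h : ConvexProfile v κ b) {z : ℂ} (hz : z ≠ 0) {t : ℝ}
    (ht : t ∈ Set.Icc 0 κ) : t * Real.log ‖z‖ - v t ≤ radialPotential v κ z := by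
  have h1 := h.tail_le z ht
  have h2 : t * Real.log ‖z‖
      ≤ ∫ s in Set.Ioc 0 t, Real.log (max (Real.exp (rightSlope v s)) ‖z‖) := by
    calc t * Real.log ‖z‖ = ∫ s in Set.Ioc 0 t, Real.log ‖z‖ := by
          rw [setIntegral_const, Real.volume_real_Ioc_of_le ht.1]; simp
      _ ≤ _ := integral_mono (integrableOn_const measure_Ioc_lt_top.ne)
          ((h.integrableOn_log_max z).mono_set (Set.Ioc_subset_Ioc_right ht.2))
          fun s => Real.log_le_log (norm_pos_iff.2 hz) (le_max_right _ _)
  rw [radialPotential, h.split_integral z ht]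
  linarith

lemma radialPotential_zero (h : ConvexProfile v κ b) : radialPotential v κ 0 = -v 0 := by
  have : ∀ t, Real.log (max (Real.exp (rightSlope v t)) ‖(0 : ℂ)‖) = rightSlope v t := fun t => by
    rw [norm_zero, max_eq_left (Real.exp_pos _).le, Real.log_exp]
  rw [radialPotential]
  simp only [this]
  rw [h.integral_eq le_rfl h.pos.le le_rfl]; ring

/-- At a maximiser t of t log‖z‖ - v(t), convexity makes the slope at most log‖z‖ before t and at
least log‖z‖ after t. Both estimates in `le_radialPotential` are then equalities. -/
lemma exists_radialPotential_eq (h : ConvexProfile v κ b) {z : ℂ} (hz : z ≠ 0) :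
    ∃ t ∈ Set.Icc 0 κ, radialPotential v κ z = t * Real.log ‖z‖ - v t := by
  set x := Real.log ‖z‖ with hx
  have hz' : 0 < ‖z‖ := norm_pos_iff.2 hz
  have hcont : ContinuousOn (fun t => t * x - v t) (Set.Icc 0 κ) :=
    (by fun_prop : Continuous fun t => t * x).continuousOn.sub
      (h.cont.mono fun t ht => ⟨ht.1, ht.2.trans_lt h.lt⟩)
  obtain ⟨t, ht, hmax⟩ := isCompact_Icc.exists_isMaxOn ⟨0, ⟨le_rfl, h.pos.le⟩⟩ hcont
  have hmax' : ∀ s ∈ Set.Icc 0 κ, s * x - v s ≤ t * x - v t := fun s hs => hmax hs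
  have htb : t ∈ Set.Ico 0 b := ⟨ht.1, ht.2.trans_lt h.lt⟩
  refine ⟨t, ht, ?_⟩
  have e1 : ∫ s in Set.Ioc 0 t, Real.log (max (Real.exp (rightSlope v s)) ‖z‖) = t * x := by
    -- The point s = t is dropped because the tangent comparison is divided by t - s.
    rw [integral_Ioc_eq_integral_Ioo]
    calc _ = ∫ s in Set.Ioo 0 t, x := by
          refine setIntegral_congr_fun measurableSet_Ioo fun s hs => ?_
          have h1 := tangent_le h.convex h.cont (t := s) (s := t)
            ⟨hs.1, hs.2.trans htb.2⟩ htb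
          have h2 := hmax' s ⟨hs.1.le, hs.2.le.trans ht.2⟩
          have h3 : rightSlope v s * (t - s) ≤ x * (t - s) := by linarith
          have h4 := le_of_mul_le_mul_right h3 (sub_pos.2 hs.2)
          have h5 : Real.exp (rightSlope v s) ≤ ‖z‖ := by
            rwa [← Real.le_log_iff_exp_le hz']
          simp only [max_eq_right h5]; rfl
      _ = _ := by
          rw [setIntegral_const, Real.volume_real_Ioo_of_le ht.1]; simp
  have e2 : ∫ s in Set.Ioc t κ, Real.log (max (Real.exp (rightSlope v s)) ‖z‖) = v κ - v t := by
    rw [← h.integral_eq ht.1 ht.2 le_rfl]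
    refine setIntegral_congr_fun measurableSet_Ioc fun s hs => ?_
    have hs0 : 0 < s := ht.1.trans_lt hs.1
    have h1 := tangent_le h.convex h.cont (t := s) (s := t) ⟨hs0, hs.2.trans_lt h.lt⟩ htb
    have h2 := hmax' s ⟨hs0.le, hs.2⟩
    have h3 : x * (s - t) ≤ rightSlope v s * (s - t) := by linarith
    have h4 := le_of_mul_le_mul_right h3 (sub_pos.2 hs.1)
    have h5 : ‖z‖ ≤ Real.exp (rightSlope v s) := by
      rwa [← Real.log_le_iff_le_exp hz']
    simp only [max_eq_left h5, Real.log_exp]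
  rw [radialPotential, h.split_integral z ht, e1, e2]
  ring

end ConvexProfile

/-! ### The radial measure and its logarithmic potential -/

/-- The uniform probability measure on angles. -/
noncomputable def angleMeasure : Measure ℝ :=
  ENNReal.ofReal (2 * Real.pi)⁻¹ • volume.restrict (Set.Ioc 0 (2 * Real.pi))

instance : IsProbabilityMeasure angleMeasure := ⟨by
  rw [angleMeasure, Measure.smul_apply, Measure.restrict_apply_univ, Real.volume_Ioc, sub_zero,
    smul_eq_mul, ← ENNReal.ofReal_mul (inv_pos.2 Real.two_pi_pos).le,
    inv_mul_cancel₀ Real.two_pi_pos.ne', ENNReal.ofReal_one]⟩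

lemma integral_angleMeasure (F : ℝ → ℝ) :
    ∫ θ, F θ ∂angleMeasure = (2 * Real.pi)⁻¹ * ∫ θ in Set.Ioc 0 (2 * Real.pi), F θ := by
  rw [angleMeasure, integral_smul_measure,
    ENNReal.toReal_ofReal (inv_pos.2 Real.two_pi_pos).le, smul_eq_mul]

/-- The rotationally invariant measure of mass `κ` whose radii are `exp (v'(t))`, `t ∈ (0, κ)`. -/
noncomputable def radialMeasure (v : ℝ → ℝ) (κ : ℝ) : Measure ℂ :=
  ((volume.restrict (Set.Ioc 0 κ)).prod angleMeasure).map
    (fun p => circleMap 0 (Real.exp (rightSlope v p.1)) p.2)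

lemma measurable_radialMap (v : ℝ → ℝ) :
    Measurable fun p : ℝ × ℝ => circleMap 0 (Real.exp (rightSlope v p.1)) p.2 := by
  have := measurable_rightSlope v
  unfold circleMap
  fun_prop

instance (v : ℝ → ℝ) (κ : ℝ) : IsFiniteMeasure (radialMeasure v κ) := by
  unfold radialMeasure; infer_instance

lemma radialMeasure_univ (v : ℝ → ℝ) (κ : ℝ) :
    radialMeasure v κ Set.univ = ENNReal.ofReal κ := by
  rw [radialMeasure, Measure.map_apply (measurable_radialMap v) MeasurableSet.univ,
    Set.preimage_univ, ← Set.univ_prod_univ, Measure.prod_prod,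
    Measure.restrict_apply_univ, Real.volume_Ioc, sub_zero, measure_univ (μ := angleMeasure),
    mul_one]

/-- Almost every point for the radial measure is of the form `exp (v'(t) + i θ)`. -/
lemma ae_radialMeasure (v : ℝ → ℝ) (κ : ℝ) {p : ℂ → Prop} (hp : MeasurableSet {z | p z})
    (h : ∀ t ∈ Set.Ioc 0 κ, ∀ z, ‖z‖ = Real.exp (rightSlope v t) → p z) :
    ∀ᵐ z ∂(radialMeasure v κ), p z := by
  rw [radialMeasure, ae_map_iff (measurable_radialMap v).aemeasurable hp]
  have h1 : ∀ᵐ q ∂((volume.restrict (Set.Ioc 0 κ)).prod angleMeasure), q.1 ∈ Set.Ioc 0 κ :=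
    Measure.quasiMeasurePreserving_fst.ae (p := fun t => t ∈ Set.Ioc 0 κ)
      (ae_restrict_mem measurableSet_Ioc)
  filter_upwards [h1] with q hq
  refine h q.1 hq _ ?_
  rw [norm_circleMap_zero, abs_of_pos (Real.exp_pos _)]

namespace ConvexProfile

variable {v : ℝ → ℝ} {κ b : ℝ}

lemma ae_norm_le (h : ConvexProfile v κ b) :
    ∀ᵐ z ∂(radialMeasure v κ), ‖z‖ ≤ Real.exp (rightSlope v κ) := by
  refine ae_radialMeasure v κ (measurableSet_le (by fun_prop) (by fun_prop)) fun t ht z hz => ?_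
  rw [hz, Real.exp_le_exp]
  exact h.slope_le ht

/-- The radii may shrink to 0 as t → 0, but the circle mean of |log| costs only |v'(t)|, which is
integrable. The bound depends on z only through a logarithmic growth term. -/
lemma integrable_log_radial (h : ConvexProfile v κ b) (z : ℂ) :
    Integrable (fun p : ℝ × ℝ => Real.log ‖z - circleMap 0 (Real.exp (rightSlope v p.1)) p.2‖)
      ((volume.restrict (Set.Ioc 0 κ)).prod angleMeasure) ∧
    ∫ p : ℝ × ℝ, |Real.log ‖z - circleMap 0 (Real.exp (rightSlope v p.1)) p.2‖|
      ∂((volume.restrict (Set.Ioc 0 κ)).prod angleMeasure)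
      ≤ ∫ t in Set.Ioc 0 κ, (2 * Real.posLog (‖z‖ + Real.exp (rightSlope v κ)) + |rightSlope v t|)
      := by
  have hm : Measurable fun p : ℝ × ℝ =>
      Real.log ‖z - circleMap 0 (Real.exp (rightSlope v p.1)) p.2‖ := by
    have := measurable_radialMap v
    fun_prop
  have hbd : Integrable (fun t => 2 * Real.posLog (‖z‖ + Real.exp (rightSlope v κ))
      + |rightSlope v t|) (volume.restrict (Set.Ioc 0 κ)) :=
    (integrable_const _).add h.integrableOn.abs
  have hle : ∀ᵐ t ∂(volume.restrict (Set.Ioc 0 κ)),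
      ∫ θ, |Real.log ‖z - circleMap 0 (Real.exp (rightSlope v t)) θ‖| ∂angleMeasure
      ≤ 2 * Real.posLog (‖z‖ + Real.exp (rightSlope v κ)) + |rightSlope v t| := by
    filter_upwards [ae_restrict_mem measurableSet_Ioc] with t ht
    have h1 := integral_abs_log_circleMap_le z 0 (Real.exp_pos (rightSlope v t))
    simp only [norm_sub_rev z]
    rw [integral_angleMeasure, inv_mul_le_iff₀ Real.two_pi_pos]
    refine h1.trans (mul_le_mul_of_nonneg_left ?_ Real.two_pi_pos.le)
    rw [zero_sub, norm_neg]
    have h2 := (log_max_bounds (rightSlope v t) z).1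
    have h3 := Real.posLog_le_posLog (x := ‖z‖ + Real.exp (rightSlope v t))
      (y := ‖z‖ + Real.exp (rightSlope v κ)) (by positivity)
      (by linarith [Real.exp_le_exp.2 (h.slope_le ht)])
    linarith [neg_abs_le (rightSlope v t)]
  have hI : Integrable (fun p : ℝ × ℝ =>
      Real.log ‖z - circleMap 0 (Real.exp (rightSlope v p.1)) p.2‖)
      ((volume.restrict (Set.Ioc 0 κ)).prod angleMeasure) := by
    rw [integrable_prod_iff hm.aestronglyMeasurable]
    constructor
    · refine ae_of_all _ fun t => ?_
      simp only [norm_sub_rev z]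
      exact (integrableOn_log_circleMap z 0 _).smul_measure (by simp)
    · refine hbd.mono' (hm.norm.stronglyMeasurable.integral_prod_right
        (ν := angleMeasure)).aestronglyMeasurable ?_
      filter_upwards [hle] with t ht
      rw [Real.norm_eq_abs, abs_of_nonneg (integral_nonneg fun _ => norm_nonneg _)]
      exact ht
  refine ⟨hI, ?_⟩
  rw [integral_prod _ hI.abs]
  exact integral_mono_ae hI.abs.integral_prod_left hbd hle

lemma integrable_log_sub (h : ConvexProfile v κ b) (z : ℂ) :
    Integrable (fun a => Real.log ‖z - a‖) (radialMeasure v κ) := by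
  rw [radialMeasure, integrable_map_measure (Measurable.aestronglyMeasurable (by fun_prop))
    (measurable_radialMap v).aemeasurable]
  exact (h.integrable_log_radial z).1

lemma integral_abs_log_sub_le (h : ConvexProfile v κ b) (z : ℂ) :
    ∫ a, |Real.log ‖z - a‖| ∂(radialMeasure v κ)
      ≤ κ * (2 * Real.posLog (‖z‖ + Real.exp (rightSlope v κ)))
        + ∫ t in Set.Ioc 0 κ, |rightSlope v t| := by
  rw [radialMeasure, integral_map (measurable_radialMap v).aemeasurable
    (Measurable.aestronglyMeasurable (by fun_prop))]
  refine (h.integrable_log_radial z).2.trans (le_of_eq ?_)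
  rw [integral_add (integrable_const _) h.integrableOn.abs, setIntegral_const,
    Real.volume_real_Ioc_of_le h.pos.le, sub_zero, smul_eq_mul]

/-- By Jensen's formula, averaging log‖z - ·‖ over the circle of radius exp v'(t) gives log max(exp
v'(t), ‖z‖). Integrating in t gives the potential. -/
lemma radialPotential_eq (h : ConvexProfile v κ b) (z : ℂ) :
    radialPotential v κ z = logPotential (radialMeasure v κ) z - v κ := by
  rw [radialPotential, logPotential, radialMeasure, integral_map
    (measurable_radialMap v).aemeasurable (Measurable.aestronglyMeasurable (by fun_prop)),
    integral_prod _ (h.integrable_log_radial z).1]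
  congr 1
  refine integral_congr_ae (ae_of_all _ fun t => ?_)
  simp only [norm_sub_rev z]
  rw [integral_angleMeasure, integral_log_circleMap z 0 (Real.exp_pos _),
    inv_mul_cancel_left₀ Real.two_pi_pos.ne', zero_sub, norm_neg]

end ConvexProfile

/-! ### Exponential bounds for the random polynomials -/

section Profile

variable {a : ℕ → ℕ → ℂ} {f : ℝ → ℝ} {T₀ : EReal}

lemma IsCoefficientProfile.convexProfile (hf : IsCoefficientProfile a f T₀)
    (hconv : ConvexOn ℝ {t : ℝ | 0 < t ∧ (t : EReal) < T₀} (fun t => -Real.log (f t)))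
    {κ b : ℝ} (hκ : 0 < κ) (hκb : κ < b) (hb : (b : EReal) ≤ T₀) :
    ConvexProfile (fun t => -Real.log (f t)) κ b where
  convex := hconv.subset (fun t ht => ⟨ht.1, (EReal.coe_lt_coe_iff.2 ht.2).trans_le hb⟩)
    (convex_Ioo 0 b)
  cont := by
    have hsub : Set.Ico 0 b ⊆ {t : ℝ | 0 ≤ t ∧ (t : EReal) < T₀} := fun t ht =>
      ⟨ht.1, (EReal.coe_lt_coe_iff.2 ht.2).trans_le hb⟩
    exact ((hf.continuousOn.mono hsub).log fun t ht =>
      (hf.pos t (hsub ht).1 (hsub ht).2).ne').neg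
  pos := hκ
  lt := hκb

lemma IsCoefficientProfile.exists_lower_bound (hf : IsCoefficientProfile a f T₀) {κ : ℝ}
    (hκ : 0 < κ) (hκT : (κ : EReal) < T₀) : ∃ c > 0, ∀ t ∈ Set.Icc 0 κ, c ≤ f t := by
  have hsub : Set.Icc 0 κ ⊆ {t : ℝ | 0 ≤ t ∧ (t : EReal) < T₀} := fun t ht =>
    ⟨ht.1, (EReal.coe_le_coe_iff.2 ht.2).trans_lt hκT⟩
  obtain ⟨t, ht, hmin⟩ := isCompact_Icc.exists_isMinOn ⟨0, ⟨le_rfl, hκ.le⟩⟩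
    (hf.continuousOn.mono hsub)
  exact ⟨f t, hf.pos t (hsub ht).1 (hsub ht).2, fun s hs => hmin hs⟩

/-- On [0, κ] the profile is at least some c > 0, so an additive error c(1 - exp(-δ)) in the n-th
root is a multiplicative error between exp(-δ) and exp δ. The upper side uses 1 - exp(-δ) ≤ δ ≤ exp
δ - 1. -/
lemma IsCoefficientProfile.coefficient_bounds (hf : IsCoefficientProfile a f T₀) {κ : ℝ}
    (hκ : 0 < κ) (hκT : (κ : EReal) < T₀) {δ : ℝ} (hδ : 0 < δ) :
    ∀ᶠ n : ℕ in atTop, ∀ k : ℕ, (k : ℝ) ≤ κ * n →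
      Real.exp (n * (Real.log (f (k / n)) - δ)) ≤ ‖a k n‖ ∧
      ‖a k n‖ ≤ Real.exp (n * (Real.log (f (k / n)) + δ)) := by
  obtain ⟨c, hc, hcf⟩ := hf.exists_lower_bound hκ hκT
  have he : Real.exp (-δ) < 1 := Real.exp_lt_one_iff.2 (by linarith)
  filter_upwards [hf.unif κ hκ (c * (1 - Real.exp (-δ))) (mul_pos hc (by linarith)),
    eventually_gt_atTop 0] with n hn hn0 k hk
  have hn' : (0 : ℝ) < n := by exact_mod_cast hn0
  have ht : (k : ℝ) / n ∈ Set.Icc 0 κ := ⟨by positivity, by rwa [div_le_iff₀ hn']⟩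
  have hft := hcf _ ht
  have h := abs_le.1 (hn k hk)
  set F := f ((k : ℝ) / n) with hF
  have hF0 : 0 < F := hc.trans_le hft
  set x := ‖a k n‖ ^ (1 / (n : ℝ)) with hx
  have hxn : x ^ n = ‖a k n‖ := by
    rw [hx, one_div, Real.rpow_inv_natCast_pow (norm_nonneg _) hn0.ne']
  have hx0 : 0 ≤ x := by positivity
  have hexp : ∀ y : ℝ, Real.exp (n * (Real.log F + y)) = (F * Real.exp y) ^ n := by
    intro y
    rw [Real.exp_nat_mul, Real.exp_add, Real.exp_log hF0]
  have h1 := Real.add_one_le_exp δ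
  have h2 := Real.add_one_le_exp (-δ)
  have h3 : c * (1 - Real.exp (-δ)) ≤ F * (1 - Real.exp (-δ)) :=
    mul_le_mul_of_nonneg_right hft (by linarith)
  rw [sub_eq_add_neg, hexp, hexp, ← hxn]
  refine ⟨pow_le_pow_left₀ (by positivity) (by nlinarith [h.1]) n,
    pow_le_pow_left₀ hx0 (by nlinarith [h.2]) n⟩

variable {κ b : ℝ}

lemma term_le (h : ConvexProfile (fun t => -Real.log (f t)) κ b) {n k : ℕ} (hn : 0 < n)
    (hk : (k : ℝ) ≤ κ * n) {δ : ℝ} {α : ℂ}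
    (hα : ‖α‖ ≤ Real.exp (n * (Real.log (f (k / n)) + δ))) (z : ℂ) :
    ‖α‖ * ‖z‖ ^ k ≤ Real.exp (n * (radialPotential (fun t => -Real.log (f t)) κ z + δ)) := by
  have hn' : (0 : ℝ) < n := by exact_mod_cast hn
  have ht : (k : ℝ) / n ∈ Set.Icc 0 κ := ⟨by positivity, by rwa [div_le_iff₀ hn']⟩
  -- The constant term and the point z = 0 are treated apart, since the formula ‖z‖ ^ k = exp(k
  -- log‖z‖) fails at z = 0 for k > 0 with the real logarithm.
  rcases eq_or_ne k 0 with hk0 | hk0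
  · subst hk0
    rw [pow_zero, mul_one]
    refine hα.trans (Real.exp_le_exp.2 (mul_le_mul_of_nonneg_left ?_ hn'.le))
    have := h.neg_le_radialPotential z
    simp only [neg_neg, Nat.cast_zero, zero_div] at this ⊢
    linarith
  rcases eq_or_ne z 0 with hz | hz
  · subst hz
    rw [norm_zero, zero_pow hk0, mul_zero]
    exact (Real.exp_pos _).le
  · have hz' : 0 < ‖z‖ := norm_pos_iff.2 hz
    have h1 := h.le_radialPotential hz ht
    have h2 : ‖z‖ ^ k = Real.exp (n * (k / n * Real.log ‖z‖)) := by
      rw [← mul_assoc, mul_div_cancel₀ _ hn'.ne', Real.exp_nat_mul, Real.exp_log hz']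
    rw [h2]
    calc _ ≤ Real.exp (n * (Real.log (f (k / n)) + δ)) * Real.exp (n * (k / n * Real.log ‖z‖)) :=
          mul_le_mul_of_nonneg_right hα (Real.exp_pos _).le
      _ ≤ _ := by
          rw [← Real.exp_add, Real.exp_le_exp, ← mul_add]
          exact mul_le_mul_of_nonneg_left (by linarith) hn'.le

end Profile

/-! ### Probability estimates and convergence of the zero measures -/

section Noise

variable {Ω : Type*} [MeasurableSpace Ω] {P : Measure Ω}

/-- The functions n · 1{X > δn} are dominated by X/δ and tend to 0 pointwise. The factor n is what a
union bound over order n indices requires. -/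
lemma tendsto_mul_measure_gt {X : Ω → ℝ} (hX : Measurable X) (hint : Integrable X P)
    (h0 : ∀ ω, 0 ≤ X ω) {δ : ℝ} (hδ : 0 < δ) :
    Tendsto (fun n : ℕ => (n : ℝ) * P.real {ω | δ * n < X ω}) atTop (𝓝 0) := by
  have hm : ∀ n : ℕ, MeasurableSet {ω | δ * n < X ω} := fun n =>
    measurableSet_lt measurable_const hX
  have e : ∀ n : ℕ, (n : ℝ) * P.real {ω | δ * n < X ω}
      = ∫ ω, {ω | δ * n < X ω}.indicator (fun _ => (n : ℝ)) ω ∂P := fun n => by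
    rw [integral_indicator_const _ (hm n), smul_eq_mul, mul_comm]
  simp only [e]
  have hz : (0 : ℝ) = ∫ _, (0 : ℝ) ∂P := by simp
  rw [hz]
  refine tendsto_integral_of_dominated_convergence (fun ω => δ⁻¹ * X ω) ?_ (hint.const_mul _) ?_ ?_
  · exact fun n => (measurable_const.indicator (hm n)).aestronglyMeasurable
  · intro n
    refine ae_of_all _ fun ω => ?_
    by_cases h : δ * n < X ω
    · rw [Set.indicator_of_mem (by exact h), Real.norm_eq_abs, abs_of_nonneg (by positivity),
        le_inv_mul_iff₀ hδ]
      exact h.le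
    · rw [Set.indicator_of_notMem (by exact h), norm_zero]
      exact mul_nonneg (inv_nonneg.2 hδ.le) (h0 ω)
  · refine ae_of_all _ fun ω => ?_
    obtain ⟨N, hN⟩ := exists_nat_gt (X ω / δ)
    refine tendsto_const_nhds.congr' ?_
    filter_upwards [eventually_ge_atTop N] with n hn
    rw [Set.indicator_of_notMem]
    simp only [Set.mem_ofPred_eq, not_lt]
    rw [div_lt_iff₀ hδ] at hN
    have : (N : ℝ) ≤ n := by exact_mod_cast hn
    nlinarith

variable [IsProbabilityMeasure P] {ξ : ℕ → Ω → ℂ}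

/-- With high probability, all noise variables of index at most `κ n` are at most `exp (δ n)`. -/
lemma IsCoefficientNoise.tendsto_measure_exists_gt (hξ : IsCoefficientNoise P ξ) {κ δ : ℝ}
    (hκ : 0 < κ) (hδ : 0 < δ) :
    Tendsto (fun n : ℕ => P {ω | ∃ k ∈ Finset.range (⌊κ * n⌋₊ + 1),
      Real.exp (δ * n) < ‖ξ k ω‖}) atTop (𝓝 0) := by
  set X : Ω → ℝ := fun ω => Real.log (1 + ‖ξ 0 ω‖) with hX
  have hXm : Measurable X := by
    have := hξ.measurable 0
    rw [hX]; fun_prop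
  have ht := tendsto_mul_measure_gt hXm hξ.log_moment
    (fun ω => Real.log_nonneg (by linarith [norm_nonneg (ξ 0 ω)])) hδ
  have ht2 : Tendsto (fun n : ℕ => ENNReal.ofReal ((κ + 1) * ((n : ℝ) * P.real {ω | δ * n < X ω})))
      atTop (𝓝 0) := by
    have := ENNReal.tendsto_ofReal (ht.const_mul (κ + 1))
    simpa using this
  refine tendsto_of_tendsto_of_tendsto_of_le_of_le' tendsto_const_nhds ht2
    (Eventually.of_forall fun _ => zero_le) ?_
  filter_upwards [eventually_ge_atTop 1] with n hn
  have hn' : (1 : ℝ) ≤ n := by exact_mod_cast hn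
  have hone : ∀ k, P {ω | Real.exp (δ * n) < ‖ξ k ω‖} ≤ P {ω | δ * n < X ω} := by
    intro k
    have hms : MeasurableSet {x : ℂ | Real.exp (δ * n) < ‖x‖} :=
      measurableSet_lt measurable_const (by fun_prop)
    have h1 := (hξ.ident k).measure_mem_eq hms
    change P {ω | Real.exp (δ * n) < ‖ξ k ω‖} = P {ω | Real.exp (δ * n) < ‖ξ 0 ω‖} at h1
    rw [h1]
    refine measure_mono fun ω hω => ?_
    simp only [Set.mem_ofPred_eq] at hω ⊢
    rw [hX, Real.lt_log_iff_exp_lt (by positivity)]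
    linarith
  calc P {ω | ∃ k ∈ Finset.range (⌊κ * n⌋₊ + 1), Real.exp (δ * n) < ‖ξ k ω‖}
      = P (⋃ k ∈ Finset.range (⌊κ * n⌋₊ + 1), {ω | Real.exp (δ * n) < ‖ξ k ω‖}) := by
        congr 1; ext ω; simp
    _ ≤ ∑ k ∈ Finset.range (⌊κ * n⌋₊ + 1), P {ω | Real.exp (δ * n) < ‖ξ k ω‖} :=
        measure_biUnion_finset_le _ _
    _ ≤ ∑ k ∈ Finset.range (⌊κ * n⌋₊ + 1), P {ω | δ * n < X ω} :=
        Finset.sum_le_sum fun k _ => hone k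
    _ = ENNReal.ofReal ((⌊κ * n⌋₊ + 1 : ℕ) * P.real {ω | δ * n < X ω}) := by
        rw [Finset.sum_const, Finset.card_range, nsmul_eq_mul, ENNReal.ofReal_mul (by positivity),
          ENNReal.ofReal_natCast, ofReal_measureReal]
    _ ≤ _ := by
        refine ENNReal.ofReal_le_ofReal ?_
        rw [← mul_assoc]
        refine mul_le_mul_of_nonneg_right ?_ measureReal_nonneg
        have := Nat.floor_le (show 0 ≤ κ * n by positivity)
        push_cast
        linarith

lemma eval_truncatedPoly {Ω : Type*} {ξ : ℕ → Ω → ℂ}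
    (a : ℕ → ℕ → ℂ) (κ : ℝ) (n : ℕ) (ω : Ω) (z : ℂ) :
    (truncatedPoly ξ a κ n ω).eval z
      = ∑ k ∈ Finset.range (⌊κ * n⌋₊ + 1), ξ k ω * a k n * z ^ k := by
  simp [truncatedPoly, Polynomial.eval_finsetSum]

lemma natDegree_truncatedPoly_le {Ω : Type*} {ξ : ℕ → Ω → ℂ}
    (a : ℕ → ℕ → ℂ) {κ : ℝ} (hκ : 0 < κ) (n : ℕ) (ω : Ω) :
    ((truncatedPoly ξ a κ n ω).natDegree : ℝ) ≤ κ * n := by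
  have h1 : (truncatedPoly ξ a κ n ω).natDegree ≤ ⌊κ * n⌋₊ := by
    refine Polynomial.natDegree_sum_le_of_forall_le _ _ fun k hk => ?_
    refine (Polynomial.natDegree_C_mul_X_pow_le _ _).trans ?_
    rw [Finset.mem_range] at hk; omega
  have h2 : ((truncatedPoly ξ a κ n ω).natDegree : ℝ) ≤ ⌊κ * n⌋₊ := by exact_mod_cast h1
  exact h2.trans (Nat.floor_le (by positivity))

variable {a : ℕ → ℕ → ℂ} {f : ℝ → ℝ} {T₀ : EReal}

/-- The margin δ is split into thirds: one for the noise, one for the coefficients, one for the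
number of terms. The exceptional event concerns the noise alone, so the bound is uniform in z. -/
lemma tendsto_measure_upper (hξ : IsCoefficientNoise P ξ) (hf : IsCoefficientProfile a f T₀)
    {κ b : ℝ} (h : ConvexProfile (fun t => -Real.log (f t)) κ b) (hκT : (κ : EReal) < T₀)
    {δ : ℝ} (hδ : 0 < δ) :
    Tendsto (fun n : ℕ => P {ω | ¬ ∀ z, ‖(truncatedPoly ξ a κ n ω).eval z‖
      ≤ Real.exp (n * (radialPotential (fun t => -Real.log (f t)) κ z + δ))}) atTop (𝓝 0) := by
  have hδ3 : 0 < δ / 3 := by positivity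
  refine tendsto_of_tendsto_of_tendsto_of_le_of_le' tendsto_const_nhds
    (hξ.tendsto_measure_exists_gt h.pos hδ3) (Eventually.of_forall fun _ => zero_le) ?_
  have hgrow : ∀ᶠ n : ℕ in atTop, κ * n + 1 ≤ Real.exp (δ / 3 * n) := by
    have h1 : Tendsto (fun x : ℝ => (κ / (δ / 3) * x + 1) / Real.exp x) atTop (𝓝 0) := by
      have h2 := Real.tendsto_pow_mul_exp_neg_atTop_nhds_zero 1
      have h3 := Real.tendsto_exp_neg_atTop_nhds_zero
      have h4 := (h2.const_mul (κ / (δ / 3))).add h3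
      simp only [pow_one, mul_zero, add_zero] at h4
      refine h4.congr fun x => ?_
      rw [Real.exp_neg]; field_simp
    have h2 : Tendsto (fun n : ℕ => δ / 3 * (n : ℝ)) atTop atTop :=
      tendsto_natCast_atTop_atTop.const_mul_atTop hδ3
    filter_upwards [(h1.comp h2).eventually (ge_mem_nhds (zero_lt_one))] with n hn
    simp only [Function.comp] at hn
    rw [div_le_one (Real.exp_pos _)] at hn
    have : κ / (δ / 3) * (δ / 3 * n) = κ * n := by field_simp
    linarith
  filter_upwards [hf.coefficient_bounds h.pos hκT hδ3, hgrow, eventually_gt_atTop 0]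
    with n hn hgn hn0
  refine measure_mono fun ω hω => ?_
  simp only [Set.mem_ofPred_eq] at hω ⊢
  by_contra hcon
  push Not at hcon
  refine hω fun z => ?_
  have hn' : (0 : ℝ) < n := by exact_mod_cast hn0
  set V := radialPotential (fun t => -Real.log (f t)) κ z with hV
  have hterm : ∀ k ∈ Finset.range (⌊κ * n⌋₊ + 1), ‖ξ k ω * a k n * z ^ k‖
      ≤ Real.exp (δ / 3 * n) * Real.exp (n * (V + δ / 3)) := by
    intro k hk
    have hk' : (k : ℝ) ≤ κ * n := by
      rw [Finset.mem_range] at hk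
      have : (k : ℝ) ≤ ⌊κ * n⌋₊ := by exact_mod_cast (by omega : k ≤ ⌊κ * n⌋₊)
      exact this.trans (Nat.floor_le (mul_nonneg h.pos.le hn'.le))
    rw [norm_mul, norm_mul, norm_pow, mul_assoc]
    exact mul_le_mul (hcon k hk) (term_le h hn0 hk' (hn k hk').2 z) (by positivity)
      (Real.exp_pos _).le
  rw [eval_truncatedPoly]
  calc _ ≤ ∑ k ∈ Finset.range (⌊κ * n⌋₊ + 1), ‖ξ k ω * a k n * z ^ k‖ := norm_sum_le _ _
    _ ≤ ∑ k ∈ Finset.range (⌊κ * n⌋₊ + 1),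
        Real.exp (δ / 3 * n) * Real.exp (n * (V + δ / 3)) := Finset.sum_le_sum hterm
    _ = (⌊κ * n⌋₊ + 1 : ℕ) * (Real.exp (δ / 3 * n) * Real.exp (n * (V + δ / 3))) := by
        rw [Finset.sum_const, Finset.card_range, nsmul_eq_mul]
    _ ≤ Real.exp (δ / 3 * n) * (Real.exp (δ / 3 * n) * Real.exp (n * (V + δ / 3))) := by
        refine mul_le_mul_of_nonneg_right ?_ (by positivity)
        have := Nat.floor_le (mul_nonneg h.pos.le hn'.le)
        push_cast
        linarith
    _ = _ := by
        rw [← Real.exp_add, ← Real.exp_add]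
        congr 1; ring

/-- By continuity, all indices with k/n near a maximiser t give terms almost as large as exp(nV).
Divided by E = exp(n(V - δ)), order n coefficients have modulus at least one, and anticoncentration
applies with any prescribed η. -/
lemma tendsto_measure_lower (hξ : IsCoefficientNoise P ξ) (hf : IsCoefficientProfile a f T₀)
    {κ b : ℝ} (h : ConvexProfile (fun t => -Real.log (f t)) κ b) (hκT : (κ : EReal) < T₀)
    {δ : ℝ} (hδ : 0 < δ) {z : ℂ} (hz : z ≠ 0) :
    Tendsto (fun n : ℕ => P {ω | ¬ Real.exp (n * (radialPotential (fun t => -Real.log (f t)) κ z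
      - δ)) ≤ ‖(truncatedPoly ξ a κ n ω).eval z‖}) atTop (𝓝 0) := by
  set V := radialPotential (fun t => -Real.log (f t)) κ z with hV
  have hz' : 0 < ‖z‖ := norm_pos_iff.2 hz
  obtain ⟨t, ht, htV⟩ := h.exists_radialPotential_eq hz
  have hcont : ContinuousOn (fun t => t * Real.log ‖z‖ - -Real.log (f t)) (Set.Icc 0 κ) :=
    (by fun_prop : Continuous fun t => t * Real.log ‖z‖).continuousOn.sub
      (h.cont.mono fun t ht => ⟨ht.1, ht.2.trans_lt h.lt⟩)
  obtain ⟨r, hr, hrt⟩ := Metric.continuousWithinAt_iff.1 (hcont t ht) (δ / 2) (by positivity)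
  -- Clipping to [0, κ] leaves an interval of positive length even when the maximiser is an
  -- endpoint.
  set α := max 0 (t - r / 2) with hα
  set β := min κ (t + r / 2) with hβ
  have hαβ : α < β := by
    have := h.pos
    rw [hα, hβ, max_lt_iff, lt_min_iff, lt_min_iff]
    refine ⟨⟨h.pos, ?_⟩, ?_, ?_⟩ <;> linarith [ht.1, ht.2]
  have hα0 : 0 ≤ α := le_max_left _ _
  have hnear : ∀ s ∈ Set.Icc α β, V - δ / 2 ≤ s * Real.log ‖z‖ + Real.log (f s) := by
    intro s hs
    have h1 : s ∈ Set.Icc 0 κ := ⟨hα0.trans hs.1, hs.2.trans (min_le_left _ _)⟩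
    have h2 : t - r / 2 ≤ s := (le_max_right _ _).trans hs.1
    have h3 : s ≤ t + r / 2 := hs.2.trans (min_le_right _ _)
    have h4 := hrt h1 (by rw [Real.dist_eq, abs_lt]; constructor <;> linarith)
    rw [Real.dist_eq, ← htV, abs_lt] at h4
    linarith [h4.1]
  rw [ENNReal.tendsto_nhds_zero]
  intro η hη
  obtain ⟨η', hη', hη'η⟩ : ∃ η' : ℝ, 0 < η' ∧ ENNReal.ofReal η' ≤ η := by
    rcases eq_or_ne η ∞ with h | h
    · exact ⟨1, one_pos, by simp [h]⟩
    · exact ⟨η.toReal, ENNReal.toReal_pos hη.ne' h, by rw [ENNReal.ofReal_toReal h]⟩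
  obtain ⟨m, hm⟩ := exists_anticoncentration P ξ hξ hη'
  -- The extra 1 pays for the two floors in counting the indices in (αn, βn].
  have hcard : ∀ᶠ n : ℕ in atTop, (m : ℝ) + 1 ≤ (β - α) * n :=
    (tendsto_natCast_atTop_atTop.const_mul_atTop (sub_pos.2 hαβ)).eventually_ge_atTop _
  filter_upwards [hf.coefficient_bounds h.pos hκT (half_pos hδ), hcard, eventually_gt_atTop 0]
    with n hn hcn hn0
  have hn' : (0 : ℝ) < n := by exact_mod_cast hn0
  set E := Real.exp (n * (V - δ)) with hE
  have hE0 : 0 < E := Real.exp_pos _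
  refine le_trans ?_ hη'η
  refine le_trans (measure_mono ?_) (hm (Finset.range (⌊κ * n⌋₊ + 1))
    (Finset.Ioc ⌊α * n⌋₊ ⌊β * n⌋₊) (fun k => (E⁻¹ : ℝ) * (a k n * z ^ k)) ?_ ?_ ?_)
  · intro ω hω
    simp only [Set.mem_ofPred_eq, not_le] at hω ⊢
    have : ∑ k ∈ Finset.range (⌊κ * n⌋₊ + 1), ((E⁻¹ : ℝ) : ℂ) * (a k n * z ^ k) * ξ k ω
        = (E⁻¹ : ℝ) * (truncatedPoly ξ a κ n ω).eval z := by
      rw [eval_truncatedPoly, Finset.mul_sum]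
      exact Finset.sum_congr rfl fun k _ => by ring
    rw [this, norm_mul, Complex.norm_real, Real.norm_eq_abs, abs_of_pos (inv_pos.2 hE0),
      inv_mul_le_iff₀ hE0, mul_one]
    exact hω.le
  · intro k hk
    rw [Finset.mem_Ioc] at hk
    rw [Finset.mem_range]
    have : ⌊β * n⌋₊ ≤ ⌊κ * n⌋₊ :=
      Nat.floor_le_floor (mul_le_mul_of_nonneg_right (min_le_left _ _) hn'.le)
    omega
  · rw [Nat.card_Ioc]
    have h1 := Nat.lt_floor_add_one (β * n)
    have h2 := Nat.floor_le (mul_nonneg hα0 hn'.le)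
    have h3 : (m : ℝ) + ⌊α * n⌋₊ < ⌊β * n⌋₊ + 1 := by linarith
    have h4 : m + ⌊α * n⌋₊ < ⌊β * n⌋₊ + 1 := by exact_mod_cast h3
    omega
  · intro k hk
    rw [Finset.mem_Ioc] at hk
    have hβ0 : 0 ≤ β * n := mul_nonneg (hα0.trans hαβ.le) hn'.le
    have hk1 : α ≤ k / n := by
      rw [le_div_iff₀ hn']
      exact (Nat.lt_of_floor_lt hk.1).le
    have hk2 : (k : ℝ) / n ≤ β := by
      rw [div_le_iff₀ hn']
      exact (Nat.le_floor_iff hβ0).1 hk.2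
    have hkκ : (k : ℝ) ≤ κ * n := by
      rw [← div_le_iff₀ hn']; exact hk2.trans (min_le_left _ _)
    have h1 := (hn k hkκ).1
    have h2 := hnear _ ⟨hk1, hk2⟩
    have h3 : ‖z‖ ^ k = Real.exp (n * (k / n * Real.log ‖z‖)) := by
      rw [← mul_assoc, mul_div_cancel₀ _ hn'.ne', Real.exp_nat_mul, Real.exp_log hz']
    rw [norm_mul, Complex.norm_real, Real.norm_eq_abs, abs_of_pos (inv_pos.2 hE0), norm_mul,
      norm_pow, le_inv_mul_iff₀ hE0, mul_one, h3]
    calc E ≤ Real.exp (n * (Real.log (f (k / n)) - δ / 2)) *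
          Real.exp (n * (k / n * Real.log ‖z‖)) := by
          rw [hE, ← Real.exp_add, Real.exp_le_exp, ← mul_add]
          exact mul_le_mul_of_nonneg_left (by linarith) hn'.le
      _ ≤ _ := mul_le_mul_of_nonneg_right h1 (Real.exp_pos _).le

/-- The scaled zero measures converge to the radial measure. -/
theorem isLimitingZeroMeasure_radialMeasure (hξ : IsCoefficientNoise P ξ)
    (hf : IsCoefficientProfile a f T₀) {κ b : ℝ}
    (h : ConvexProfile (fun t => -Real.log (f t)) κ b) (hκT : (κ : EReal) < T₀) :
    IsLimitingZeroMeasure P ξ a κ (radialMeasure (fun t => -Real.log (f t)) κ) := by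
  set v : ℝ → ℝ := fun t => -Real.log (f t) with hv
  refine ⟨inferInstance, fun φ hφ hφc => ?_⟩
  rw [tendstoInMeasure_iff_dist]
  intro ε hε
  obtain ⟨Z, R, δ, hZ, hδ, hstab⟩ := exists_vague_stability (radialMeasure v κ) h.ae_norm_le
    h.continuous_radialPotential h.radialPotential_eq (K := κ) hφ hφc (half_pos hε)
  have hsum : Tendsto (fun n : ℕ => P {ω | ¬ ∀ z, ‖(truncatedPoly ξ a κ n ω).eval z‖
      ≤ Real.exp (n * (radialPotential v κ z + δ))} + ∑ z ∈ Z, P {ω | ¬ Real.exp (n *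
      (radialPotential v κ z - δ)) ≤ ‖(truncatedPoly ξ a κ n ω).eval z‖}) atTop (𝓝 0) := by
    have h2 := tendsto_finsetSum Z fun z hz => tendsto_measure_lower hξ hf h hκT hδ
      (z := z) (fun h0 => hZ (h0 ▸ hz))
    simpa using (tendsto_measure_upper hξ hf h hκT hδ).add h2
  refine tendsto_of_tendsto_of_tendsto_of_le_of_le' tendsto_const_nhds hsum
    (Eventually.of_forall fun _ => zero_le) ?_
  filter_upwards [eventually_gt_atTop 0] with n hn0
  refine le_trans (measure_mono ?_) ((measure_union_le _ (⋃ z ∈ Z, {ω | ¬ Real.exp (n *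
      (radialPotential v κ z - δ)) ≤ ‖(truncatedPoly ξ a κ n ω).eval z‖})).trans
      (add_le_add le_rfl (measure_biUnion_finset_le _ _)))
  intro ω hω
  by_contra hcon
  simp only [Set.mem_union, Set.mem_ofPred_eq, Set.mem_iUnion, not_or, not_exists, not_not]
    at hcon
  have := hstab n (truncatedPoly ξ a κ n ω) hn0 (natDegree_truncatedPoly_le a h.pos n ω)
    (fun z _ => hcon.1 z) (fun z hz => hcon.2 z hz)
  simp only [Set.mem_ofPred_eq, Real.dist_eq] at hω
  linarith

end Noise

/-! ### Uniqueness of vague limits -/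

/-- Limits in probability are almost surely unique, and here they are constants. Integrals against
compactly supported functions determine a locally finite measure. -/
lemma IsLimitingZeroMeasure.unique {Ω : Type*} [MeasurableSpace Ω] {P : Measure Ω}
    [IsProbabilityMeasure P] {ξ : ℕ → Ω → ℂ} {a : ℕ → ℕ → ℂ} {κ : ℝ} {μ ν : Measure ℂ}
    (hμ : IsLimitingZeroMeasure P ξ a κ μ) (hν : IsLimitingZeroMeasure P ξ a κ ν) : μ = ν := by
  have := hμ.1
  have := hν.1
  refine Measure.ext_of_integral_eq_on_compactlySupported fun φ => ?_
  have h := tendstoInMeasure_ae_unique (hμ.2 φ φ.continuous φ.hasCompactSupport)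
    (hν.2 φ φ.continuous φ.hasCompactSupport)
  obtain ⟨ω, hω⟩ := h.exists
  exact hω

/-! ### The external field -/

lemma negLog_of_pos {f : ℝ → ℝ} {t : ℝ} (h : 0 < f t) :
    negLog f t = ((-Real.log (f t) : ℝ) : EReal) := by
  rw [negLog, ENNReal.log_ofReal_of_pos h, EReal.coe_neg]

lemma log_enorm {z : ℂ} (hz : z ≠ 0) : ENNReal.log ‖z‖ₑ = ((Real.log ‖z‖ : ℝ) : EReal) := by
  rw [← ofReal_norm, ENNReal.log_ofReal_of_pos (norm_pos_iff.2 hz)]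

section Field

variable {a : ℕ → ℕ → ℂ} {f : ℝ → ℝ} {T₀ : EReal} {κ b : ℝ}

/-- The potential is a supremum over [0, κ], the field one over all t ≥ 0. At the origin the index t
= 0 realises the bound. -/
lemma radialPotential_le_externalField
    (hf : IsCoefficientProfile a f T₀) (h : ConvexProfile (fun t => -Real.log (f t)) κ b)
    (hκT : (κ : EReal) < T₀) (z : ℂ) :
    ((radialPotential (fun t => -Real.log (f t)) κ z : ℝ) : EReal) ≤ externalField f z := by
  have hpos : ∀ t ∈ Set.Icc 0 κ, 0 < f t := fun t ht =>
    hf.pos t ht.1 ((EReal.coe_le_coe_iff.2 ht.2).trans_lt hκT)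
  rcases eq_or_ne z 0 with rfl | hz
  · rw [h.radialPotential_zero]
    refine le_iSup_of_le (⟨0, Set.self_mem_Ici⟩ : Set.Ici (0 : ℝ)) ?_
    rw [negLog_of_pos (hpos 0 ⟨le_rfl, h.pos.le⟩)]
    simp
  · obtain ⟨t, ht, hV⟩ := h.exists_radialPotential_eq hz
    rw [hV]
    refine le_iSup_of_le (⟨t, ht.1⟩ : Set.Ici (0 : ℝ)) ?_
    rw [negLog_of_pos (hpos t ht), log_enorm hz, ← EReal.coe_mul, ← EReal.coe_sub, mul_comm]

/-- The tangent of -log f at κ stays below on all of [0, ∞): by convexity before T₀, by left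
continuity at T₀, and trivially beyond, where f = 0. -/
lemma le_exp_tangent (hf : IsCoefficientProfile a f T₀)
    (hconv : ConvexOn ℝ {t : ℝ | 0 < t ∧ (t : EReal) < T₀} (fun t => -Real.log (f t)))
    (hκ : 0 < κ) (hκT : (κ : EReal) < T₀) {s : ℝ} (hs : 0 ≤ s) :
    f s ≤ Real.exp (-(-Real.log (f κ) + rightSlope (fun t => -Real.log (f t)) κ * (s - κ))) := by
  set g := rightSlope (fun t => -Real.log (f t)) κ with hg
  have key : ∀ s : ℝ, 0 ≤ s → (s : EReal) < T₀ →
      f s ≤ Real.exp (-(-Real.log (f κ) + g * (s - κ))) := by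
    intro s hs hsT
    obtain ⟨b, hb1, hb2⟩ := EReal.lt_iff_exists_real_btwn.1 (max_lt hsT hκT)
    have hsb : s < b := EReal.coe_lt_coe_iff.1 ((le_max_left _ _).trans_lt hb1)
    have hκb : κ < b := EReal.coe_lt_coe_iff.1 ((le_max_right _ _).trans_lt hb1)
    have h := hf.convexProfile hconv hκ hκb hb2.le
    have := tangent_le h.convex h.cont ⟨hκ, hκb⟩ ⟨hs, hsb⟩
    rw [← Real.log_le_iff_le_exp (hf.pos s hs hsT)]
    linarith
  rcases lt_trichotomy (s : EReal) T₀ with hlt | heq | hgt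
  · exact key s hs hlt
  · have hκs : κ < s := EReal.coe_lt_coe_iff.1 (heq ▸ hκT)
    have h1 : Tendsto f (𝓝[<] s) (𝓝 (f s)) :=
      (hf.left_continuous s heq).mono_left (nhdsWithin_mono _ Set.Iio_subset_Iic_self)
    have h2 : Tendsto (fun s => Real.exp (-(-Real.log (f κ) + g * (s - κ)))) (𝓝[<] s)
        (𝓝 (Real.exp (-(-Real.log (f κ) + g * (s - κ))))) :=
      ((by fun_prop : Continuous fun s => Real.exp (-(-Real.log (f κ) + g * (s - κ)))).tendsto
        s).mono_left nhdsWithin_le_nhds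
    refine le_of_tendsto_of_tendsto h1 h2 ?_
    filter_upwards [Ioo_mem_nhdsLT (hκ.trans hκs)] with x hx
    exact key x hx.1.le (heq ▸ EReal.coe_lt_coe_iff.2 hx.2)
  · rw [hf.zero s hs hgt]
    exact (Real.exp_pos _).le

/-- If log‖z‖ ≤ v'(κ), the tangent at κ shows that indices beyond κ give nothing larger than κ
itself, so extending the supremum past κ is harmless. At z = 0 every positive index contributes -∞,
as does every index where f vanishes. -/
lemma externalField_le_radialPotential (hf : IsCoefficientProfile a f T₀)
    (hconv : ConvexOn ℝ {t : ℝ | 0 < t ∧ (t : EReal) < T₀} (fun t => -Real.log (f t)))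
    (h : ConvexProfile (fun t => -Real.log (f t)) κ b) (hκT : (κ : EReal) < T₀) {z : ℂ}
    (hz : ‖z‖ ≤ Real.exp (rightSlope (fun t => -Real.log (f t)) κ)) :
    externalField f z ≤ ((radialPotential (fun t => -Real.log (f t)) κ z : ℝ) : EReal) := by
  refine iSup_le fun ⟨s, hs⟩ => ?_
  rcases eq_or_ne z 0 with rfl | hz0
  · rcases eq_or_lt_of_le (show (0 : ℝ) ≤ s from hs) with rfl | hs0
    · rw [h.radialPotential_zero, negLog_of_pos (hf.pos 0 le_rfl hf.T₀_pos)]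
      simp
    · simp [EReal.bot_mul_coe_of_pos hs0]
  · rcases le_or_gt (f s) 0 with hfs | hfs
    · simp [negLog, ENNReal.ofReal_of_nonpos hfs, sub_eq_add_neg]
    · rw [negLog_of_pos hfs, log_enorm hz0, ← EReal.coe_mul, ← EReal.coe_sub,
        EReal.coe_le_coe_iff]
      rcases le_total s κ with hsκ | hsκ
      · have := h.le_radialPotential hz0 ⟨hs, hsκ⟩
        linarith
      refine le_trans ?_ (h.le_radialPotential hz0 ⟨h.pos.le, le_rfl⟩)
      have h1 := (Real.log_le_iff_le_exp hfs).2 (le_exp_tangent hf hconv h.pos hκT hs)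
      have h2 : Real.log ‖z‖ ≤ rightSlope (fun t => -Real.log (f t)) κ :=
        (Real.log_le_iff_le_exp (norm_pos_iff.2 hz0)).2 hz
      have h3 := mul_nonneg (sub_nonneg.2 hsκ) (sub_nonneg.2 h2)
      linarith

end Field

/-! ### Weighted energies -/

lemma weightedEnergy_mono {Q Q' : ℂ → EReal} {ν : Measure ℂ} (h : ∀ᵐ z ∂ν, Q z ≤ Q' z) :
    weightedEnergy Q ν ≤ weightedEnergy Q' ν := by
  have hpos : energyPos Q ν ≤ energyPos Q' ν := by
    refine add_le_add le_rfl (lintegral_mono_ae ?_)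
    filter_upwards [h] with z hz using EReal.toENNReal_le_toENNReal hz
  have hneg : energyNeg Q' ν ≤ energyNeg Q ν := by
    refine add_le_add le_rfl (lintegral_mono_ae ?_)
    filter_upwards [h] with z hz using EReal.toENNReal_le_toENNReal (EReal.neg_le_neg_iff.2 hz)
  by_cases h' : energyPos Q' ν = ∞
  · rw [weightedEnergy, weightedEnergy, if_pos h']
    exact le_top
  · rw [weightedEnergy, weightedEnergy, if_neg h', if_neg (ne_top_of_le_ne_top h' hpos)]
    exact EReal.sub_le_sub (EReal.coe_ennreal_le_coe_ennreal_iff.2 hpos)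
      (EReal.coe_ennreal_le_coe_ennreal_iff.2 hneg)

lemma toENNReal_logKernel {z w : ℂ} (h : z ≠ w) :
    (logKernel z w).toENNReal = ENNReal.ofReal (-Real.log ‖z - w‖) := by
  rw [logKernel, log_enorm (sub_ne_zero.2 h), ← EReal.coe_neg, EReal.real_coe_toENNReal]

/-- Unlike the positive part, this needs no exclusion of the diagonal: the kernel is +∞ there, its
negative part is 0, and so is the real logarithm of 0. -/
lemma toENNReal_neg_logKernel (z w : ℂ) :
    (-logKernel z w).toENNReal = ENNReal.ofReal (Real.log ‖z - w‖) := by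
  rcases eq_or_ne z w with rfl | h
  · simp [logKernel]
  · rw [logKernel, log_enorm (sub_ne_zero.2 h), neg_neg, EReal.real_coe_toENNReal]

lemma measurable_toENNReal_logKernel :
    Measurable fun p : ℂ × ℂ => (logKernel p.1 p.2).toENNReal := by
  unfold logKernel
  exact measurable_ereal_toENNReal.comp
    ((by fun_prop : Measurable fun p : ℂ × ℂ => ‖p.1 - p.2‖ₑ).ennreal_log.neg)

lemma weightedEnergy_coe {ν : Measure ℂ} [IsFiniteMeasure ν] {F : ℂ → ℝ}
    (hν : LogIntegrable ν ν) (hF : Integrable F ν) :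
    weightedEnergy (fun z => (F z : EReal)) ν
      = ((2⁻¹ * -(∫ p : ℂ × ℂ, Real.log ‖p.1 - p.2‖ ∂(ν.prod ν)) + ∫ z, F z ∂ν : ℝ) : EReal) := by
  have h1 : ∫⁻ z, ∫⁻ w, (logKernel z w).toENNReal ∂ν ∂ν
      = ∫⁻ p : ℂ × ℂ, ENNReal.ofReal (-Real.log ‖p.1 - p.2‖) ∂(ν.prod ν) := by
    rw [← lintegral_prod (fun p : ℂ × ℂ => (logKernel p.1 p.2).toENNReal)
      measurable_toENNReal_logKernel.aemeasurable]
    refine lintegral_congr_ae ?_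
    filter_upwards [hν.ae_ne] with p hp using toENNReal_logKernel hp
  have h2 : ∫⁻ z, ∫⁻ w, (-logKernel z w).toENNReal ∂ν ∂ν
      = ∫⁻ p : ℂ × ℂ, ENNReal.ofReal (Real.log ‖p.1 - p.2‖) ∂(ν.prod ν) := by
    simp only [toENNReal_neg_logKernel]
    rw [lintegral_prod (fun p : ℂ × ℂ => ENNReal.ofReal (Real.log ‖p.1 - p.2‖))
      (Measurable.aemeasurable (by fun_prop))]
  have hfin1 := hν.integrable.neg.lintegral_lt_top.ne
  have hfin2 := hν.integrable.lintegral_lt_top.ne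
  have hfin3 := hF.lintegral_lt_top.ne
  have hfin4 := hF.neg.lintegral_lt_top.ne
  simp only [Pi.neg_apply] at hfin1 hfin4
  have hp : energyPos (fun z => (F z : EReal)) ν
      = 2⁻¹ * (∫⁻ p : ℂ × ℂ, ENNReal.ofReal (-Real.log ‖p.1 - p.2‖) ∂(ν.prod ν))
        + ∫⁻ z, ENNReal.ofReal (F z) ∂ν := by
    rw [energyPos, h1]; rfl
  have hn : energyNeg (fun z => (F z : EReal)) ν
      = 2⁻¹ * (∫⁻ p : ℂ × ℂ, ENNReal.ofReal (Real.log ‖p.1 - p.2‖) ∂(ν.prod ν))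
        + ∫⁻ z, ENNReal.ofReal (-F z) ∂ν := by
    rw [energyNeg, h2]; rfl
  have h2top : (2⁻¹ : ℝ≥0∞) ≠ ∞ := by simp
  have hpt : energyPos (fun z => (F z : EReal)) ν ≠ ∞ := by
    rw [hp]; exact ENNReal.add_ne_top.2 ⟨ENNReal.mul_ne_top h2top hfin1, hfin3⟩
  have hnt : energyNeg (fun z => (F z : EReal)) ν ≠ ∞ := by
    rw [hn]; exact ENNReal.add_ne_top.2 ⟨ENNReal.mul_ne_top h2top hfin2, hfin4⟩
  rw [weightedEnergy, if_neg hpt, ← ENNReal.ofReal_toReal hpt, ← ENNReal.ofReal_toReal hnt,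
    EReal.coe_ennreal_ofReal, EReal.coe_ennreal_ofReal, max_eq_left ENNReal.toReal_nonneg,
    max_eq_left ENNReal.toReal_nonneg, ← EReal.coe_sub, EReal.coe_eq_coe_iff, hp, hn,
    ENNReal.toReal_add (ENNReal.mul_ne_top h2top hfin1) hfin3,
    ENNReal.toReal_add (ENNReal.mul_ne_top h2top hfin2) hfin4,
    integral_eq_lintegral_pos_part_sub_lintegral_neg_part hF,
    integral_eq_lintegral_pos_part_sub_lintegral_neg_part hν.integrable,
    ENNReal.toReal_mul, ENNReal.toReal_mul, ENNReal.toReal_inv, ENNReal.toReal_ofNat]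
  ring

lemma log_norm_sub_le (z w : ℂ) :
    Real.log ‖z - w‖ ≤ Real.posLog ‖z‖ + Real.posLog ‖w‖ + Real.log 2 := by
  have h1 := Real.posLog_add (x := ‖z‖) (y := ‖w‖)
  have h2 : Real.posLog ‖z - w‖ ≤ Real.posLog (‖z‖ + ‖w‖) :=
    Real.monotoneOn_posLog (norm_nonneg _) (by positivity : (0 : ℝ) ≤ ‖z‖ + ‖w‖)
      (norm_sub_le z w)
  have h3 : Real.log ‖z - w‖ ≤ Real.posLog ‖z - w‖ := le_max_right _ _
  linarith

/-- The kernel is +∞ on the diagonal, so finiteness of its positive energy makes the diagonal null.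
The opposite sign of the kernel is controlled by log⁺‖z‖ + log⁺‖w‖ + log 2. -/
lemma logIntegrable_self {ν : Measure ℂ} [IsFiniteMeasure ν]
    (hlog : Integrable (fun z => Real.posLog ‖z‖) ν)
    (hfin : ∫⁻ z, ∫⁻ w, (logKernel z w).toENNReal ∂ν ∂ν ≠ ∞) : LogIntegrable ν ν := by
  rw [← lintegral_prod (fun p : ℂ × ℂ => (logKernel p.1 p.2).toENNReal)
      measurable_toENNReal_logKernel.aemeasurable] at hfin
  have hne : ∀ᵐ p ∂(ν.prod ν), p.1 ≠ p.2 := by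
    filter_upwards [ae_lt_top measurable_toENNReal_logKernel hfin] with p hp heq
    simp [logKernel, heq] at hp
  refine ⟨?_, hne⟩
  have hm : Integrable (fun p : ℂ × ℂ => (logKernel p.1 p.2).toENNReal.toReal) (ν.prod ν) :=
    integrable_toReal_of_lintegral_ne_top measurable_toENNReal_logKernel.aemeasurable hfin
  have hb : Integrable (fun p : ℂ × ℂ => Real.posLog ‖p.1‖ + Real.posLog ‖p.2‖ + Real.log 2)
      (ν.prod ν) := ((hlog.comp_fst ν).add (hlog.comp_snd ν)).add (integrable_const _)
  refine (hm.add hb).mono' (Measurable.aestronglyMeasurable (by fun_prop)) ?_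
  filter_upwards [hne] with p hp
  rw [Pi.add_apply, toENNReal_logKernel hp, Real.norm_eq_abs, ENNReal.toReal_ofReal']
  have h1 := log_norm_sub_le p.1 p.2
  have h2 : 0 ≤ Real.posLog ‖p.1‖ + Real.posLog ‖p.2‖ + Real.log 2 :=
    add_nonneg (add_nonneg Real.posLog_nonneg Real.posLog_nonneg) (Real.log_nonneg (by norm_num))
  have h3 := le_max_left (-Real.log ‖p.1 - p.2‖) 0
  have h4 := le_max_right (-Real.log ‖p.1 - p.2‖) 0
  exact abs_le.2 ⟨by linarith, by linarith⟩

lemma LogIntegrable.symm {α β : Measure ℂ} [IsFiniteMeasure α] [IsFiniteMeasure β]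
    (h : LogIntegrable α β) : LogIntegrable β α where
  integrable := by
    refine h.integrable.swap.congr (ae_of_all _ fun p => ?_)
    simp [Function.comp, norm_sub_rev]
  ae_ne := by
    have := (Measure.measurePreserving_swap (μ := β) (ν := α)).quasiMeasurePreserving.ae h.ae_ne
    filter_upwards [this] with p hp using hp.symm

lemma integral_log_norm_sub_comm (α β : Measure ℂ) [IsFiniteMeasure α] [IsFiniteMeasure β] :
    ∫ p : ℂ × ℂ, Real.log ‖p.1 - p.2‖ ∂(β.prod α)
      = ∫ p : ℂ × ℂ, Real.log ‖p.1 - p.2‖ ∂(α.prod β) := by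
  rw [← integral_prod_swap]
  exact integral_congr_ae (ae_of_all _ fun p => by simp [norm_sub_rev])

/-! ### The radial measure as equilibrium measure -/

namespace ConvexProfile

variable {v : ℝ → ℝ} {κ b : ℝ}

instance : NullSingletonClass angleMeasure := by
  unfold angleMeasure
  refine ⟨fun θ => ?_⟩
  simp

lemma ae_radialMeasure_ne (v : ℝ → ℝ) (κ : ℝ) (z : ℂ) :
    ∀ᵐ a ∂(radialMeasure v κ), z ≠ a := by
  have hm : MeasurableSet {a : ℂ | z ≠ a} :=
    (measurableSet_eq_fun measurable_const measurable_id).compl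
  rw [radialMeasure, ae_map_iff (measurable_radialMap v).aemeasurable hm]
  refine (Measure.ae_prod_iff_ae_ae (measurable_radialMap v hm)).2 ?_
  refine ae_of_all _ fun t => ?_
  have hnull := ((Set.countable_singleton z).preimage_circleMap 0
    (Real.exp_pos (rightSlope v t)).ne').measure_zero angleMeasure
  filter_upwards [measure_eq_zero_iff_ae_notMem.1 hnull] with θ hθ heq using hθ heq.symm

/-- The absolute potential of the radial measure grows at most logarithmically, so a logarithmic
moment of ν suffices. The diagonal is null because the radial measure has no atoms. -/
lemma logIntegrable_radialMeasure (h : ConvexProfile v κ b) {ν : Measure ℂ} [IsFiniteMeasure ν]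
    (hlog : Integrable (fun z => Real.posLog ‖z‖) ν) : LogIntegrable ν (radialMeasure v κ) where
  integrable := by
    have hm : Measurable fun p : ℂ × ℂ => Real.log ‖p.1 - p.2‖ := by fun_prop
    rw [integrable_prod_iff hm.aestronglyMeasurable]
    refine ⟨ae_of_all _ h.integrable_log_sub, ?_⟩
    have hbd : Integrable (fun z => κ * (2 * (Real.posLog ‖z‖
        + Real.posLog (Real.exp (rightSlope v κ)) + Real.log 2))
        + ∫ t in Set.Ioc 0 κ, |rightSlope v t|) ν :=
      ((((hlog.add (integrable_const _)).add (integrable_const _)).const_mul 2).const_mul κ).add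
        (integrable_const _)
    refine hbd.mono' hm.norm.stronglyMeasurable.integral_prod_right'.aestronglyMeasurable
      (ae_of_all _ fun z => ?_)
    rw [Real.norm_eq_abs, abs_of_nonneg (integral_nonneg fun a => norm_nonneg _)]
    refine (h.integral_abs_log_sub_le z).trans ?_
    have h1 := Real.posLog_add (x := ‖z‖) (y := Real.exp (rightSlope v κ))
    have := h.pos
    gcongr
    linarith
  ae_ne := by
    rw [Measure.ae_prod_iff_ae_ae]
    · exact ae_of_all _ (ae_radialMeasure_ne v κ)
    · exact (measurableSet_eq_fun measurable_fst measurable_snd).compl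

lemma integrable_posLog_radialMeasure (h : ConvexProfile v κ b) :
    Integrable (fun z : ℂ => Real.posLog ‖z‖) (radialMeasure v κ) := by
  refine (integrable_const (Real.posLog (Real.exp (rightSlope v κ)))).mono'
    (Measurable.aestronglyMeasurable (by fun_prop)) ?_
  filter_upwards [h.ae_norm_le] with z hz
  rw [Real.norm_eq_abs, abs_of_nonneg Real.posLog_nonneg]
  exact Real.monotoneOn_posLog (norm_nonneg z) (Real.exp_pos _).le hz

lemma integral_radialPotential (h : ConvexProfile v κ b) {ν : Measure ℂ} [IsFiniteMeasure ν]
    (hν : LogIntegrable ν (radialMeasure v κ)) :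
    Integrable (radialPotential v κ) ν ∧ ∫ z, radialPotential v κ z ∂ν
      = (∫ p : ℂ × ℂ, Real.log ‖p.1 - p.2‖ ∂(ν.prod (radialMeasure v κ)))
        - ν.real Set.univ * v κ := by
  have h1 : Integrable (fun z => logPotential (radialMeasure v κ) z) ν :=
    hν.integrable.integral_prod_left
  have h2 : radialPotential v κ = fun z => logPotential (radialMeasure v κ) z - v κ :=
    funext h.radialPotential_eq
  rw [h2]
  refine ⟨h1.sub (integrable_const _), ?_⟩
  rw [integral_sub h1 (integrable_const _), integral_prod _ hν.integrable, integral_const,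
    smul_eq_mul]
  rfl

/-- The field is at least κ log‖z‖ - v(κ) away from 0, so a competitor of finite positive energy has
a logarithmic moment. This rules out ∞ - ∞ for all energies compared below. -/
lemma integrable_posLog_of_energyPos (h : ConvexProfile v κ b) {ν : Measure ℂ}
    [IsFiniteMeasure ν] {Q : ℂ → EReal} (hQ : ∀ z, ((radialPotential v κ z : ℝ) : EReal) ≤ Q z)
    (hfin : energyPos Q ν ≠ ∞) : Integrable (fun z => Real.posLog ‖z‖) ν := by
  have hQfin : ∫⁻ z, ENNReal.ofReal (radialPotential v κ z) ∂ν ≠ ∞ :=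
    ne_top_of_le_ne_top (ENNReal.add_ne_top.1 hfin).2
      (lintegral_mono fun z => EReal.toENNReal_le_toENNReal (hQ z))
  have hm : Measurable fun z => ENNReal.ofReal (radialPotential v κ z) :=
    h.continuous_radialPotential.measurable.ennreal_ofReal
  have hi := integrable_toReal_of_lintegral_ne_top hm.aemeasurable hQfin
  refine ((hi.add (integrable_const |v κ|)).const_mul κ⁻¹).mono'
    (Measurable.aestronglyMeasurable (by fun_prop)) (ae_of_all _ fun z => ?_)
  have hκ := h.pos
  rw [Real.norm_eq_abs, abs_of_nonneg Real.posLog_nonneg, ← div_eq_inv_mul, le_div_iff₀' hκ,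
    Pi.add_apply, ENNReal.toReal_ofReal']
  have h1 := le_max_left (radialPotential v κ z) 0
  have h2 := le_max_right (radialPotential v κ z) 0
  rcases le_or_gt (Real.log ‖z‖) 0 with hz | hz
  · rw [Real.posLog_apply, max_eq_left hz, mul_zero]
    positivity
  · have hz0 : z ≠ 0 := by rintro rfl; simp at hz
    rw [Real.posLog_apply, max_eq_right hz.le]
    have h3 := h.le_radialPotential hz0 ⟨hκ.le, le_rfl⟩
    have h4 := neg_abs_le (v κ)
    have h5 := le_abs_self (v κ)
    linarith

/-- The radial measure minimises the weighted energy in any external field which dominates its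
potential and agrees with it almost everywhere. -/
theorem isEquilibriumMeasure_radialMeasure (h : ConvexProfile v κ b) {Q : ℂ → EReal}
    (hQ : ∀ z, ((radialPotential v κ z : ℝ) : EReal) ≤ Q z)
    (hQ' : ∀ᵐ z ∂(radialMeasure v κ), Q z ≤ ((radialPotential v κ z : ℝ) : EReal)) :
    IsEquilibriumMeasure Q κ (radialMeasure v κ) := by
  refine ⟨radialMeasure_univ v κ, fun ν hνκ hne => ?_⟩
  have hνf : IsFiniteMeasure ν := ⟨by rw [hνκ]; exact ENNReal.ofReal_lt_top⟩
  have hμμ := h.logIntegrable_radialMeasure h.integrable_posLog_radialMeasure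
  obtain ⟨hμV, hμE⟩ := h.integral_radialPotential hμμ
  refine (weightedEnergy_mono hQ').trans_lt ?_
  rw [weightedEnergy_coe hμμ hμV]
  by_cases hfin : energyPos Q ν = ∞
  · rw [weightedEnergy, if_pos hfin]
    exact EReal.coe_lt_top _
  have hlog := h.integrable_posLog_of_energyPos hQ hfin
  have hνμ := h.logIntegrable_radialMeasure hlog
  have hνν : LogIntegrable ν ν := by
    refine logIntegrable_self hlog fun htop => (ENNReal.add_ne_top.1 hfin).1 ?_
    rw [htop, ENNReal.mul_top (by simp)]
  obtain ⟨hνV, hνE⟩ := h.integral_radialPotential hνμ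
  refine lt_of_lt_of_le ?_ (weightedEnergy_mono (ae_of_all _ hQ))
  rw [weightedEnergy_coe hνν hνV, EReal.coe_lt_coe_iff, hμE, hνE]
  have hmass : ν.real Set.univ = (radialMeasure v κ).real Set.univ := by
    rw [measureReal_def, measureReal_def, hνκ, radialMeasure_univ]
  -- Integrating the potential against either measure gives mutual energies and the same constant,
  -- as the masses agree. What remains is half the energy of the difference.
  have hpos := logEnergy_sub_pos hne hmass hνν hνμ hνμ.symm hμμ
  rw [integral_log_norm_sub_comm ν (radialMeasure v κ)] at hpos
  rw [hmass]
  linarith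

end ConvexProfile

end ZeroEquilibrium

/-! ### Identification of the limit and its minimality -/

theorem proposition2p10 {Ω : Type*} [MeasurableSpace Ω] (P : Measure Ω) [IsProbabilityMeasure P]
    (ξ : ℕ → Ω → ℂ) (hξ : ZeroEquilibrium.IsCoefficientNoise P ξ)
    (a : ℕ → ℕ → ℂ) (f : ℝ → ℝ) (T₀ : EReal)
    (hf : ZeroEquilibrium.IsCoefficientProfile a f T₀)
    (hconv : ConvexOn ℝ {t : ℝ | 0 < t ∧ (t : EReal) < T₀} (fun t => -Real.log (f t)))
    (κ : ℝ) (hκ : 0 < κ) (hκT : (κ : EReal) < T₀) :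
    (∃! μ : Measure ℂ, ZeroEquilibrium.IsLimitingZeroMeasure P ξ a κ μ) ∧
    ∀ μ : Measure ℂ, ZeroEquilibrium.IsLimitingZeroMeasure P ξ a κ μ →
      ZeroEquilibrium.IsEquilibriumMeasure (ZeroEquilibrium.externalField f) κ μ := by
  obtain ⟨b, hb1, hb2⟩ := EReal.lt_iff_exists_real_btwn.1 hκT
  have h := hf.convexProfile hconv hκ (EReal.coe_lt_coe_iff.1 hb1) hb2.le
  have hlim := ZeroEquilibrium.isLimitingZeroMeasure_radialMeasure hξ hf h hκT
  refine ⟨⟨_, hlim, fun ν hν => hν.unique hlim⟩, fun μ hμ => ?_⟩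
  rw [hμ.unique hlim]
  refine h.isEquilibriumMeasure_radialMeasure
    (ZeroEquilibrium.radialPotential_le_externalField hf h hκT) ?_
  filter_upwards [h.ae_norm_le] with z hz
  exact ZeroEquilibrium.externalField_le_radialPotential hf hconv h hκT hz
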